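/- Let $N\in\mathbb N$, let $\mathcal H=L^2(\mathbb R^N,dq)$, and let $X=\mathbb R^N\times\mathbb R^N$ be phase space with the measure $dx=(2\pi)^{-N}dq\,dp$. For $x=(q,p)\in X$ let $W(x)$ be the Weyl operator on $\mathcal H$, $$(W(q,p)\psi)(y)=e^{-\frac i2 q\cdot p}\,e^{ip\cdot y}\,\psi(y-q).$$ For a trace class operator $T$ on $\mathcal H$ its Weyl transform is the function $\widehat T(x)=\operatorname{Tr}[W(x)T]$ on $X$; for a Hilbert–Schmidt operator $T$, $\widehat T\in L^2(X,dx)$ is defined by extending this map continuously from the trace class operators with the Hilbert–Schmidt norm to all Hilbert–Schmidt operators. Let $Q_i$ be multiplication by the coordinate $q_i$, let $P_i=-i\,\partial/\partial q_i$, and for multi-indices put $Q^\alpha=Q_1^{\alpha_1}\cdots Q_N^{\alpha_N}$, $P^\beta=P_1^{\beta_1}\cdots P_N^{\beta_N}$, acting on the Schwartz space $\mathcal S(\mathbb R^N)$. A bounded operator $T$ on $\mathcal H$ is called a Schwartz operator if for all multi-indices $\alpha,\alpha',\beta,\beta'$ $$\|T\|_{\alpha,\alpha',\beta,\beta'}:=\sup\bigl\{|\langle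 P^\beta Q^\alpha\psi\,|\,T P^{\beta'}Q^{\alpha'}\varphi\rangle| : \psi,\varphi\in\mathcal S(\mathbb R^N),\ \|\psi\|_{\mathcal H}\le 1,\ \|\varphi\|_{\mathcal H}\le 1\bigr\}<\infty .$$ The space $\mathcal S(\mathcal H)$ of Schwartz operators carries the locally convex topology given by these seminorms, and $\mathcal S(X)$ is the Schwartz space on $X$ with its usual topology. Then the Weyl transform $\widehat T\in L^2(X,dx)$ of every Hilbert–Schmidt operator $T$ on $\mathcal H$ is well defined, and $T\in\mathcal S(\mathcal H)$ if and only if $\widehat T\in\mathcal S(X)$, i.e. if and only if $\widehat T$ coincides almost everywhere with a Schwartz function on $X$. Every Schwartz operator is trace class (hence Hilbert–Schmidt), and the Weyl transform restricts to a linear topological isomorphism $\mathcal S(\mathcal H)\to\mathcal S(X)$, given for $T\in\mathcal S(\mathcal H)$ by $\widehat T(x)=\operatorname{Tr}[W(x)T]$ for every $x\in X$. -/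

import Mathlib

open scoped SchwartzMap InnerProductSpace

namespace QuantumHA

noncomputable section

/-! ### Hilbert–Schmidt and trace class operators on a complex Hilbert space -/

section Hilbert

variable {H : Type*} [NormedAddCommGroup H] [InnerProductSpace ℂ H] [CompleteSpace H]

/-- The index set of an orthonormal basis of `H`, chosen once and for all.  None of the quantities
below depends on the choice. -/
def onbIndex (H : Type*) [NormedAddCommGroup H] [InnerProductSpace ℂ H] [CompleteSpace H] :
    Set H :=
  (exists_hilbertBasis ℂ H).choose

/-- An orthonormal basis of `H`, chosen once and for all. -/
def onb (H : Type*) [NormedAddCommGroup H] [InnerProductSpace ℂ H] [CompleteSpace H] :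
    HilbertBasis (onbIndex H) ℂ H :=
  (exists_hilbertBasis ℂ H).choose_spec.choose

/-- The Hilbert–Schmidt norm `‖T‖₂ = (∑ₖ ‖T eₖ‖²)^{1/2} = (Tr |T|²)^{1/2}`, with value in
`[0, ∞]`. -/
def hsNorm (T : H →L[ℂ] H) : ENNReal :=
  (∑' k, ‖T (onb H k)‖ₑ ^ 2) ^ (1 / 2 : ℝ)

/-- `T` is a Hilbert–Schmidt operator. -/
def IsHilbertSchmidt (T : H →L[ℂ] H) : Prop :=
  hsNorm T < ⊤

/-- The trace norm `‖T‖₁ = Tr |T| = ∑ₖ ⟨eₖ, |T| eₖ⟩`, where `|T| = √(T* T)`, with value in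
`[0, ∞]`. -/
def traceNorm (T : H →L[ℂ] H) : ENNReal :=
  ∑' k, ENNReal.ofReal (RCLike.re ⟪onb H k, CFC.abs T (onb H k)⟫_ℂ)

/-- `T` is a trace class operator. -/
def IsTraceClass (T : H →L[ℂ] H) : Prop :=
  traceNorm T < ⊤

/-- The trace `Tr T = ∑ₖ ⟨eₖ, T eₖ⟩` (the sum is absolutely convergent if `T` is trace class). -/
def opTrace (T : H →L[ℂ] H) : ℂ :=
  ∑' k, ⟪onb H k, T (onb H k)⟫_ℂ

/-- The trace class operators that approach `T` in the Hilbert–Schmidt norm: the trace of the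
Hilbert–Schmidt neighbourhood filter of `T` on the trace class. -/
def traceClassNhds (T : H →L[ℂ] H) : Filter (H →L[ℂ] H) :=
  Filter.comap (fun S => hsNorm (S - T)) (nhds 0) ⊓ Filter.principal {S | IsTraceClass S}

end Hilbert

/-! ### Configuration space, phase space, Weyl operators -/

/-- Configuration space `ℝᴺ`. -/
abbrev Config (N : ℕ) : Type := EuclideanSpace ℝ (Fin N)

/-- Phase space `X = ℝᴺ × ℝᴺ` of position-momentum pairs `(q, p)`. -/
abbrev Phase (N : ℕ) : Type := Config N × Config N

/-- The Hilbert space `L²(ℝᴺ, dq)`. -/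
abbrev Hilb (N : ℕ) : Type :=
  MeasureTheory.Lp ℂ 2 (MeasureTheory.volume : MeasureTheory.Measure (Config N))

/-- The measure `dx = (2π)⁻ᴺ dq dp` on phase space. -/
def phaseMeasure (N : ℕ) : MeasureTheory.Measure (Phase N) :=
  ENNReal.ofReal (((2 * Real.pi) ^ N)⁻¹) • MeasureTheory.volume

/-- The factor `e^{-(i/2) q·p} e^{i p·y}` of the Weyl operator `W(q, p)`. -/
def weylPhase {N : ℕ} (x : Phase N) (y : Config N) : ℂ :=
  Complex.exp (-(Complex.I / 2) * (⟪x.1, x.2⟫_ℝ : ℝ)) * Complex.exp (Complex.I * (⟪x.2, y⟫_ℝ : ℝ))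

theorem norm_weylPhase {N : ℕ} (x : Phase N) (y : Config N) : ‖weylPhase x y‖ = 1 := by
  rw [weylPhase, norm_mul, Complex.norm_exp, Complex.norm_exp]
  simp

theorem continuous_weylPhase {N : ℕ} (x : Phase N) : Continuous (weylPhase x) := by
  unfold weylPhase
  fun_prop

theorem memLp_weyl {N : ℕ} (x : Phase N) (ψ : Hilb N) :
    MeasureTheory.MemLp (fun y => weylPhase x y * ψ (y - x.1)) 2 MeasureTheory.volume := by
  have h := (MeasureTheory.Lp.memLp ψ).comp_measurePreserving
    (MeasureTheory.measurePreserving_sub_right MeasureTheory.volume x.1)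
  refine h.of_le ((continuous_weylPhase x).aestronglyMeasurable.mul h.1) ?_
  filter_upwards with y
  simp [norm_weylPhase]

/-- The Weyl operator, `(W(q, p) ψ)(y) = e^{-(i/2) q·p} e^{i p·y} ψ(y - q)`. -/
def weylOp {N : ℕ} (x : Phase N) : Hilb N →L[ℂ] Hilb N :=
  LinearMap.mkContinuous
    { toFun := fun ψ => (memLp_weyl x ψ).toLp _
      map_add' := by
        intro ψ φ
        rw [← MeasureTheory.MemLp.toLp_add, MeasureTheory.MemLp.toLp_eq_toLp_iff]
        have h := (MeasureTheory.measurePreserving_sub_right MeasureTheory.volume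
          x.1).quasiMeasurePreserving.ae (MeasureTheory.Lp.coeFn_add ψ φ)
        filter_upwards [h] with y hy
        simp only [Pi.add_apply] at hy ⊢
        rw [hy, mul_add]
      map_smul' := by
        intro c ψ
        rw [RingHom.id_apply, ← MeasureTheory.MemLp.toLp_const_smul,
          MeasureTheory.MemLp.toLp_eq_toLp_iff]
        have h := (MeasureTheory.measurePreserving_sub_right MeasureTheory.volume
          x.1).quasiMeasurePreserving.ae (MeasureTheory.Lp.coeFn_smul c ψ)
        filter_upwards [h] with y hy
        simp only [Pi.smul_apply, smul_eq_mul] at hy ⊢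
        rw [hy]
        ring }
    1 (by
      intro ψ
      have h := (MeasureTheory.Lp.memLp ψ).comp_measurePreserving
        (MeasureTheory.measurePreserving_sub_right MeasureTheory.volume x.1)
      rw [one_mul, LinearMap.coe_mk, AddHom.coe_mk, MeasureTheory.Lp.norm_toLp,
        MeasureTheory.Lp.norm_def]
      refine le_of_eq (congrArg ENNReal.toReal ?_)
      rw [← MeasureTheory.eLpNorm_comp_measurePreserving (MeasureTheory.Lp.memLp ψ).1
        (MeasureTheory.measurePreserving_sub_right MeasureTheory.volume x.1)]
      refine MeasureTheory.eLpNorm_congr_norm_ae ?_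
      filter_upwards with y
      simp [norm_weylPhase])

theorem weylOp_apply {N : ℕ} (q p : Config N) (ψ : Hilb N) :
    weylOp (q, p) ψ =ᵐ[MeasureTheory.volume] fun y =>
      Complex.exp (-(Complex.I / 2) * (⟪q, p⟫_ℝ : ℝ)) * Complex.exp (Complex.I * (⟪p, y⟫_ℝ : ℝ)) *
        ψ (y - q) :=
  (memLp_weyl (q, p) ψ).coeFn_toLp

/-! ### Schwartz operators -/

/-- The position operator `Qᵢ` on Schwartz functions, multiplication by the `i`-th coordinate. -/
def posOp {N : ℕ} (i : Fin N) : 𝓢(Config N, ℂ) →L[ℂ] 𝓢(Config N, ℂ) :=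
  SchwartzMap.smulLeftCLM ℂ fun q : Config N => ((q i : ℝ) : ℂ)

/-- The momentum operator `Pᵢ = -i ∂/∂qᵢ` on Schwartz functions. -/
def momOp {N : ℕ} (i : Fin N) : 𝓢(Config N, ℂ) →L[ℂ] 𝓢(Config N, ℂ) :=
  -Complex.I • LineDeriv.lineDerivOpCLM ℂ 𝓢(Config N, ℂ) (EuclideanSpace.single i (1 : ℝ))

theorem posOp_apply {N : ℕ} (i : Fin N) (φ : 𝓢(Config N, ℂ)) (q : Config N) :
    posOp i φ q = (q i : ℂ) * φ q := by
  have h : Function.HasTemperateGrowth fun q : Config N => ((q i : ℝ) : ℂ) :=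
    (Complex.ofRealCLM.comp (EuclideanSpace.proj i : Config N →L[ℝ] ℝ)).hasTemperateGrowth
  rw [posOp, SchwartzMap.smulLeftCLM_apply_apply h, smul_eq_mul]

theorem momOp_apply {N : ℕ} (i : Fin N) (φ : 𝓢(Config N, ℂ)) (q : Config N) :
    momOp i φ q = -Complex.I * lineDeriv ℝ φ q (EuclideanSpace.single i 1) := by
  rw [momOp, ← SchwartzMap.lineDerivOp_apply]
  rfl

/-- The multi-index power `Aᵅ = A₁^{α₁} ⋯ A_N^{α_N}`. -/
def multiPow {N : ℕ} (A : Fin N → 𝓢(Config N, ℂ) →L[ℂ] 𝓢(Config N, ℂ)) (α : Fin N → ℕ) :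
    𝓢(Config N, ℂ) →L[ℂ] 𝓢(Config N, ℂ) :=
  (List.ofFn fun i => A i ^ α i).prod

/-- The vector `P^β Q^α ψ`, as an element of the Hilbert space. -/
def momPos {N : ℕ} (β α : Fin N → ℕ) (ψ : 𝓢(Config N, ℂ)) : Hilb N :=
  (multiPow momOp β (multiPow posOp α ψ)).toLp 2

/-- An index `(α, α', β, β')` of four multi-indices. -/
abbrev Idx (N : ℕ) : Type := (Fin N → ℕ) × (Fin N → ℕ) × (Fin N → ℕ) × (Fin N → ℕ)

/-- The set of all `|⟨P^β Q^α ψ, T P^β' Q^α' φ⟩|`, where `ψ`, `φ` are Schwartz functions in the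
unit ball of the Hilbert space, and where `k = (α, α', β, β')`. -/
def formValues {N : ℕ} (k : Idx N) (T : Hilb N →L[ℂ] Hilb N) : Set ℝ :=
  {r | ∃ ψ φ : 𝓢(Config N, ℂ), ‖ψ.toLp 2 MeasureTheory.volume‖ ≤ 1 ∧
    ‖φ.toLp 2 MeasureTheory.volume‖ ≤ 1 ∧
    r = ‖⟪momPos k.2.2.1 k.1 ψ, T (momPos k.2.2.2 k.2.1 φ)⟫_ℂ‖}

/-- `T` is a Schwartz operator: `‖T‖_{α,α',β,β'} < ∞` for all `α, α', β, β'`. -/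
def IsSchwartzOperator {N : ℕ} (T : Hilb N →L[ℂ] Hilb N) : Prop :=
  ∀ k : Idx N, BddAbove (formValues k T)

theorem zero_mem_formValues {N : ℕ} (k : Idx N) (T : Hilb N →L[ℂ] Hilb N) :
    (0 : ℝ) ∈ formValues k T := by
  have h0 : momPos k.2.2.1 k.1 (0 : 𝓢(Config N, ℂ)) = 0 := by
    rw [momPos, map_zero, map_zero]
    exact map_zero (SchwartzMap.toLpCLM ℂ (E := Config N) ℂ 2 MeasureTheory.volume)
  have h1 : ‖(0 : 𝓢(Config N, ℂ)).toLp 2 MeasureTheory.volume‖ ≤ 1 := by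
    have : (0 : 𝓢(Config N, ℂ)).toLp 2 MeasureTheory.volume = 0 :=
      map_zero (SchwartzMap.toLpCLM ℂ (E := Config N) ℂ 2 MeasureTheory.volume)
    rw [this, norm_zero]
    exact zero_le_one
  exact ⟨0, 0, h1, h1, by rw [h0, inner_zero_left, norm_zero]⟩

theorem formValues_add_le {N : ℕ} {k : Idx N} {S T : Hilb N →L[ℂ] Hilb N} {a b r : ℝ}
    (hS : a ∈ upperBounds (formValues k S)) (hT : b ∈ upperBounds (formValues k T))
    (hr : r ∈ formValues k (S + T)) : r ≤ a + b := by
  obtain ⟨ψ, φ, hψ, hφ, rfl⟩ := hr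
  rw [add_apply, inner_add_right]
  exact (norm_add_le _ _).trans (add_le_add (hS ⟨ψ, φ, hψ, hφ, rfl⟩) (hT ⟨ψ, φ, hψ, hφ, rfl⟩))

theorem formValues_smul_le {N : ℕ} {k : Idx N} {T : Hilb N →L[ℂ] Hilb N} {b r : ℝ} (c : ℂ)
    (hT : b ∈ upperBounds (formValues k T)) (hr : r ∈ formValues k (c • T)) : r ≤ ‖c‖ * b := by
  obtain ⟨ψ, φ, hψ, hφ, rfl⟩ := hr
  rw [smul_apply, inner_smul_right, norm_mul]
  exact mul_le_mul_of_nonneg_left (hT ⟨ψ, φ, hψ, hφ, rfl⟩) (norm_nonneg c)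

theorem formValues_zero_le {N : ℕ} {k : Idx N} {r : ℝ}
    (hr : r ∈ formValues k (0 : Hilb N →L[ℂ] Hilb N)) : r ≤ 0 := by
  obtain ⟨ψ, φ, _, _, rfl⟩ := hr
  simp

/-- The Schwartz operators as a linear subspace of the bounded operators. -/
def schwartzSubmodule (N : ℕ) : Submodule ℂ (Hilb N →L[ℂ] Hilb N) where
  carrier := {T | IsSchwartzOperator T}
  add_mem' := fun hS hT k => by
    obtain ⟨a, ha⟩ := hS k
    obtain ⟨b, hb⟩ := hT k
    exact ⟨a + b, fun r hr => formValues_add_le ha hb hr⟩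
  zero_mem' := fun _ => ⟨0, fun _ hr => formValues_zero_le hr⟩
  smul_mem' := fun c _ hT k => by
    obtain ⟨b, hb⟩ := hT k
    exact ⟨‖c‖ * b, fun r hr => formValues_smul_le c hb hr⟩

/-- The space `𝓢(H)` of Schwartz operators.  (A copy of the subspace above, so that it carries its
own topology and not the one of the operator norm.) -/
def SchwartzOperator (N : ℕ) : Type := schwartzSubmodule N

instance (N : ℕ) : AddCommGroup (SchwartzOperator N) :=
  inferInstanceAs (AddCommGroup (schwartzSubmodule N))

instance (N : ℕ) : Module ℂ (SchwartzOperator N) :=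
  inferInstanceAs (Module ℂ (schwartzSubmodule N))

/-- The bounded operator underlying a Schwartz operator. -/
def SchwartzOperator.toCLM {N : ℕ} (T : SchwartzOperator N) : Hilb N →L[ℂ] Hilb N :=
  Subtype.val (p := fun T => T ∈ schwartzSubmodule N) T

theorem SchwartzOperator.isSchwartz {N : ℕ} (T : SchwartzOperator N) :
    IsSchwartzOperator T.toCLM :=
  Subtype.property (p := fun T => T ∈ schwartzSubmodule N) T

/-- The seminorm `‖T‖_{α,α',β,β'} = sup |⟨P^β Q^α ψ, T P^β' Q^α' φ⟩|` on `𝓢(H)`, the supremum being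
over Schwartz functions `ψ`, `φ` in the unit ball of the Hilbert space. -/
def SchwartzOperator.seminorm {N : ℕ} (k : Idx N) : Seminorm ℂ (SchwartzOperator N) :=
  Seminorm.ofSMulLE (fun T => sSup (formValues k T.toCLM))
    (le_antisymm (csSup_le ⟨0, zero_mem_formValues k _⟩ fun _ hr => formValues_zero_le hr)
      (le_csSup ((0 : SchwartzOperator N).isSchwartz k) (zero_mem_formValues k _)))
    (fun S T => csSup_le ⟨0, zero_mem_formValues k _⟩ fun _ hr =>
      formValues_add_le (fun _ h => le_csSup (S.isSchwartz k) h)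
        (fun _ h => le_csSup (T.isSchwartz k) h) hr)
    (fun c T => csSup_le ⟨0, zero_mem_formValues k _⟩ fun _ hr =>
      formValues_smul_le c (fun _ h => le_csSup (T.isSchwartz k) h) hr)

/-- The family of all seminorms `‖·‖_{α,α',β,β'}`. -/
def schwartzOperatorSeminorms (N : ℕ) : SeminormFamily ℂ (SchwartzOperator N) (Idx N) :=
  fun k => SchwartzOperator.seminorm k

/-- The locally convex topology of `𝓢(H)`, given by the seminorms `‖·‖_{α,α',β,β'}`. -/
instance (N : ℕ) : TopologicalSpace (SchwartzOperator N) :=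
  (schwartzOperatorSeminorms N).moduleFilterBasis.topology

theorem schwartzOperator_withSeminorms (N : ℕ) : WithSeminorms (schwartzOperatorSeminorms N) :=
  ⟨rfl⟩

/-! ### The Weyl transform -/

/-- The function `x ↦ Tr[W(x) T]` on phase space, for `T` trace class. -/
def weylFun {N : ℕ} (T : Hilb N →L[ℂ] Hilb N) (x : Phase N) : ℂ :=
  opTrace (weylOp x ∘L T)

open scoped Classical in
/-- The element of `L²(X, dx)` given by `x ↦ Tr[W(x) T]`; by convention `0` if that function is not
square integrable. -/
def weylLp {N : ℕ} (T : Hilb N →L[ℂ] Hilb N) : MeasureTheory.Lp ℂ 2 (phaseMeasure N) :=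
  if h : MeasureTheory.MemLp (weylFun T) 2 (phaseMeasure N) then h.toLp _ else 0

/-- `f ∈ L²(X, dx)` is the Weyl transform of the Hilbert–Schmidt operator `T`, that is, the value
at `T` of the extension by continuity of the map `S ↦ Tr[W(·) S]` from the trace class operators
with the Hilbert–Schmidt norm to `L²(X, dx)`: as trace class operators `S` approach `T` in
Hilbert–Schmidt norm, `Tr[W(·) S]` is square integrable and converges to `f` in `L²(X, dx)`. -/
structure IsWeylTransform {N : ℕ} (T : Hilb N →L[ℂ] Hilb N)
    (f : MeasureTheory.Lp ℂ 2 (phaseMeasure N)) : Prop where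
  neBot : (traceClassNhds T).NeBot
  memLp : ∀ᶠ S in traceClassNhds T, MeasureTheory.MemLp (weylFun S) 2 (phaseMeasure N)
  tendsto : Filter.Tendsto weylLp (traceClassNhds T) (nhds f)

/-- The Weyl transform is unique. -/
theorem IsWeylTransform.unique {N : ℕ} {T : Hilb N →L[ℂ] Hilb N}
    {f g : MeasureTheory.Lp ℂ 2 (phaseMeasure N)}
    (hf : IsWeylTransform T f) (hg : IsWeylTransform T g) : f = g :=
  haveI := hf.neBot
  tendsto_nhds_unique hf.tendsto hg.tendsto

/-- The Weyl transform of a trace class operator `T` is the function `x ↦ Tr[W(x) T]`. -/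
theorem IsWeylTransform.ae_eq_of_isTraceClass {N : ℕ} {T : Hilb N →L[ℂ] Hilb N}
    {f : MeasureTheory.Lp ℂ 2 (phaseMeasure N)}
    (hf : IsWeylTransform T f) (hT : IsTraceClass T) :
    f =ᵐ[phaseMeasure N] fun x => opTrace (weylOp x ∘L T) := by
  have h0 : hsNorm (T - T) = 0 := by simp [hsNorm]
  have hp : pure T ≤ traceClassNhds T := by
    refine le_inf (Filter.map_le_iff_le_comap.mp ?_) (by simpa using hT)
    rw [Filter.map_pure, h0]
    exact pure_le_nhds 0
  have hm : MeasureTheory.MemLp (weylFun T) 2 (phaseMeasure N) := hf.memLp.filter_mono hp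
  have hw : weylLp T = f := by
    have := (hf.tendsto.mono_left hp)
    exact tendsto_nhds_unique (tendsto_pure_nhds weylLp T) this
  rw [← hw, weylLp, dif_pos hm]
  exact hm.coeFn_toLp

end

end QuantumHA

namespace QuantumHA

noncomputable section

open MeasureTheory Filter Topology

/-! ### Hilbert–Schmidt and trace class operators: Parseval, factorization, summability of diagonals
-/

section HilbertSpace

variable {H : Type*} [NormedAddCommGroup H] [InnerProductSpace ℂ H] [CompleteSpace H]

/-! Write σ for the symplectic form and G_v = b·Q − a·P for v = (a, b). Three facts about the Weyl
operators carry the proof: the intertwining relation G_v W(z) = W(z) G_v + σ(v, z) W(z)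
(`fieldOp_weylS`); the derivative ∂_v W = (i/2)(G_v W + W G_v) in matrix coefficients
(`hasFDerivAt_coeff`); and the orthogonality relations ∫ conj⟨u, W(z)v⟩ ⟨u', W(z)v'⟩ dz = ⟨v,
v'⟩⟨u', u⟩ (`inner_coeffLp_coeffLp`), which are Plancherel in the momentum variable.

Hilbert–Schmidt operators: by orthogonality T ↦ Σ_k ⟨e_k, W(·) T e_k⟩ is an isometry into L². On the
trace class, which is dense, it is Tr[W(·)T], so it is the continuous extension sought
(`isWeylTransform_weylHS`).

From operators to functions: orthogonality also resolves the identity into coherent states W(x)g,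
whence T = ∫ |T W(x)g⟩⟨W(x)g| dx. The intertwining relation trades a factor σ(v, x) in front of T
W(x)g for an inserted G_v, which a Schwartz operator absorbs. So ‖T W(x)g‖ decays rapidly, the
integral converges in trace norm and T is trace class (`seminormBounded_norm_coh`, `isNuclear_coh`).
The transform takes T G_v − G_v T to multiplication by σ(v, ·) and (i/2)(T G_v + G_v T) to ∂_v. Both
operations are continuous on Schwartz operators, so the sup bound on the transform propagates to all
Schwartz seminorms (`seminormBounded_iteratedFDeriv_weylFun`).

From functions to operators: the inverse is g ↦ ∫ g(x) W(−x) dx. Integration by parts moves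
polynomials in Q and P from either side onto g, as differential operators with polynomial
coefficients (`exists_norm_inner_weylQuant_le`). Fubini and orthogonality recover T from its
transform (`weylQuant_weylSchwartz`), and quantization is injective because conjugation by W(a)
multiplies the symbol by a character (`weylQuant_eq_zero`).

The seminorms only involve P^β Q^α, while these arguments insert field operators in any order;
normal ordering (`weylAlg_le_span`) bridges the gap. -/

theorem tsum_enorm_inner_onb_sq (x : H) : ∑' k, ‖⟪onb H k, x⟫_ℂ‖ₑ ^ 2 = ‖x‖ₑ ^ 2 := by
  have h := (onb H).hasSum_inner_mul_inner x x
  have h1 : HasSum (fun k => ‖⟪onb H k, x⟫_ℂ‖ ^ 2) (‖x‖ ^ 2) := by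
    rw [inner_self_eq_norm_sq_to_K] at h
    have h2 : (fun i => ⟪x, onb H i⟫_ℂ * ⟪onb H i, x⟫_ℂ) =
        fun i => ((‖⟪onb H i, x⟫_ℂ‖ ^ 2 : ℝ) : ℂ) := by
      funext i
      rw [← inner_conj_symm x, Complex.conj_mul']
      norm_cast
    rw [h2] at h
    have h3 : HasSum (fun i => ((‖⟪onb H i, x⟫_ℂ‖ ^ 2 : ℝ) : ℂ)) ((‖x‖ ^ 2 : ℝ) : ℂ) := by
      simpa using h
    exact Complex.hasSum_ofReal.1 h3
  have h3 : ∀ y : ℂ, ‖y‖ₑ ^ 2 = ENNReal.ofReal (‖y‖ ^ 2) := fun y => by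
    rw [ENNReal.ofReal_pow (norm_nonneg _), ofReal_norm]
  simp_rw [h3]
  rw [← ENNReal.ofReal_tsum_of_nonneg (fun _ => by positivity) h1.summable, h1.tsum_eq,
    ENNReal.ofReal_pow (norm_nonneg _), ofReal_norm]

/-- Parseval makes both sides the double sum of |⟨e_j, A e_k⟩|², and in [0, ∞] the order of
summation is free. -/
theorem tsum_enorm_adjoint_sq (A : H →L[ℂ] H) :
    ∑' k, ‖A.adjoint (onb H k)‖ₑ ^ 2 = ∑' k, ‖A (onb H k)‖ₑ ^ 2 := by
  simp_rw [← tsum_enorm_inner_onb_sq (A.adjoint _), ← tsum_enorm_inner_onb_sq (A _)]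
  rw [ENNReal.tsum_comm]
  refine tsum_congr fun k => tsum_congr fun j => ?_
  rw [ContinuousLinearMap.adjoint_inner_right, ← inner_conj_symm, enorm_eq_nnnorm,
    enorm_eq_nnnorm, RCLike.nnnorm_conj]

theorem tsum_enorm_comp_sq_le (B A : H →L[ℂ] H) :
    ∑' k, ‖B (A (onb H k))‖ₑ ^ 2 ≤ ‖B‖ₑ ^ 2 * ∑' k, ‖A (onb H k)‖ₑ ^ 2 := by
  rw [← ENNReal.tsum_mul_left]
  refine ENNReal.tsum_le_tsum fun k => ?_
  rw [← mul_pow]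
  gcongr
  exact B.le_opENorm _

theorem hsNorm_sq (T : H →L[ℂ] H) : hsNorm T ^ 2 = ∑' k, ‖T (onb H k)‖ₑ ^ 2 := by
  rw [hsNorm, ← ENNReal.rpow_natCast, ← ENNReal.rpow_mul]
  norm_num

theorem isHilbertSchmidt_iff_tsum_ne_top (T : H →L[ℂ] H) :
    IsHilbertSchmidt T ↔ ∑' k, ‖T (onb H k)‖ₑ ^ 2 ≠ ⊤ := by
  rw [← hsNorm_sq, IsHilbertSchmidt, lt_top_iff_ne_top, Ne, Ne, ENNReal.pow_eq_top_iff]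
  simp

theorem summable_norm_sq_iff {ι E : Type*} [NormedAddCommGroup E] (f : ι → E) :
    Summable (fun k => ‖f k‖ ^ 2) ↔ ∑' k, ‖f k‖ₑ ^ 2 ≠ ⊤ := by
  have h : ∀ k, ‖f k‖ₑ ^ 2 = ((‖f k‖₊ ^ 2 : NNReal) : ENNReal) := fun k => by
    rw [enorm_eq_nnnorm, ENNReal.coe_pow]
  simp_rw [h, ENNReal.tsum_coe_ne_top_iff_summable]
  rw [← NNReal.summable_coe]
  simp

theorem IsHilbertSchmidt.summable {T : H →L[ℂ] H} (hT : IsHilbertSchmidt T) :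
    Summable fun k => ‖T (onb H k)‖ ^ 2 := by
  rw [summable_norm_sq_iff]
  exact (isHilbertSchmidt_iff_tsum_ne_top T).1 hT

theorem IsHilbertSchmidt.hsNorm_eq {T : H →L[ℂ] H} (hT : IsHilbertSchmidt T) :
    hsNorm T = ENNReal.ofReal (√(∑' k, ‖T (onb H k)‖ ^ 2)) := by
  have h0 : 0 ≤ ∑' k, ‖T (onb H k)‖ ^ 2 := tsum_nonneg fun _ => by positivity
  have h : hsNorm T ^ 2 = ENNReal.ofReal (√(∑' k, ‖T (onb H k)‖ ^ 2)) ^ 2 := by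
    rw [hsNorm_sq, ← ENNReal.ofReal_pow (Real.sqrt_nonneg _), Real.sq_sqrt h0,
      ENNReal.ofReal_tsum_of_nonneg (fun _ => by positivity) hT.summable]
    refine tsum_congr fun k => ?_
    rw [ENNReal.ofReal_pow (norm_nonneg _), ofReal_norm]
  exact (ENNReal.pow_right_strictMono two_ne_zero).injective h

theorem IsHilbertSchmidt.sub {S T : H →L[ℂ] H} (hS : IsHilbertSchmidt S)
    (hT : IsHilbertSchmidt T) : IsHilbertSchmidt (S - T) := by
  rw [isHilbertSchmidt_iff_tsum_ne_top, ← summable_norm_sq_iff]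
  refine Summable.of_nonneg_of_le (fun _ => by positivity) (fun k => ?_)
    ((hS.summable.add hT.summable).mul_left 2)
  have h1 := norm_sub_le (S (onb H k)) (T (onb H k))
  have h2 : ‖(S - T) (onb H k)‖ = ‖S (onb H k) - T (onb H k)‖ := rfl
  rw [h2]
  nlinarith [sq_nonneg (‖S (onb H k)‖ - ‖T (onb H k)‖), norm_nonneg (S (onb H k) - T (onb H k))]

theorem IsHilbertSchmidt.comp_left {A : H →L[ℂ] H} (hA : IsHilbertSchmidt A) (B : H →L[ℂ] H) :
    IsHilbertSchmidt (B ∘L A) := by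
  rw [isHilbertSchmidt_iff_tsum_ne_top] at hA ⊢
  refine ne_top_of_le_ne_top ?_ (tsum_enorm_comp_sq_le B A)
  exact ENNReal.mul_ne_top (ENNReal.pow_ne_top enorm_ne_top) hA

theorem IsHilbertSchmidt.adjoint {A : H →L[ℂ] H} (hA : IsHilbertSchmidt A) :
    IsHilbertSchmidt A.adjoint := by
  rw [isHilbertSchmidt_iff_tsum_ne_top] at hA ⊢
  rwa [tsum_enorm_adjoint_sq]

theorem ext_onb {S T : H →L[ℂ] H} (h : ∀ k, S (onb H k) = T (onb H k)) : S = T := by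
  refine ContinuousLinearMap.ext_on
    (s := Set.range (onb H)) ?_ (by rintro _ ⟨k, rfl⟩; exact h k)
  rw [Submodule.dense_iff_topologicalClosure_eq_top]
  exact (onb H).dense_span

theorem eq_of_hsNorm_sub_eq_zero {S T : H →L[ℂ] H} (h : hsNorm (S - T) = 0) : S = T := by
  have h2 : hsNorm (S - T) ^ 2 = 0 := by rw [h]; simp
  rw [hsNorm_sq, ENNReal.tsum_eq_zero] at h2
  refine ext_onb fun k => ?_
  have := h2 k
  simpa [sub_eq_zero] using this

/-- Douglas' factorization lemma for `A* A ≤ B* B`. -/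
theorem exists_contraction_comp_eq (A B : H →L[ℂ] H) (h : ∀ v, ‖A v‖ ≤ ‖B v‖) :
    ∃ V : H →L[ℂ] H, (∀ v, ‖V v‖ ≤ ‖v‖) ∧ A = V ∘L B := by
  let K : Submodule ℂ H := (LinearMap.range (B : H →ₗ[ℂ] H)).topologicalClosure
  have : CompleteSpace K :=
    (Submodule.isClosed_topologicalClosure _).completeSpace_coe
  have hK : ∀ v, B v ∈ K := fun v => Submodule.le_topologicalClosure _ ⟨v, rfl⟩
  let e : H →ₗ[ℂ] K := (B : H →ₗ[ℂ] H).codRestrict K hK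
  have he : DenseRange e := by
    rw [DenseRange, Subtype.dense_iff]
    intro x hx
    have hx' : x ∈ closure (LinearMap.range (B : H →ₗ[ℂ] H) : Set H) := hx
    refine closure_mono ?_ hx'
    rintro _ ⟨v, rfl⟩
    exact ⟨e v, ⟨v, rfl⟩, rfl⟩
  have hb : ∀ v, ‖(A : H →ₗ[ℂ] H) v‖ ≤ 1 * ‖e v‖ := fun v => by
    rw [one_mul]; exact h v
  -- `V` is B v ↦ A v, extended to the closure of the range of `B` and precomposed with the
  -- orthogonal projection onto it.
  refine ⟨((A : H →ₗ[ℂ] H).extendOfNorm e) ∘L K.orthogonalProjectionOnto, fun v => ?_, ?_⟩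
  · refine (LinearMap.norm_extendOfNorm_apply_le he 1 hb _).trans ?_
    rw [one_mul]
    exact K.norm_orthogonalProjectionOnto_apply_le v
  · ext v
    have h1 : K.orthogonalProjectionOnto (B v) = e v :=
      K.orthogonalProjectionOnto_mem_subspace_eq_self (e v)
    rw [ContinuousLinearMap.comp_apply, ContinuousLinearMap.comp_apply, h1,
      LinearMap.extendOfNorm_eq he ⟨1, hb⟩]
    rfl

theorem abs_isSelfAdjoint (T : H →L[ℂ] H) : (CFC.abs T).adjoint = CFC.abs T :=
  (CFC.abs_nonneg T).isSelfAdjoint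

/-- Both squares are ⟨v, T* T v⟩. With the factorization lemma this replaces the polar
decomposition: `T` and its absolute value are contractive left multiples of each other. -/
theorem norm_abs_apply (T : H →L[ℂ] H) (v : H) : ‖CFC.abs T v‖ = ‖T v‖ := by
  have h : CFC.abs T * CFC.abs T = star T * T := CFC.abs_mul_abs T
  have h1 : ⟪CFC.abs T v, CFC.abs T v⟫_ℂ = ⟪T v, T v⟫_ℂ := by
    rw [← ContinuousLinearMap.adjoint_inner_right, abs_isSelfAdjoint,
      ← ContinuousLinearMap.adjoint_inner_right T]
    exact congrArg (fun A : H →L[ℂ] H => ⟪v, A v⟫_ℂ) h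
  rw [inner_self_eq_norm_sq_to_K, inner_self_eq_norm_sq_to_K] at h1
  exact (pow_left_inj₀ (norm_nonneg _) (norm_nonneg _) two_ne_zero).1 (by exact_mod_cast h1)

theorem exists_eq_comp_abs (T : H →L[ℂ] H) :
    ∃ U : H →L[ℂ] H, (∀ v, ‖U v‖ ≤ ‖v‖) ∧ T = U ∘L CFC.abs T :=
  exists_contraction_comp_eq _ _ fun v => (norm_abs_apply T v).ge

theorem exists_abs_eq_comp (T : H →L[ℂ] H) :
    ∃ V : H →L[ℂ] H, (∀ v, ‖V v‖ ≤ ‖v‖) ∧ CFC.abs T = V ∘L T :=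
  exists_contraction_comp_eq _ _ fun v => (norm_abs_apply T v).le

/-- A trace class operator is a product of Hilbert–Schmidt operators. -/
theorem IsTraceClass.exists_comp {T : H →L[ℂ] H} (hT : IsTraceClass T) :
    ∃ C A : H →L[ℂ] H, IsHilbertSchmidt C ∧ IsHilbertSchmidt A ∧ T = C ∘L A := by
  obtain ⟨U, -, hU⟩ := exists_eq_comp_abs T
  have h0 := CFC.abs_nonneg T
  have hs : (CFC.sqrt (CFC.abs T)).adjoint = CFC.sqrt (CFC.abs T) :=
    (CFC.sqrt_nonneg (CFC.abs T)).isSelfAdjoint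
  have hm : CFC.sqrt (CFC.abs T) ∘L CFC.sqrt (CFC.abs T) = CFC.abs T :=
    CFC.sqrt_mul_sqrt_self _ h0
  -- The diagonal entries of |T| are the squared norms of √|T| on the basis, so the trace norm of
  -- `T` is the squared Hilbert–Schmidt norm of √|T|.
  have hA : IsHilbertSchmidt (CFC.sqrt (CFC.abs T)) := by
    rw [isHilbertSchmidt_iff_tsum_ne_top]
    refine ne_of_eq_of_ne (tsum_congr fun k => ?_) hT.ne
    conv_rhs => rw [← hm]
    rw [ContinuousLinearMap.comp_apply, ← ContinuousLinearMap.adjoint_inner_left, hs,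
      inner_self_eq_norm_sq, ENNReal.ofReal_pow (norm_nonneg _), ofReal_norm]
  exact ⟨U ∘L CFC.sqrt (CFC.abs T), _, hA.comp_left U, hA, by
    rw [ContinuousLinearMap.comp_assoc, hm]; exact hU⟩

/-- The diagonal entry is ⟨C* e_k, A e_k⟩, and C* is again Hilbert–Schmidt. -/
theorem summable_inner_of_isHilbertSchmidt {C A : H →L[ℂ] H} (hC : IsHilbertSchmidt C)
    (hA : IsHilbertSchmidt A) : Summable fun k => ⟪onb H k, C (A (onb H k))⟫_ℂ := by
  refine Summable.of_norm_bounded (hC.adjoint.summable.add hA.summable) fun k => ?_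
  rw [← ContinuousLinearMap.adjoint_inner_left]
  refine (norm_inner_le_norm _ _).trans ?_
  nlinarith [sq_nonneg (‖C.adjoint (onb H k)‖ - ‖A (onb H k)‖), sq_nonneg ‖C.adjoint (onb H k)‖,
    sq_nonneg ‖A (onb H k)‖]

theorem IsTraceClass.summable_inner {T : H →L[ℂ] H} (hT : IsTraceClass T) (B : H →L[ℂ] H) :
    Summable fun k => ⟪onb H k, B (T (onb H k))⟫_ℂ := by
  obtain ⟨C, A, hC, hA, rfl⟩ := hT.exists_comp
  exact summable_inner_of_isHilbertSchmidt (C := B ∘L C) (hC.comp_left B) hA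

theorem IsTraceClass.isHilbertSchmidt {T : H →L[ℂ] H} (hT : IsTraceClass T) :
    IsHilbertSchmidt T := by
  obtain ⟨C, A, hC, hA, rfl⟩ := hT.exists_comp
  exact hA.comp_left C

/-- Distinct basis vectors lie √2 apart, so balls of radius 1/2 around them are disjoint.
Countability is needed to exchange sums over the basis with integrals and to extract sequences of
finite subsets. -/
theorem countable_onbIndex [TopologicalSpace.SeparableSpace H] : Countable (onbIndex H) := by
  have ho := (onb H).orthonormal
  refine Pairwise.countable_of_isOpen_disjoint (α := H)
    (s := fun k => Metric.ball (onb H k) (1 / 2)) (fun i j hij => ?_)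
    (fun _ => Metric.isOpen_ball) fun k => ⟨onb H k, Metric.mem_ball_self (by norm_num)⟩
  refine Metric.ball_disjoint_ball ?_
  have h1 : ‖onb H i - onb H j‖ ^ 2 = 2 := by
    rw [@norm_sub_sq ℂ, ho.1 i, ho.1 j, ho.2 hij]
    norm_num
  rw [dist_eq_norm]
  nlinarith [norm_nonneg (onb H i - onb H j)]

/-- Cauchy–Schwarz followed by Bessel. The bound is uniform in `F`, which makes integral
representations of operators summable on the diagonal. -/
theorem sum_norm_inner_mul_inner_le (F : Finset (onbIndex H)) (u v : H) :
    ∑ k ∈ F, ‖⟪onb H k, u⟫_ℂ * ⟪v, onb H k⟫_ℂ‖ ≤ ‖u‖ * ‖v‖ := by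
  have ho := (onb H).orthonormal
  simp_rw [norm_mul, norm_inner_symm v]
  refine (Real.sum_mul_le_sqrt_mul_sqrt _ _ _).trans ?_
  gcongr
  · exact Real.sqrt_le_iff.2 ⟨norm_nonneg _, ho.sum_inner_products_le u⟩
  · exact Real.sqrt_le_iff.2 ⟨norm_nonneg _, ho.sum_inner_products_le v⟩

end HilbertSpace

/-! ### Nuclear representations -/

section Nuclear

variable {H : Type*} [NormedAddCommGroup H] [InnerProductSpace ℂ H] [CompleteSpace H]
  {Ω : Type*} [MeasurableSpace Ω]

/-- The operator `T` is the weak integral `∫ |u ω⟩⟨v ω| dμ(ω)`, absolutely convergent in trace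
norm. -/
structure IsNuclear (μ : Measure Ω) (u v : Ω → H) (T : H →L[ℂ] H) : Prop where
  measurable_left : AEStronglyMeasurable u μ
  measurable_right : AEStronglyMeasurable v μ
  integrable : Integrable (fun ω => ‖u ω‖ * ‖v ω‖) μ
  inner_eq : ∀ x y, ⟪x, T y⟫_ℂ = ∫ ω, ⟪x, u ω⟫_ℂ * ⟪v ω, y⟫_ℂ ∂μ

namespace IsNuclear

variable {μ : Measure Ω} {u v : Ω → H} {T : H →L[ℂ] H}

theorem comp_left (h : IsNuclear μ u v T) (B : H →L[ℂ] H) :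
    IsNuclear μ (fun ω => B (u ω)) v (B ∘L T) where
  measurable_left := B.continuous.comp_aestronglyMeasurable h.measurable_left
  measurable_right := h.measurable_right
  integrable := by
    refine (h.integrable.const_mul ‖B‖).mono'
      ((B.continuous.comp_aestronglyMeasurable h.measurable_left).norm.mul
        h.measurable_right.norm) (.of_forall fun ω => ?_)
    rw [norm_mul, norm_norm, norm_norm, ← mul_assoc]
    gcongr
    exact B.le_opNorm _
  inner_eq x y := by
    rw [ContinuousLinearMap.comp_apply, ← ContinuousLinearMap.adjoint_inner_left, h.inner_eq]
    simp_rw [ContinuousLinearMap.adjoint_inner_left]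

theorem adjoint (h : IsNuclear μ u v T) : IsNuclear μ v u T.adjoint where
  measurable_left := h.measurable_right
  measurable_right := h.measurable_left
  integrable := by simpa only [mul_comm] using h.integrable
  inner_eq x y := by
    rw [ContinuousLinearMap.adjoint_inner_right, ← inner_conj_symm, h.inner_eq, ← integral_conj]
    refine integral_congr_ae (.of_forall fun ω => ?_)
    simp only [map_mul, inner_conj_symm]
    exact mul_comm _ _

theorem integrable_term (h : IsNuclear μ u v T) (x y : H) :
    Integrable (fun ω => ⟪x, u ω⟫_ℂ * ⟪v ω, y⟫_ℂ) μ := by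
  refine (h.integrable.const_mul (‖x‖ * ‖y‖)).mono'
    ((h.measurable_left.const_inner).mul (h.measurable_right.inner_const))
    (.of_forall fun ω => ?_)
  rw [norm_mul]
  calc ‖⟪x, u ω⟫_ℂ‖ * ‖⟪v ω, y⟫_ℂ‖ ≤ (‖x‖ * ‖u ω‖) * (‖v ω‖ * ‖y‖) := by
        gcongr <;> exact norm_inner_le_norm _ _
    _ = _ := by ring

theorem sum_integral_norm_le (h : IsNuclear μ u v T) (F : Finset (onbIndex H)) :
    ∑ k ∈ F, ∫ ω, ‖⟪onb H k, u ω⟫_ℂ * ⟪v ω, onb H k⟫_ℂ‖ ∂μ ≤ ∫ ω, ‖u ω‖ * ‖v ω‖ ∂μ := by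
  rw [← integral_finsetSum _ fun k _ => (h.integrable_term _ _).norm]
  exact integral_mono (integrable_finsetSum _ fun k _ => (h.integrable_term _ _).norm)
    h.integrable fun ω => sum_norm_inner_mul_inner_le F (u ω) (v ω)

/-- Fubini for the sum over the basis and the integral over `Ω`; summing the integrand first gives
⟨v ω, u ω⟩ by Parseval. -/
theorem hasSum_trace [TopologicalSpace.SeparableSpace H] (h : IsNuclear μ u v T) :
    HasSum (fun k => ⟪onb H k, T (onb H k)⟫_ℂ) (∫ ω, ⟪v ω, u ω⟫_ℂ ∂μ) := by
  have := countable_onbIndex (H := H)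
  have h1 := hasSum_integral_of_summable_integral_norm (μ := μ)
    (F := fun k ω => ⟪onb H k, u ω⟫_ℂ * ⟪v ω, onb H k⟫_ℂ)
    (fun k => h.integrable_term _ _)
    (summable_of_sum_le (fun k => integral_nonneg fun ω => norm_nonneg _) h.sum_integral_norm_le)
  simp_rw [← h.inner_eq] at h1
  have h2 : ∫ ω, ⟪v ω, u ω⟫_ℂ ∂μ =
      ∫ ω, ∑' k, ⟪onb H k, u ω⟫_ℂ * ⟪v ω, onb H k⟫_ℂ ∂μ := by
    congr 1 with ω
    rw [← (onb H).tsum_inner_mul_inner]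
    exact tsum_congr fun k => mul_comm _ _
  rw [h2]
  exact h1

theorem opTrace_eq [TopologicalSpace.SeparableSpace H] (h : IsNuclear μ u v T) :
    opTrace T = ∫ ω, ⟪v ω, u ω⟫_ℂ ∂μ :=
  h.hasSum_trace.tsum_eq

/-- Composing with the contraction that sends `T` to |T| makes |T| nuclear as well, so its diagonal
is absolutely summable. -/
theorem isTraceClass (h : IsNuclear μ u v T) : IsTraceClass T := by
  obtain ⟨V, -, hV⟩ := exists_abs_eq_comp T
  have hn := h.comp_left V
  have hs : Summable fun k => ⟪onb H k, CFC.abs T (onb H k)⟫_ℂ := by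
    refine Summable.of_norm_bounded
      (summable_of_sum_le (fun k => integral_nonneg fun ω => norm_nonneg _)
        hn.sum_integral_norm_le) fun k => ?_
    rw [hV, hn.inner_eq]
    exact norm_integral_le_integral_norm _
  have hr : Summable fun k => RCLike.re ⟪onb H k, CFC.abs T (onb H k)⟫_ℂ :=
    hs.map (RCLike.reCLM (K := ℂ)) (RCLike.reCLM (K := ℂ)).continuous
  rw [IsTraceClass, traceNorm]
  exact hr.tsum_ofReal_lt_top

end IsNuclear

end Nuclear

/-! ### The Weyl operators on Schwartz functions -/

section WeylSchwartz

variable {N : ℕ}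

theorem hasTemperateGrowth_cexp_I_mul :
    Function.HasTemperateGrowth fun t : ℝ => Complex.exp (Complex.I * t) := by
  have hd : ∀ n : ℕ, iteratedDeriv n (fun t : ℝ => Complex.exp (Complex.I * t)) =
      fun t : ℝ => Complex.I ^ n * Complex.exp (Complex.I * t) := by
    intro n
    induction n with
    | zero => simp
    | succ n ih =>
      rw [iteratedDeriv_succ, ih]
      funext t
      have h : HasDerivAt (fun t : ℝ => Complex.I ^ n * Complex.exp (Complex.I * t))
          (Complex.I ^ n * (Complex.exp (Complex.I * t) * (Complex.I * 1))) t :=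
        (((Complex.ofRealCLM.hasDerivAt (x := t)).const_mul Complex.I).cexp).const_mul _
      rw [h.deriv]
      ring
  -- The n-th derivative i^n e^{it} has modulus one, so exponent 0 and constant 1 work for every n.
  refine ⟨Complex.contDiff_exp.comp (contDiff_const.mul Complex.ofRealCLM.contDiff),
    fun n => ⟨0, 1, fun t => ?_⟩⟩
  rw [norm_iteratedFDeriv_eq_norm_iteratedDeriv, hd, norm_mul, norm_pow, Complex.norm_I,
    mul_comm Complex.I, Complex.norm_exp_ofReal_mul_I]
  simp

theorem hasTemperateGrowth_weylPhase (z : Phase N) : (weylPhase z).HasTemperateGrowth :=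
  (Function.HasTemperateGrowth.const _).mul
    (hasTemperateGrowth_cexp_I_mul.comp (Function.hasTemperateGrowth_inner_right z.2))

/-- The Weyl operator on Schwartz functions. -/
def weylS (z : Phase N) : 𝓢(Config N, ℂ) →L[ℂ] 𝓢(Config N, ℂ) :=
  SchwartzMap.smulLeftCLM ℂ (weylPhase z) ∘L SchwartzMap.compSubConstCLM ℂ z.1

theorem weylS_apply (z : Phase N) (φ : 𝓢(Config N, ℂ)) (y : Config N) :
    weylS z φ y = weylPhase z y * φ (y - z.1) := by
  rw [weylS, ContinuousLinearMap.comp_apply,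
    SchwartzMap.smulLeftCLM_apply_apply (hasTemperateGrowth_weylPhase z),
    SchwartzMap.compSubConstCLM_apply, smul_eq_mul]

/-- The embedding of the Schwartz functions into the Hilbert space. -/
def toHilb (N : ℕ) : 𝓢(Config N, ℂ) →L[ℂ] Hilb N :=
  SchwartzMap.toLpCLM ℂ ℂ 2 volume

theorem toHilb_apply (φ : 𝓢(Config N, ℂ)) : toHilb N φ = φ.toLp 2 volume := rfl

theorem denseRange_toHilb (N : ℕ) : DenseRange (toHilb N) :=
  SchwartzMap.denseRange_toLpCLM (by simp)

theorem coeFn_toHilb (φ : 𝓢(Config N, ℂ)) : toHilb N φ =ᵐ[volume] φ :=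
  φ.coeFn_toLp 2 volume

theorem inner_toHilb (ψ φ : 𝓢(Config N, ℂ)) :
    ⟪toHilb N ψ, toHilb N φ⟫_ℂ = ∫ y, ⟪ψ y, φ y⟫_ℂ := by
  exact SchwartzMap.inner_toL2_toL2_eq ψ φ volume

theorem weylOp_toHilb (z : Phase N) (φ : 𝓢(Config N, ℂ)) :
    weylOp z (toHilb N φ) = toHilb N (weylS z φ) := by
  refine Lp.ext ?_
  have h1 : weylOp z (toHilb N φ) =ᵐ[volume] fun y => weylPhase z y * toHilb N φ (y - z.1) :=
    (memLp_weyl z (toHilb N φ)).coeFn_toLp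
  have h2 := (measurePreserving_sub_right volume z.1).quasiMeasurePreserving.ae (coeFn_toHilb φ)
  filter_upwards [h1, h2, coeFn_toHilb (weylS z φ)] with y h1 h2 h3
  rw [h1, h2, h3, weylS_apply]

/-- The symplectic form on phase space. -/
def symp (v z : Phase N) : ℝ := ⟪v.2, z.1⟫_ℝ - ⟪v.1, z.2⟫_ℝ

/-- The factor 2 is there because the product norm on phase space is the maximum, not the Euclidean
norm. -/
theorem abs_symp_le (v z : Phase N) : |symp v z| ≤ 2 * ‖v‖ * ‖z‖ := by
  have h1 : |⟪v.2, z.1⟫_ℝ| ≤ ‖v‖ * ‖z‖ :=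
    (abs_real_inner_le_norm _ _).trans
      (mul_le_mul (norm_snd_le v) (norm_fst_le z) (norm_nonneg _) (norm_nonneg _))
  have h2 : |⟪v.1, z.2⟫_ℝ| ≤ ‖v‖ * ‖z‖ :=
    (abs_real_inner_le_norm _ _).trans
      (mul_le_mul (norm_fst_le v) (norm_snd_le z) (norm_nonneg _) (norm_nonneg _))
  rw [symp]
  refine (abs_sub _ _).trans ?_
  linarith

/-- The field operator `b · Q - a · P` for `v = (a, b)`. -/
def fieldOp (v : Phase N) : 𝓢(Config N, ℂ) →L[ℂ] 𝓢(Config N, ℂ) :=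
  ∑ i, ((v.2 i : ℝ) : ℂ) • posOp i - ∑ i, ((v.1 i : ℝ) : ℂ) • momOp i

theorem fieldOp_add (v w : Phase N) : fieldOp (v + w) = fieldOp v + fieldOp w := by
  simp only [fieldOp, Prod.fst_add, Prod.snd_add, PiLp.add_apply, Complex.ofReal_add, add_smul,
    Finset.sum_add_distrib]
  abel

theorem fieldOp_smul (c : ℝ) (v : Phase N) : fieldOp (c • v) = (c : ℂ) • fieldOp v := by
  simp only [fieldOp, Prod.smul_fst, Prod.smul_snd, PiLp.smul_apply, smul_eq_mul,
    Complex.ofReal_mul, mul_smul, smul_sub, Finset.smul_sum]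

theorem momOp_apply_fderiv (i : Fin N) (φ : 𝓢(Config N, ℂ)) (y : Config N) :
    momOp i φ y = -Complex.I * fderiv ℝ φ y (EuclideanSpace.single i 1) := by
  rw [momOp_apply, (φ.differentiableAt (x := y)).lineDeriv_eq_fderiv]

theorem fieldOp_apply (v : Phase N) (φ : 𝓢(Config N, ℂ)) (y : Config N) :
    fieldOp v φ y = ((⟪v.2, y⟫_ℝ : ℝ) : ℂ) * φ y + Complex.I * fderiv ℝ φ y v.1 := by
  have h1 : fieldOp v φ y =
      ∑ i, ((v.2 i : ℝ) : ℂ) * posOp i φ y - ∑ i, ((v.1 i : ℝ) : ℂ) * momOp i φ y := by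
    simp [fieldOp]
  have h2 : fderiv ℝ φ y v.1 =
      ∑ i, ((v.1 i : ℝ) : ℂ) * fderiv ℝ φ y (EuclideanSpace.single i 1) := by
    conv_lhs => rw [← (EuclideanSpace.basisFun (Fin N) ℝ).sum_repr v.1]
    simp
  have h3 : ((⟪v.2, y⟫_ℝ : ℝ) : ℂ) = ∑ i, ((v.2 i : ℝ) : ℂ) * (y i : ℂ) := by
    simp [PiLp.inner_apply, mul_comm]
  rw [h1, h2, h3, Finset.sum_mul, Finset.mul_sum, sub_eq_add_neg, ← Finset.sum_neg_distrib]
  congr 1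
  · exact Finset.sum_congr rfl fun i _ => by rw [posOp_apply]; ring
  · exact Finset.sum_congr rfl fun i _ => by rw [momOp_apply_fderiv]; ring

theorem hasFDerivAt_weylPhase_right (z : Phase N) (y : Config N) :
    HasFDerivAt (weylPhase z)
      ((weylPhase z y * Complex.I) • (Complex.ofRealCLM ∘L innerSL ℝ z.2)) y := by
  have h1 : HasFDerivAt (fun y : Config N => ((⟪z.2, y⟫_ℝ : ℝ) : ℂ))
      (Complex.ofRealCLM ∘L innerSL ℝ z.2) y :=
    (Complex.ofRealCLM ∘L innerSL ℝ z.2).hasFDerivAt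
  have h2 := ((h1.const_mul Complex.I).cexp).const_mul
    (Complex.exp (-(Complex.I / 2) * (⟪z.1, z.2⟫_ℝ : ℝ)))
  refine h2.congr_fderiv ?_
  rw [smul_smul, smul_smul, weylPhase]

/-- Conjugation by W(q, p) shifts Q by q and P by p, hence b·Q − a·P by the scalar b·q − a·p. This
is the mechanism that turns polynomial weights in `z` into field operators. -/
theorem fieldOp_weylS (v z : Phase N) (φ : 𝓢(Config N, ℂ)) :
    fieldOp v (weylS z φ) = weylS z (fieldOp v φ) + (symp v z : ℂ) • weylS z φ := by
  ext y
  have h1 : HasFDerivAt (weylS z φ)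
      (weylPhase z y • fderiv ℝ φ (y - z.1) + φ (y - z.1) •
        ((weylPhase z y * Complex.I) • (Complex.ofRealCLM ∘L innerSL ℝ z.2))) y := by
    have h2 : (weylS z φ : Config N → ℂ) = fun y => weylPhase z y * φ (y - z.1) :=
      funext (weylS_apply z φ)
    rw [h2]
    refine (hasFDerivAt_weylPhase_right z y).mul ?_
    simpa using! (φ.hasFDerivAt (y - z.1)).comp y ((hasFDerivAt_id y).sub_const z.1)
  have h3 : (weylS z (fieldOp v φ) + (symp v z : ℂ) • weylS z φ) y =
    weylS z (fieldOp v φ) y + (symp v z : ℂ) * weylS z φ y := rfl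
  rw [h3, fieldOp_apply, h1.fderiv, weylS_apply, weylS_apply, fieldOp_apply, symp,
    inner_sub_right]
  simp only [add_apply, smul_apply, ContinuousLinearMap.comp_apply, innerSL_apply_apply,
    Complex.ofRealCLM_apply, smul_eq_mul, Complex.ofReal_sub, real_inner_comm v.1 z.2]
  linear_combination (weylPhase z y * φ (y - z.1) * (⟪v.1, z.2⟫_ℝ : ℝ)) * Complex.I_sq

/-- The form `(z, w) ↦ conj z * w`, as a real bilinear map. -/
def conjMulCLM : ℂ →L[ℝ] ℂ →L[ℝ] ℂ :=
  (ContinuousLinearMap.mul ℝ ℂ) ∘L (Complex.conjCLE : ℂ →L[ℝ] ℂ)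

theorem conjMulCLM_apply (z w : ℂ) : conjMulCLM z w = ⟪z, w⟫_ℂ := by
  rw [RCLike.inner_apply]
  exact mul_comm _ _

theorem inner_posOp (i : Fin N) (ψ φ : 𝓢(Config N, ℂ)) :
    ⟪toHilb N (posOp i ψ), toHilb N φ⟫_ℂ = ⟪toHilb N ψ, toHilb N (posOp i φ)⟫_ℂ := by
  rw [inner_toHilb, inner_toHilb]
  congr 1 with y
  rw [posOp_apply, posOp_apply, RCLike.inner_apply, RCLike.inner_apply, map_mul,
    Complex.conj_ofReal]
  ring

theorem inner_momOp (i : Fin N) (ψ φ : 𝓢(Config N, ℂ)) :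
    ⟪toHilb N (momOp i ψ), toHilb N φ⟫_ℂ = ⟪toHilb N ψ, toHilb N (momOp i φ)⟫_ℂ := by
  have h := SchwartzMap.integral_bilinear_lineDerivOp_right_eq_neg_left (μ := volume) ψ φ
    conjMulCLM (EuclideanSpace.single i (1 : ℝ))
  simp_rw [conjMulCLM_apply] at h
  have h1 : ∀ φ : 𝓢(Config N, ℂ), toHilb N (momOp i φ) = -Complex.I •
      toHilb N (LineDeriv.lineDerivOp (EuclideanSpace.single i (1 : ℝ)) φ) := fun φ => by
    rw [← map_smul]; rfl
  rw [h1, h1, inner_smul_left, inner_smul_right, inner_toHilb, inner_toHilb, h]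
  simp

theorem inner_fieldOp (v : Phase N) (ψ φ : 𝓢(Config N, ℂ)) :
    ⟪toHilb N (fieldOp v ψ), toHilb N φ⟫_ℂ = ⟪toHilb N ψ, toHilb N (fieldOp v φ)⟫_ℂ := by
  simp only [fieldOp, sub_apply, sum_apply, smul_apply,
    map_sub, map_sum, map_smul, inner_sub_left, inner_sub_right, sum_inner, inner_sum,
    inner_smul_left, inner_smul_right, inner_posOp, inner_momOp, Complex.conj_ofReal]

theorem symp_neg_right (v z : Phase N) : symp v (-z) = -symp v z := by
  simp [symp]; ring

theorem symp_self (v : Phase N) : symp v v = 0 := by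
  rw [symp, real_inner_comm, sub_self]

/-- The Weyl relations; they hold by comparing the exponents of the phase factors. -/
theorem weylS_weylS (a b : Phase N) (φ : 𝓢(Config N, ℂ)) :
    weylS a (weylS b φ) = Complex.exp (Complex.I / 2 * symp a b) • weylS (a + b) φ := by
  ext y
  have h : (Complex.exp (Complex.I / 2 * symp a b) • weylS (a + b) φ) y =
    Complex.exp (Complex.I / 2 * symp a b) * weylS (a + b) φ y := rfl
  rw [h, weylS_apply, weylS_apply, weylS_apply, Prod.fst_add, sub_sub, ← mul_assoc, ← mul_assoc]
  congr 1
  rw [weylPhase, weylPhase, weylPhase, symp, ← Complex.exp_add, ← Complex.exp_add,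
    ← Complex.exp_add, ← Complex.exp_add, ← Complex.exp_add]
  congr 1
  simp only [Prod.fst_add, Prod.snd_add, inner_add_left, inner_add_right, inner_sub_right,
    real_inner_comm b.1 a.2, real_inner_comm a.1 b.2]
  push_cast
  ring

theorem weylS_zero (φ : 𝓢(Config N, ℂ)) : weylS 0 φ = φ := by
  ext y
  rw [weylS_apply]
  simp [weylPhase]

end WeylSchwartz

/-! ### The Weyl system on the Hilbert space -/

section WeylSystem

variable {N : ℕ}

theorem ext_toHilb {S T : Hilb N →L[ℂ] Hilb N}
    (h : ∀ φ : 𝓢(Config N, ℂ), S (toHilb N φ) = T (toHilb N φ)) : S = T := by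
  ext1 u
  exact congrFun ((denseRange_toHilb N).equalizer S.continuous T.continuous (funext h)) u

theorem weylOp_weylOp (a b : Phase N) (u : Hilb N) :
    weylOp a (weylOp b u) = Complex.exp (Complex.I / 2 * symp a b) • weylOp (a + b) u := by
  have h : weylOp a ∘L weylOp b = Complex.exp (Complex.I / 2 * symp a b) • weylOp (a + b) := by
    refine ext_toHilb fun φ => ?_
    rw [ContinuousLinearMap.comp_apply, weylOp_toHilb, weylOp_toHilb, weylS_weylS, smul_apply,
      weylOp_toHilb, map_smul]
  exact congrArg (fun A : Hilb N →L[ℂ] Hilb N => A u) h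

theorem weylOp_zero (u : Hilb N) : weylOp 0 u = u := by
  have h : weylOp (0 : Phase N) = ContinuousLinearMap.id ℂ _ := by
    refine ext_toHilb fun φ => ?_
    rw [weylOp_toHilb, weylS_zero]
    rfl
  rw [h]
  rfl

theorem weylOp_neg_weylOp (z : Phase N) (u : Hilb N) : weylOp (-z) (weylOp z u) = u := by
  have h : symp (-z) z = 0 := by
    have h1 := symp_neg_right (-z) (-z)
    rwa [neg_neg, symp_self, neg_zero] at h1
  rw [weylOp_weylOp, h, neg_add_cancel, weylOp_zero]
  simp

theorem weylOp_weylOp_neg (z : Phase N) (u : Hilb N) : weylOp z (weylOp (-z) u) = u := by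
  simpa using weylOp_neg_weylOp (-z) u

/-- W(z) and its inverse W(−z) are both contractions. -/
theorem norm_weylOp_apply (z : Phase N) (u : Hilb N) : ‖weylOp z u‖ = ‖u‖ := by
  have h : ∀ (z : Phase N) (u : Hilb N), ‖weylOp z u‖ ≤ ‖u‖ := fun z u => by
    refine ((weylOp z).le_of_opNorm_le (c := 1) ?_ u).trans_eq (one_mul _)
    exact LinearMap.mkContinuous_norm_le _ zero_le_one _
  refine le_antisymm (h z u) ?_
  simpa [weylOp_neg_weylOp] using h (-z) (weylOp z u)

theorem inner_weylOp_weylOp (z : Phase N) (u v : Hilb N) :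
    ⟪weylOp z u, weylOp z v⟫_ℂ = ⟪u, v⟫_ℂ :=
  LinearIsometry.inner_map_map (⟨(weylOp z).toLinearMap, norm_weylOp_apply z⟩ :
    Hilb N →ₗᵢ[ℂ] Hilb N) u v

theorem inner_weylOp_neg (z : Phase N) (u v : Hilb N) :
    ⟪weylOp (-z) u, v⟫_ℂ = ⟪u, weylOp z v⟫_ℂ := by
  rw [← inner_weylOp_weylOp z, weylOp_weylOp_neg]

end WeylSystem

/-! ### Derivatives of matrix coefficients of the Weyl system -/

section Derivative

variable {N : ℕ}

/-- The map `v ↦ (b · Q - a · P) φ`, for `v = (a, b)`. -/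
def fieldVec (φ : 𝓢(Config N, ℂ)) : Phase N →L[ℝ] Hilb N :=
  LinearMap.toContinuousLinearMap
    { toFun := fun v => toHilb N (fieldOp v φ)
      map_add' := fun v w => by rw [fieldOp_add, add_apply, map_add]
      map_smul' := fun c v => by
        rw [fieldOp_smul, smul_apply, map_smul, RingHom.id_apply,
          RCLike.real_smul_eq_coe_smul (K := ℂ)]
        rfl }

theorem fieldVec_apply (φ : 𝓢(Config N, ℂ)) (v : Phase N) :
    fieldVec φ v = toHilb N (fieldOp v φ) := rfl

theorem fieldVec_weylS (φ : 𝓢(Config N, ℂ)) (v z : Phase N) :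
    fieldVec (weylS z φ) v = weylOp z (fieldVec φ v) + (symp v z : ℂ) • weylOp z (toHilb N φ) := by
  rw [fieldVec_apply, fieldVec_apply, fieldOp_weylS, map_add, map_smul, weylOp_toHilb,
    weylOp_toHilb]

/-- The derivative of `z ↦ ⟨u, W(z) φ⟩`. -/
def coeffDeriv (u : Hilb N) (φ : 𝓢(Config N, ℂ)) (z : Phase N) : Phase N →L[ℝ] ℂ :=
  LinearMap.toContinuousLinearMap
    { toFun := fun v => Complex.I / 2 *
        (⟪u, fieldVec (weylS z φ) v⟫_ℂ + ⟪u, weylOp z (fieldVec φ v)⟫_ℂ)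
      map_add' := fun v w => by
        simp only [map_add, inner_add_right]
        ring
      map_smul' := fun c v => by
        have h : ∀ x : Hilb N, ⟪u, weylOp z (c • x)⟫_ℂ = (c : ℂ) * ⟪u, weylOp z x⟫_ℂ := fun x => by
          rw [RCLike.real_smul_eq_coe_smul (K := ℂ), map_smul, inner_smul_right]
          rfl
        have h' : ∀ x : Hilb N, ⟪u, c • x⟫_ℂ = (c : ℂ) * ⟪u, x⟫_ℂ := fun x => by
          rw [RCLike.real_smul_eq_coe_smul (K := ℂ), inner_smul_right]
          rfl
        simp only [map_smul, h, h', RingHom.id_apply, Complex.real_smul]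
        ring }

theorem coeffDeriv_apply (u : Hilb N) (φ : 𝓢(Config N, ℂ)) (z v : Phase N) :
    coeffDeriv u φ z v = Complex.I / 2 *
      (⟪u, fieldVec (weylS z φ) v⟫_ℂ + ⟪u, weylOp z (fieldVec φ v)⟫_ℂ) := rfl

theorem coeffDeriv_sub (u u' : Hilb N) (φ : 𝓢(Config N, ℂ)) (z : Phase N) :
    coeffDeriv (u - u') φ z = coeffDeriv u φ z - coeffDeriv u' φ z := by
  refine ContinuousLinearMap.ext fun v => ?_
  rw [sub_apply, coeffDeriv_apply, coeffDeriv_apply, coeffDeriv_apply, inner_sub_left,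
    inner_sub_left]
  ring

/-- Since the bound is linear in ‖u‖ and locally bounded in `z`, the derivative formula survives
limits in `u`. -/
theorem norm_coeffDeriv_le (u : Hilb N) (φ : 𝓢(Config N, ℂ)) (z : Phase N) :
    ‖coeffDeriv u φ z‖ ≤ ‖u‖ * (‖fieldVec φ‖ + ‖z‖ * ‖toHilb N φ‖) := by
  refine ContinuousLinearMap.opNorm_le_bound _ (by positivity) fun v => ?_
  have h1 : ‖fieldVec φ v‖ ≤ ‖fieldVec φ‖ * ‖v‖ := (fieldVec φ).le_opNorm v
  have h2 : ‖weylOp z (fieldVec φ v)‖ ≤ ‖fieldVec φ‖ * ‖v‖ := by rwa [norm_weylOp_apply]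
  have h3 : ‖fieldVec (weylS z φ) v‖ ≤ ‖fieldVec φ‖ * ‖v‖ + 2 * ‖v‖ * ‖z‖ * ‖toHilb N φ‖ := by
    rw [fieldVec_weylS]
    refine (norm_add_le _ _).trans (add_le_add h2 ?_)
    rw [norm_smul, norm_weylOp_apply, Complex.norm_real]
    gcongr
    exact abs_symp_le v z
  have h4 : ‖Complex.I / 2‖ = 1 / 2 := by simp
  rw [coeffDeriv_apply, norm_mul, h4]
  calc 1 / 2 * ‖⟪u, fieldVec (weylS z φ) v⟫_ℂ + ⟪u, weylOp z (fieldVec φ v)⟫_ℂ‖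
      ≤ 1 / 2 * (‖u‖ * (‖fieldVec φ‖ * ‖v‖ + 2 * ‖v‖ * ‖z‖ * ‖toHilb N φ‖) +
          ‖u‖ * (‖fieldVec φ‖ * ‖v‖)) := by
        gcongr
        refine (norm_add_le _ _).trans (add_le_add ?_ ?_)
        · exact (norm_inner_le_norm _ _).trans (by gcongr)
        · exact (norm_inner_le_norm _ _).trans (by gcongr)
    _ = _ := by ring

/-- The derivative of `z ↦ (W(z) φ)(y)`. -/
def pointDeriv (φ : 𝓢(Config N, ℂ)) (z : Phase N) (y : Config N) : Phase N →L[ℝ] ℂ :=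
  (weylPhase z y * Complex.I * φ (y - z.1)) • (Complex.ofRealCLM ∘L
    (innerSL ℝ y ∘L ContinuousLinearMap.snd ℝ (Config N) (Config N) - (1 / 2 : ℝ) •
      (innerSL ℝ z.2 ∘L ContinuousLinearMap.fst ℝ (Config N) (Config N) +
        innerSL ℝ z.1 ∘L ContinuousLinearMap.snd ℝ (Config N) (Config N)))) -
  weylPhase z y • (fderiv ℝ φ (y - z.1) ∘L ContinuousLinearMap.fst ℝ (Config N) (Config N))

/-- The factor e^{−(i/2) q·p} in the Weyl operator is what makes the derivative the symmetric
average of G W and W G. -/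
theorem pointDeriv_apply (φ : 𝓢(Config N, ℂ)) (z v : Phase N) (y : Config N) :
    pointDeriv φ z y v =
      Complex.I / 2 * (fieldOp v (weylS z φ) y + weylS z (fieldOp v φ) y) := by
  have h3 : fieldOp v (weylS z φ) y = weylS z (fieldOp v φ) y + (symp v z : ℂ) * weylS z φ y := by
    rw [fieldOp_weylS]; rfl
  rw [h3, weylS_apply, weylS_apply, fieldOp_apply, symp, inner_sub_right]
  simp only [pointDeriv, sub_apply, add_apply, smul_apply, ContinuousLinearMap.comp_apply,
    innerSL_apply_apply, Complex.ofRealCLM_apply, smul_eq_mul, Complex.ofReal_sub,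
    Complex.ofReal_add, Complex.ofReal_mul, ContinuousLinearMap.coe_fst',
    ContinuousLinearMap.coe_snd', real_inner_comm v.1 z.2, real_inner_comm v.2 z.1,
    real_inner_comm v.2 y]
  push_cast
  linear_combination (-weylPhase z y * fderiv ℝ φ (y - z.1) v.1) * Complex.I_sq

theorem hasFDerivAt_point (φ : 𝓢(Config N, ℂ)) (z : Phase N) (y : Config N) :
    HasFDerivAt (fun z : Phase N => weylPhase z y * φ (y - z.1)) (pointDeriv φ z y) z := by
  have h1 : HasFDerivAt (fun z : Phase N => ⟪z.1, z.2⟫_ℝ)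
      (innerSL ℝ z.2 ∘L ContinuousLinearMap.fst ℝ (Config N) (Config N) +
        innerSL ℝ z.1 ∘L ContinuousLinearMap.snd ℝ (Config N) (Config N)) z := by
    refine (hasFDerivAt_fst.inner ℝ hasFDerivAt_snd).congr_fderiv ?_
    refine ContinuousLinearMap.ext fun v => ?_
    simp [real_inner_comm, add_comm]
  have h2 : HasFDerivAt (fun z : Phase N => ⟪z.2, y⟫_ℝ)
      (innerSL ℝ y ∘L ContinuousLinearMap.snd ℝ (Config N) (Config N)) z := by
    refine (innerSL ℝ y ∘L ContinuousLinearMap.snd ℝ (Config N) (Config N)).hasFDerivAt.congr_of_eventuallyEq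
      (.of_forall fun z => ?_)
    simp [real_inner_comm]
  have h3 := (Complex.ofRealCLM.hasFDerivAt.comp z (h2.sub (h1.const_smul (1 / 2 : ℝ))))
  have h4 := (h3.const_mul Complex.I).cexp
  have h5 : HasFDerivAt (fun z : Phase N => φ (y - z.1))
      (-(fderiv ℝ φ (y - z.1) ∘L ContinuousLinearMap.fst ℝ (Config N) (Config N))) z := by
    refine ((φ.hasFDerivAt (y - z.1)).comp z (hasFDerivAt_fst.const_sub y)).congr_fderiv ?_
    refine ContinuousLinearMap.ext fun v => ?_
    simp
  have h6 : ∀ z : Phase N, Complex.exp (Complex.I *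
      (Complex.ofRealCLM ∘ fun z : Phase N => ⟪z.2, y⟫_ℝ - (1 / 2 : ℝ) • ⟪z.1, z.2⟫_ℝ) z) =
        weylPhase z y := fun z => by
    rw [weylPhase, ← Complex.exp_add]
    congr 1
    simp only [Function.comp_apply, smul_eq_mul, Complex.ofRealCLM_apply]
    push_cast
    ring
  have h7 : HasFDerivAt (fun z : Phase N => weylPhase z y) _ z :=
    h4.congr_of_eventuallyEq (.of_forall fun z => (h6 z).symm)
  refine (h7.mul h5).congr_fderiv ?_
  have h6' : Complex.exp (Complex.I * (Complex.ofRealCLM ∘ ((fun z : Phase N => ⟪z.2, y⟫_ℝ) -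
      (1 / 2 : ℝ) • fun z : Phase N => ⟪z.1, z.2⟫_ℝ)) z) = weylPhase z y := h6 z
  refine ContinuousLinearMap.ext fun v => ?_
  simp only [pointDeriv, sub_apply, add_apply, smul_apply, neg_apply,
    ContinuousLinearMap.comp_apply, smul_eq_mul, h6']
  ring

theorem norm_pointDeriv_le (φ : 𝓢(Config N, ℂ)) {C₀ C₁ : ℝ} (h₀ : ∀ y, ‖φ y‖ ≤ C₀)
    (h₁ : ∀ y, ‖fderiv ℝ φ y‖ ≤ C₁) (z : Phase N) (y : Config N) :
    ‖pointDeriv φ z y‖ ≤ C₀ * (‖y‖ + ‖z‖) + C₁ := by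
  have hC₀ : 0 ≤ C₀ := (norm_nonneg _).trans (h₀ 0)
  have hC₁ : 0 ≤ C₁ := (norm_nonneg _).trans (h₁ 0)
  refine ContinuousLinearMap.opNorm_le_bound _ (by positivity) fun v => ?_
  have e1 : ‖v.1‖ ≤ ‖v‖ := norm_fst_le v
  have e2 : ‖v.2‖ ≤ ‖v‖ := norm_snd_le v
  have e3 : ‖z.1‖ ≤ ‖z‖ := norm_fst_le z
  have e4 : ‖z.2‖ ≤ ‖z‖ := norm_snd_le z
  have i1 : |⟪y, v.2⟫_ℝ| ≤ ‖y‖ * ‖v‖ := (abs_real_inner_le_norm _ _).trans (by gcongr)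
  have i2 : |⟪z.2, v.1⟫_ℝ| ≤ ‖z‖ * ‖v‖ := (abs_real_inner_le_norm _ _).trans (by gcongr)
  have i3 : |⟪z.1, v.2⟫_ℝ| ≤ ‖z‖ * ‖v‖ := (abs_real_inner_le_norm _ _).trans (by gcongr)
  have i4 : |⟪y, v.2⟫_ℝ - 1 / 2 * (⟪z.2, v.1⟫_ℝ + ⟪z.1, v.2⟫_ℝ)| ≤ (‖y‖ + ‖z‖) * ‖v‖ := by
    rw [abs_le] at *
    constructor <;> linarith
  have i5 : ‖fderiv ℝ φ (y - z.1) v.1‖ ≤ C₁ * ‖v‖ :=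
    (ContinuousLinearMap.le_opNorm _ _).trans (by gcongr; exact h₁ _)
  have h : pointDeriv φ z y v = weylPhase z y * Complex.I * φ (y - z.1) *
      ((⟪y, v.2⟫_ℝ - 1 / 2 * (⟪z.2, v.1⟫_ℝ + ⟪z.1, v.2⟫_ℝ) : ℝ) : ℂ) -
      weylPhase z y * fderiv ℝ φ (y - z.1) v.1 := rfl
  rw [h]
  refine (norm_sub_le _ _).trans ?_
  simp only [norm_mul, norm_weylPhase, Complex.norm_I, one_mul, Complex.norm_real,
    Real.norm_eq_abs]
  calc ‖φ (y - z.1)‖ * |⟪y, v.2⟫_ℝ - 1 / 2 * (⟪z.2, v.1⟫_ℝ + ⟪z.1, v.2⟫_ℝ)| +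
        ‖fderiv ℝ φ (y - z.1) v.1‖ ≤ C₀ * ((‖y‖ + ‖z‖) * ‖v‖) + C₁ * ‖v‖ := by
        gcongr
        exact h₀ _
    _ = _ := by ring

theorem continuous_pointDeriv (φ : 𝓢(Config N, ℂ)) (z : Phase N) :
    Continuous (pointDeriv φ z) := by
  have h1 : Continuous (fderiv ℝ φ) := (φ.smooth 1).continuous_fderiv one_ne_zero
  have h2 := continuous_weylPhase z
  have h3 : Continuous φ := φ.continuous
  have h4 : Continuous fun y : Config N => (innerSL ℝ y : Config N →L[ℝ] ℝ) :=
    (innerSL ℝ (E := Config N)).continuous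
  unfold pointDeriv
  fun_prop

theorem hasFDerivAt_coeff_schwartz (ψ φ : 𝓢(Config N, ℂ)) (z : Phase N) :
    HasFDerivAt (fun z => ⟪toHilb N ψ, weylOp z (toHilb N φ)⟫_ℂ)
      (coeffDeriv (toHilb N ψ) φ z) z := by
  obtain ⟨C₀, h₀⟩ : ∃ C, ∀ y, ‖φ y‖ ≤ C :=
    ⟨_, fun y => SchwartzMap.norm_le_seminorm ℝ φ y⟩
  obtain ⟨C₁, h₁⟩ : ∃ C, ∀ y, ‖fderiv ℝ φ y‖ ≤ C :=
    ⟨_, fun y => SchwartzMap.norm_le_seminorm ℝ (SchwartzMap.fderivCLM ℝ _ _ φ) y⟩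
  have hC₀ : 0 ≤ C₀ := (norm_nonneg _).trans (h₀ 0)
  have hF : ∀ z : Phase N, ⟪toHilb N ψ, weylOp z (toHilb N φ)⟫_ℂ =
      ∫ y, (starRingEnd ℂ) (ψ y) * (weylPhase z y * φ (y - z.1)) := fun z => by
    rw [weylOp_toHilb, inner_toHilb]
    congr 1 with y
    rw [weylS_apply, RCLike.inner_apply, mul_comm]
  have hint : ∀ χ : 𝓢(Config N, ℂ), Integrable fun y => (starRingEnd ℂ) (ψ y) * χ y := fun χ => by
    have h := (SchwartzMap.pairing (ContinuousLinearMap.mul ℝ ℂ)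
      (SchwartzMap.postcompCLM (𝕜 := ℝ) (Complex.conjCLE : ℂ →L[ℝ] ℂ) ψ) χ).integrable
      (μ := volume)
    exact h
  have hcψ : Continuous fun y => (starRingEnd ℂ) (ψ y) :=
    Complex.continuous_conj.comp ψ.continuous
  -- On the unit ball around `z` the derivative of the integrand grows at most linearly in `y`,
  -- which the Schwartz function `ψ` absorbs.
  have key := hasFDerivAt_integral_of_dominated_of_fderiv_le (𝕜 := ℝ) (μ := volume)
    (s := Metric.ball z 1) (x₀ := z)
    (F := fun z y => (starRingEnd ℂ) (ψ y) * (weylPhase z y * φ (y - z.1)))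
    (F' := fun z y => (starRingEnd ℂ) (ψ y) • pointDeriv φ z y)
    (bound := fun y => C₀ * (‖y‖ * ‖ψ y‖) + (C₀ * (‖z‖ + 1) + C₁) * ‖ψ y‖)
    (Metric.ball_mem_nhds z one_pos)
    (.of_forall fun w => (hcψ.mul ((continuous_weylPhase w).mul
      (φ.continuous.comp (continuous_id.sub continuous_const)))).aestronglyMeasurable)
    ((hint (weylS z φ)).congr (.of_forall fun y => by simp only [weylS_apply]))
    (hcψ.smul (continuous_pointDeriv φ z)).aestronglyMeasurable
    (.of_forall fun y w hw => by
      have hw' : ‖w‖ ≤ ‖z‖ + 1 := by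
        have h1 := norm_le_norm_add_norm_sub z w
        have h2 : ‖w - z‖ < 1 := by simpa [dist_eq_norm] using hw
        rw [norm_sub_rev] at h2
        linarith
      rw [norm_smul, RCLike.norm_conj]
      calc ‖ψ y‖ * ‖pointDeriv φ w y‖ ≤ ‖ψ y‖ * (C₀ * (‖y‖ + (‖z‖ + 1)) + C₁) := by
            gcongr
            exact (norm_pointDeriv_le φ h₀ h₁ w y).trans (by gcongr)
        _ = _ := by ring)
    (by
      have h1 := ψ.integrable_pow_mul volume 1
      simp only [pow_one] at h1
      exact (h1.const_mul _).add ((ψ.integrable.norm).const_mul _))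
    (.of_forall fun y w _ => (hasFDerivAt_point φ w y).const_mul _)
  have hF' : (fun z => ⟪toHilb N ψ, weylOp z (toHilb N φ)⟫_ℂ) = fun z : Phase N =>
      ∫ y, (starRingEnd ℂ) (ψ y) * (weylPhase z y * φ (y - z.1)) := funext hF
  rw [hF']
  refine key.congr_fderiv ?_
  have hint' : Integrable fun y => (starRingEnd ℂ) (ψ y) • pointDeriv φ z y := by
    have h1 := ψ.integrable_pow_mul volume 1
    simp only [pow_one] at h1
    refine ((h1.const_mul C₀).add ((ψ.integrable.norm (μ := volume)).const_mul
      (C₀ * ‖z‖ + C₁))).mono'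
      (hcψ.smul (continuous_pointDeriv φ z)).aestronglyMeasurable (.of_forall fun y => ?_)
    rw [norm_smul, RCLike.norm_conj]
    calc ‖ψ y‖ * ‖pointDeriv φ z y‖ ≤ ‖ψ y‖ * (C₀ * (‖y‖ + ‖z‖) + C₁) := by
          gcongr
          exact norm_pointDeriv_le φ h₀ h₁ z y
      _ = _ := by simp only [Pi.add_apply]; ring
  refine ContinuousLinearMap.ext fun v => ?_
  rw [ContinuousLinearMap.integral_apply hint', coeffDeriv_apply, fieldVec_apply, fieldVec_apply,
    weylOp_toHilb, inner_toHilb, inner_toHilb]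
  have e : ∀ χ : 𝓢(Config N, ℂ), (fun y => ⟪ψ y, χ y⟫_ℂ) = fun y => (starRingEnd ℂ) (ψ y) * χ y :=
    fun χ => funext fun y => by rw [RCLike.inner_apply, mul_comm]
  rw [e, e, ← integral_add (hint _) (hint _), ← integral_const_mul]
  congr 1 with y
  rw [smul_apply, pointDeriv_apply, smul_eq_mul]
  ring

/-- Approximating `u` by Schwartz functions, the derivatives converge uniformly on a ball. Only the
vector on which W(z) acts has to be Schwartz; this asymmetry is used for u = T* W(x)g. -/
theorem hasFDerivAt_coeff (u : Hilb N) (φ : 𝓢(Config N, ℂ)) (z : Phase N) :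
    HasFDerivAt (fun z => ⟪u, weylOp z (toHilb N φ)⟫_ℂ) (coeffDeriv u φ z) z := by
  obtain ⟨s, hs, hlim⟩ := mem_closure_iff_seq_limit.1 (denseRange_toHilb N u)
  choose ψ hψ using hs
  refine hasFDerivAt_of_tendstoUniformlyOn (l := atTop) (Metric.isOpen_ball (x := z) (ε := 1))
    (f := fun n z => ⟪s n, weylOp z (toHilb N φ)⟫_ℂ) (f' := fun n z => coeffDeriv (s n) φ z)
    (g' := fun z => coeffDeriv u φ z) ?_ (fun n w _ => ?_) (fun w _ => hlim.inner tendsto_const_nhds)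
    (Metric.mem_ball_self one_pos)
  · rw [Metric.tendstoUniformlyOn_iff]
    intro ε hε
    have h1 : Tendsto (fun n => ‖u - s n‖ *
        (‖fieldVec φ‖ + (‖z‖ + 1) * ‖toHilb N φ‖)) atTop (𝓝 0) := by
      have h2 := (tendsto_const_nhds (x := u)).sub hlim
      rw [sub_self] at h2
      simpa using h2.norm.mul_const (‖fieldVec φ‖ + (‖z‖ + 1) * ‖toHilb N φ‖)
    filter_upwards [h1.eventually (gt_mem_nhds hε)] with n hn w hw
    rw [dist_eq_norm, ← coeffDeriv_sub]
    refine lt_of_le_of_lt ((norm_coeffDeriv_le _ _ _).trans ?_) hn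
    gcongr
    have h3 := norm_le_norm_add_norm_sub z w
    have h4 : ‖w - z‖ < 1 := by simpa [dist_eq_norm] using hw
    rw [norm_sub_rev] at h4
    linarith
  · rw [← hψ]
    exact hasFDerivAt_coeff_schwartz (ψ n) φ w

end Derivative

/-! ### Strong continuity -/

section Continuity

variable {N : ℕ}

theorem tendsto_of_tendsto_inner {α E : Type*} [NormedAddCommGroup E] [InnerProductSpace ℂ E]
    {l : Filter α} {f : α → E} {x : E} (hn : ∀ a, ‖f a‖ = ‖x‖)
    (hf : Tendsto (fun a => ⟪x, f a⟫_ℂ) l (𝓝 ⟪x, x⟫_ℂ)) : Tendsto f l (𝓝 x) := by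
  -- With equal norms, ‖x − f a‖² = 2‖x‖² − 2 Re⟨x, f a⟩, so weak convergence against `x` suffices.
  have h2 : Tendsto (fun a => ‖x - f a‖ ^ 2) l (𝓝 0) := by
    have h3 := ((tendsto_const_nhds (x := ‖x‖ ^ 2)).sub
      (((RCLike.continuous_re (K := ℂ)).tendsto _).comp hf |>.const_mul 2)).add
      (tendsto_const_nhds (x := ‖x‖ ^ 2))
    have h4 : ‖x‖ ^ 2 - 2 * RCLike.re ⟪x, x⟫_ℂ + ‖x‖ ^ 2 = 0 := by
      rw [inner_self_eq_norm_sq]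
      ring
    rw [h4] at h3
    refine h3.congr fun a => ?_
    rw [@norm_sub_sq ℂ, hn]
    rfl
  have h5 : Tendsto (fun a => ‖x - f a‖) l (𝓝 0) := by
    simpa [Real.sqrt_sq (norm_nonneg _)] using h2.sqrt
  refine tendsto_iff_norm_sub_tendsto_zero.2 ?_
  simpa only [norm_sub_rev] using h5

theorem continuous_weylOp_toHilb (φ : 𝓢(Config N, ℂ)) :
    Continuous fun z : Phase N => weylOp z (toHilb N φ) := by
  refine continuous_iff_continuousAt.2 fun z => tendsto_of_tendsto_inner (fun w => ?_) ?_
  · rw [norm_weylOp_apply, norm_weylOp_apply]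
  · exact (hasFDerivAt_coeff (weylOp z (toHilb N φ)) φ z).continuousAt.tendsto

theorem continuous_weylOp (u : Hilb N) : Continuous fun z : Phase N => weylOp z u := by
  refine continuous_of_uniform_approx_of_continuous fun s hs => ?_
  obtain ⟨ε, hε, hs⟩ := Metric.mem_uniformity_dist.1 hs
  obtain ⟨φ, hφ⟩ := Metric.mem_closure_range_iff.1 (denseRange_toHilb N u) ε hε
  refine ⟨_, continuous_weylOp_toHilb φ, fun z => hs ?_⟩
  rwa [dist_eq_norm, ← map_sub, norm_weylOp_apply, ← dist_eq_norm]

theorem continuous_coeff (u v : Hilb N) : Continuous fun z : Phase N => ⟪u, weylOp z v⟫_ℂ :=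
  continuous_const.inner (continuous_weylOp v)

end Continuity

/-! ### The orthogonality relations -/

section Moyal

variable {N : ℕ}

instance isAddHaarMeasure_phaseMeasure : (phaseMeasure N).IsAddHaarMeasure :=
  have : (volume : Measure (Phase N)).IsAddHaarMeasure :=
    inferInstanceAs (Measure.prod volume volume).IsAddHaarMeasure
  Measure.IsAddHaarMeasure.smul volume (by simp; positivity) ENNReal.ofReal_ne_top

theorem enorm_toHilb_sq (φ : 𝓢(Config N, ℂ)) : ‖toHilb N φ‖ₑ ^ 2 = ∫⁻ y, ‖φ y‖ₑ ^ 2 := by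
  have h : ‖toHilb N φ‖ₑ = eLpNorm φ 2 volume := by
    rw [Lp.enorm_def]
    exact eLpNorm_congr_ae (coeFn_toHilb φ)
  rw [h, eLpNorm_eq_lintegral_rpow_enorm_toReal (by simp) (by simp), ← ENNReal.rpow_natCast,
    ← ENNReal.rpow_mul]
  simp

/-- The function `y ↦ conj ψ(y) φ(y - q)`. -/
def shiftProduct (ψ φ : 𝓢(Config N, ℂ)) (q : Config N) : 𝓢(Config N, ℂ) :=
  SchwartzMap.pairing (ContinuousLinearMap.mul ℝ ℂ)
    (SchwartzMap.postcompCLM (𝕜 := ℝ) (Complex.conjCLE : ℂ →L[ℝ] ℂ) ψ)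
    (SchwartzMap.compSubConstCLM ℝ q φ)

theorem shiftProduct_apply (ψ φ : 𝓢(Config N, ℂ)) (q y : Config N) :
    shiftProduct ψ φ q y = (starRingEnd ℂ) (ψ y) * φ (y - q) := rfl

open scoped FourierTransform in
-- At fixed `q` the coefficient is, up to a unimodular constant, ∫ e^{i p·y} conj ψ(y) φ(y − q) dy;
-- the rescaling of `p` adapts this to the kernel e^{−2πi y·ξ}.
theorem norm_coeff_eq_norm_fourier (ψ φ : 𝓢(Config N, ℂ)) (q p : Config N) :
    ‖⟪toHilb N ψ, weylOp (q, p) (toHilb N φ)⟫_ℂ‖ =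
      ‖𝓕 (shiftProduct ψ φ q) ((-(2 * Real.pi)⁻¹ : ℝ) • p)‖ := by
  rw [weylOp_toHilb, inner_toHilb, SchwartzMap.fourier_coe, Real.fourier_eq']
  have h : ∀ y, ⟪ψ y, weylS (q, p) φ y⟫_ℂ = Complex.exp (-(Complex.I / 2) * (⟪q, p⟫_ℝ : ℝ)) *
      (Complex.exp (((-2 * Real.pi * ⟪y, (-(2 * Real.pi)⁻¹ : ℝ) • p⟫_ℝ : ℝ) : ℂ) * Complex.I) •
        shiftProduct ψ φ q y) := fun y => by
    have h1 : -2 * Real.pi * ⟪y, (-(2 * Real.pi)⁻¹ : ℝ) • p⟫_ℝ = ⟪p, y⟫_ℝ := by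
      rw [inner_smul_right, real_inner_comm]
      field_simp
    rw [h1, weylS_apply, shiftProduct_apply, RCLike.inner_apply, weylPhase, smul_eq_mul,
      mul_comm _ Complex.I]
    ring
  simp_rw [h]
  rw [integral_const_mul, norm_mul, Complex.norm_exp]
  simp

/-- Plancherel in `p`. The rescaling by −1/(2π) yields the Jacobian (2π)^N, which the normalization
of the phase space measure cancels. -/
theorem lintegral_coeff_fst (ψ φ : 𝓢(Config N, ℂ)) (q : Config N) :
    ∫⁻ p, ‖⟪toHilb N ψ, weylOp (q, p) (toHilb N φ)⟫_ℂ‖ₑ ^ 2 =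
      ENNReal.ofReal ((2 * Real.pi) ^ N) * ∫⁻ y, ‖ψ y‖ₑ ^ 2 * ‖φ (y - q)‖ₑ ^ 2 := by
  have hsq : ∀ f : 𝓢(Config N, ℂ), Integrable (fun y => ‖f y‖ ^ 2) := fun f =>
    (f.memLp 2 volume).integrable_norm_pow two_ne_zero
  have hl : ∀ f : 𝓢(Config N, ℂ), ∫⁻ y, ‖f y‖ₑ ^ 2 = ENNReal.ofReal (∫ y, ‖f y‖ ^ 2) := fun f => by
    rw [ofReal_integral_eq_lintegral_ofReal (hsq f) (.of_forall fun _ => by positivity)]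
    congr 1 with y
    rw [ENNReal.ofReal_pow (norm_nonneg _), ofReal_norm]
  have h1 : ∀ y, ‖ψ y‖ₑ ^ 2 * ‖φ (y - q)‖ₑ ^ 2 = ‖shiftProduct ψ φ q y‖ₑ ^ 2 := fun y => by
    rw [shiftProduct_apply, enorm_mul, mul_pow]
    congr 2
    rw [enorm_eq_nnnorm, enorm_eq_nnnorm, RCLike.nnnorm_conj]
  have hne : (-(2 * Real.pi)⁻¹ : ℝ) ≠ 0 := by
    have := Real.pi_pos
    simp [Real.pi_ne_zero]
  simp_rw [h1, hl]
  have h2 : ∀ p, ‖⟪toHilb N ψ, weylOp (q, p) (toHilb N φ)⟫_ℂ‖ₑ ^ 2 = ENNReal.ofReal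
      (‖(FourierTransform.fourier (shiftProduct ψ φ q)) ((-(2 * Real.pi)⁻¹ : ℝ) • p)‖ ^ 2) :=
    fun p => by
      rw [← norm_coeff_eq_norm_fourier, ENNReal.ofReal_pow (norm_nonneg _), ofReal_norm]
  simp_rw [h2]
  rw [← ofReal_integral_eq_lintegral_ofReal
    ((integrable_comp_smul_iff volume _ hne).2 (hsq _)) (.of_forall fun _ => by positivity),
    Measure.integral_comp_smul volume
      (fun p => ‖(FourierTransform.fourier (shiftProduct ψ φ q)) p‖ ^ 2),
    SchwartzMap.integral_norm_sq_fourier, smul_eq_mul, ENNReal.ofReal_mul (abs_nonneg _)]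
  congr 2
  rw [finrank_euclideanSpace_fin, abs_inv, abs_pow, abs_neg, abs_inv, inv_pow, inv_inv,
    abs_of_pos Real.two_pi_pos]

theorem lintegral_coeff_schwartz (ψ φ : 𝓢(Config N, ℂ)) :
    ∫⁻ z, ‖⟪toHilb N ψ, weylOp z (toHilb N φ)⟫_ℂ‖ₑ ^ 2 ∂(phaseMeasure N) =
      ‖toHilb N ψ‖ₑ ^ 2 * ‖toHilb N φ‖ₑ ^ 2 := by
  have hm : Measurable fun z : Phase N => ‖⟪toHilb N ψ, weylOp z (toHilb N φ)⟫_ℂ‖ₑ ^ 2 :=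
    ((continuous_coeff _ _).measurable.enorm).pow_const 2
  have hψ : Measurable fun y => ‖ψ y‖ₑ ^ 2 := ψ.continuous.measurable.enorm.pow_const 2
  have hφ : Measurable fun y => ‖φ y‖ₑ ^ 2 := φ.continuous.measurable.enorm.pow_const 2
  have hm2 : Measurable fun x : Config N × Config N => ‖ψ x.2‖ₑ ^ 2 * ‖φ (x.2 - x.1)‖ₑ ^ 2 :=
    (hψ.comp measurable_snd).mul (hφ.comp (measurable_snd.sub measurable_fst))
  rw [phaseMeasure, lintegral_smul_measure, Measure.volume_eq_prod,
    lintegral_prod _ hm.aemeasurable]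
  simp_rw [lintegral_coeff_fst]
  rw [lintegral_const_mul' _ _ ENNReal.ofReal_ne_top, lintegral_lintegral_swap hm2.aemeasurable]
  have h1 : ∀ y, ∫⁻ q, ‖ψ y‖ₑ ^ 2 * ‖φ (y - q)‖ₑ ^ 2 = ‖ψ y‖ₑ ^ 2 * ‖toHilb N φ‖ₑ ^ 2 :=
    fun y => by
      rw [lintegral_const_mul' _ _ (ENNReal.pow_ne_top enorm_ne_top), enorm_toHilb_sq]
      congr 1
      exact lintegral_sub_left_eq_self (fun q => ‖φ q‖ₑ ^ 2) y
  simp_rw [h1]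
  rw [lintegral_mul_const _ hψ, ← enorm_toHilb_sq, smul_eq_mul, ← mul_assoc,
    ← ENNReal.ofReal_mul (by positivity), inv_mul_cancel₀ (by positivity), ENNReal.ofReal_one,
    one_mul]

theorem eLpNorm_coeff_schwartz (ψ φ : 𝓢(Config N, ℂ)) :
    eLpNorm (fun z => ⟪toHilb N ψ, weylOp z (toHilb N φ)⟫_ℂ) 2 (phaseMeasure N) =
      ‖toHilb N ψ‖ₑ * ‖toHilb N φ‖ₑ := by
  have h := lintegral_coeff_schwartz ψ φ
  refine (ENNReal.pow_right_strictMono two_ne_zero).injective ?_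
  beta_reduce
  rw [mul_pow, ← h, eLpNorm_eq_lintegral_rpow_enorm_toReal (by simp) (by simp),
    ← ENNReal.rpow_natCast, ← ENNReal.rpow_mul]
  simp

/-- Fatou along Schwartz approximations; the inequality gives membership in L², after which equality
follows by density. -/
theorem eLpNorm_coeff_le (u v : Hilb N) :
    eLpNorm (fun z => ⟪u, weylOp z v⟫_ℂ) 2 (phaseMeasure N) ≤ ‖u‖ₑ * ‖v‖ₑ := by
  obtain ⟨s, hs, hlim⟩ := mem_closure_iff_seq_limit.1 (denseRange_toHilb N u)
  obtain ⟨t, ht, hlim'⟩ := mem_closure_iff_seq_limit.1 (denseRange_toHilb N v)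
  choose ψ hψ using hs
  choose φ hφ using ht
  refine (Lp.eLpNorm_lim_le_liminf_eLpNorm (p := 2) (f := fun n z => ⟪s n, weylOp z (t n)⟫_ℂ)
    (fun n => (continuous_coeff _ _).aestronglyMeasurable) _
    (.of_forall fun z => hlim.inner (((weylOp z).continuous.tendsto v).comp hlim'))).trans ?_
  have h : ∀ n, eLpNorm (fun z => ⟪s n, weylOp z (t n)⟫_ℂ) 2 (phaseMeasure N) =
      ‖s n‖ₑ * ‖t n‖ₑ := fun n => by
    rw [← hψ, ← hφ, eLpNorm_coeff_schwartz]
  simp_rw [h]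
  refine le_of_eq (Tendsto.liminf_eq ?_)
  exact ENNReal.Tendsto.mul hlim.enorm (Or.inr enorm_ne_top) hlim'.enorm (Or.inr enorm_ne_top)

theorem memLp_coeff (u v : Hilb N) :
    MemLp (fun z => ⟪u, weylOp z v⟫_ℂ) 2 (phaseMeasure N) :=
  ⟨(continuous_coeff _ _).aestronglyMeasurable,
    (eLpNorm_coeff_le u v).trans_lt (ENNReal.mul_lt_top enorm_lt_top enorm_lt_top)⟩

/-- The matrix coefficient `z ↦ ⟨u, W(z) v⟩`, as an element of `L²(X, dx)`. -/
def coeffLp (N : ℕ) : Hilb N →L⋆[ℂ] Hilb N →L[ℂ] Lp ℂ 2 (phaseMeasure N) :=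
  LinearMap.mkContinuous₂ (LinearMap.mk₂'ₛₗ (starRingEnd ℂ) (RingHom.id ℂ)
    (fun u v => (memLp_coeff u v).toLp _)
    (fun u u' v => by
      rw [← MemLp.toLp_add, MemLp.toLp_eq_toLp_iff]
      exact .of_forall fun z => inner_add_left _ _ _)
    (fun c u v => by
      rw [← MemLp.toLp_const_smul, MemLp.toLp_eq_toLp_iff]
      exact .of_forall fun z => inner_smul_left _ _ _)
    (fun u v v' => by
      rw [← MemLp.toLp_add, MemLp.toLp_eq_toLp_iff]
      exact .of_forall fun z => by simp only [map_add, inner_add_right, Pi.add_apply])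
    (fun c u v => by
      rw [RingHom.id_apply, ← MemLp.toLp_const_smul, MemLp.toLp_eq_toLp_iff]
      exact .of_forall fun z => by simp only [map_smul, inner_smul_right, Pi.smul_apply,
        smul_eq_mul])) 1
    (fun u v => by
      rw [LinearMap.mk₂'ₛₗ_apply, Lp.norm_toLp, one_mul]
      refine ENNReal.toReal_le_of_le_ofReal (by positivity) ((eLpNorm_coeff_le u v).trans_eq ?_)
      rw [ENNReal.ofReal_mul (norm_nonneg _), ofReal_norm, ofReal_norm])

theorem coeffLp_apply (u v : Hilb N) : coeffLp N u v = (memLp_coeff u v).toLp _ := rfl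

theorem coeFn_coeffLp (u v : Hilb N) :
    coeffLp N u v =ᵐ[phaseMeasure N] fun z => ⟪u, weylOp z v⟫_ℂ :=
  (memLp_coeff u v).coeFn_toLp

theorem norm_coeffLp (u v : Hilb N) : ‖coeffLp N u v‖ = ‖u‖ * ‖v‖ := by
  refine (denseRange_toHilb N).induction_on₂ (p := fun u v => ‖coeffLp N u v‖ = ‖u‖ * ‖v‖)
    (isClosed_eq ?_ ?_) (fun ψ φ => ?_) u v
  · exact ((coeffLp N).continuous.comp continuous_fst |>.clm_apply continuous_snd).norm
  · fun_prop
  · rw [coeffLp_apply, Lp.norm_toLp, eLpNorm_coeff_schwartz, ENNReal.toReal_mul]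
    simp

/-- Two polarizations of the norm identity: `hdiag` is the one in the right arguments, and the
vectors u + u' and iu + u' give the one in the left arguments. -/
theorem inner_coeffLp_coeffLp (u v u' v' : Hilb N) :
    ⟪coeffLp N u v, coeffLp N u' v'⟫_ℂ = ⟪v, v'⟫_ℂ * ⟪u', u⟫_ℂ := by
  have hdiag : ∀ w, ⟪coeffLp N w v, coeffLp N w v'⟫_ℂ = ⟪v, v'⟫_ℂ * ⟪w, w⟫_ℂ := fun w => by
    rw [inner_eq_sum_norm_sq_div_four, inner_eq_sum_norm_sq_div_four v v', ← map_add, ← map_sub,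
      ← map_smul, ← map_add, ← map_sub, inner_self_eq_norm_sq_to_K]
    simp only [norm_coeffLp]
    push_cast
    ring
  have h1 := hdiag (u + u')
  have h2 := hdiag (Complex.I • u + u')
  simp only [map_add, add_apply, inner_add_left, inner_add_right, hdiag, map_smulₛₗ, smul_apply,
    inner_smul_left, inner_smul_right, Complex.conj_I, map_neg] at h1 h2
  linear_combination (1 / 2) * h1 - (Complex.I / 2) * h2 + (1 / 2) *
    (⟪coeffLp N u v, coeffLp N u' v'⟫_ℂ - ⟪coeffLp N u' v, coeffLp N u v'⟫_ℂ -
      ⟪v, v'⟫_ℂ * ⟪u', u⟫_ℂ + ⟪v, v'⟫_ℂ * ⟪u, u'⟫_ℂ) * Complex.I_sq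

theorem integrable_coeff_mul (u v u' v' : Hilb N) :
    Integrable (fun z => (starRingEnd ℂ) ⟪u, weylOp z v⟫_ℂ * ⟪u', weylOp z v'⟫_ℂ)
      (phaseMeasure N) :=
  (memLp_coeff u v).star.integrable_mul (memLp_coeff u' v')

theorem integral_coeff_mul (u v u' v' : Hilb N) :
    ∫ z, (starRingEnd ℂ) ⟪u, weylOp z v⟫_ℂ * ⟪u', weylOp z v'⟫_ℂ ∂(phaseMeasure N) =
      ⟪v, v'⟫_ℂ * ⟪u', u⟫_ℂ := by
  rw [← inner_coeffLp_coeffLp, L2.inner_def]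
  refine integral_congr_ae ?_
  filter_upwards [coeFn_coeffLp u v, coeFn_coeffLp u' v'] with z h1 h2
  rw [h1, h2, RCLike.inner_apply, mul_comm]

/-- Cauchy–Schwarz, the two L² norms being known from orthogonality; it supplies the absolute
integrability for Fubini. -/
theorem integral_norm_coeff_mul_le (u v u' v' : Hilb N) :
    ∫ z, ‖⟪u, weylOp z v⟫_ℂ‖ * ‖⟪u', weylOp z v'⟫_ℂ‖ ∂(phaseMeasure N) ≤
      ‖u‖ * ‖v‖ * (‖u'‖ * ‖v'‖) := by
  have h2 : ∀ u v : Hilb N, (∫ z, ‖⟪u, weylOp z v⟫_ℂ‖ ^ (2 : ℝ) ∂(phaseMeasure N)) ^ (1 / 2 : ℝ) =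
      ‖u‖ * ‖v‖ := fun u v => by
    have h := (integral_coeff_mul u v u v)
    have h1 : ∀ z : Phase N, (starRingEnd ℂ) ⟪u, weylOp z v⟫_ℂ * ⟪u, weylOp z v⟫_ℂ =
        ((‖⟪u, weylOp z v⟫_ℂ‖ ^ (2 : ℝ) : ℝ) : ℂ) := fun z => by
      rw [Complex.conj_mul']
      norm_cast
    simp_rw [h1] at h
    rw [integral_complex_ofReal, inner_self_eq_norm_sq_to_K, inner_self_eq_norm_sq_to_K] at h
    have h3 : ∫ z, ‖⟪u, weylOp z v⟫_ℂ‖ ^ (2 : ℝ) ∂(phaseMeasure N) = (‖u‖ * ‖v‖) ^ 2 := by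
      apply Complex.ofReal_injective
      rw [h]
      push_cast
      rw [mul_pow]
      exact mul_comm _ _
    rw [h3, ← Real.sqrt_eq_rpow, Real.sqrt_sq (by positivity)]
  have h := integral_mul_norm_le_Lp_mul_Lq (μ := phaseMeasure N)
    (f := fun z => ⟪u, weylOp z v⟫_ℂ) (g := fun z => ⟪u', weylOp z v'⟫_ℂ) (p := 2) (q := 2)
    Real.HolderConjugate.two_two (by simpa using memLp_coeff u v) (by simpa using memLp_coeff u' v')
  rwa [h2, h2] at h

/-- The resolution of the identity by coherent states. -/
theorem integral_inner_weylOp_mul_inner (g u v : Hilb N) :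
    ∫ z, ⟪u, weylOp z g⟫_ℂ * ⟪weylOp z g, v⟫_ℂ ∂(phaseMeasure N) = ⟪g, g⟫_ℂ * ⟪u, v⟫_ℂ := by
  rw [← integral_coeff_mul]
  congr 1 with z
  rw [inner_conj_symm, mul_comm]

end Moyal

/-! ### The Weyl transform of Hilbert–Schmidt operators -/

section HilbertSchmidtTransform

variable {N : ℕ}

instance separableSpace_hilb : TopologicalSpace.SeparableSpace (Hilb N) :=
  have : Fact ((2 : ENNReal) ≠ ⊤) := ⟨by simp⟩
  inferInstance

/-- The isometry `v ↦ ⟨eₖ, W(·) v⟩`, for a vector `eₖ` of the orthonormal basis. -/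
def coeffIsometry (k : onbIndex (Hilb N)) : Hilb N →ₗᵢ[ℂ] Lp ℂ 2 (phaseMeasure N) where
  toLinearMap := (coeffLp N (onb (Hilb N) k)).toLinearMap
  norm_map' v := by
    have h : ‖coeffLp N (onb (Hilb N) k) v‖ = ‖v‖ := by
      rw [norm_coeffLp, (onb (Hilb N)).orthonormal.1 k, one_mul]
    exact h

theorem coeffIsometry_apply (k : onbIndex (Hilb N)) (v : Hilb N) :
    coeffIsometry k v = coeffLp N (onb (Hilb N) k) v := rfl

theorem orthogonalFamily_coeffIsometry :
    OrthogonalFamily ℂ (fun _ : onbIndex (Hilb N) => Hilb N) coeffIsometry := by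
  intro i j hij v w
  rw [coeffIsometry_apply, coeffIsometry_apply, inner_coeffLp_coeffLp,
    (onb (Hilb N)).orthonormal.2 hij.symm, mul_zero]

/-- The Weyl transform of a Hilbert–Schmidt operator. -/
def weylHS (T : Hilb N →L[ℂ] Hilb N) : Lp ℂ 2 (phaseMeasure N) :=
  ∑' k, coeffLp N (onb (Hilb N) k) (T (onb (Hilb N) k))

theorem hasSum_weylHS {T : Hilb N →L[ℂ] Hilb N} (hT : IsHilbertSchmidt T) :
    HasSum (fun k => coeffLp N (onb (Hilb N) k) (T (onb (Hilb N) k))) (weylHS T) :=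
  Summable.hasSum ((orthogonalFamily_coeffIsometry.summable_iff_norm_sq_summable
    (fun k => T (onb (Hilb N) k))).2 hT.summable)

theorem weylHS_sub {S T : Hilb N →L[ℂ] Hilb N} (hS : IsHilbertSchmidt S)
    (hT : IsHilbertSchmidt T) : weylHS (S - T) = weylHS S - weylHS T := by
  refine (hasSum_weylHS (hS.sub hT)).unique ?_
  simpa only [sub_apply, map_sub] using (hasSum_weylHS hS).sub (hasSum_weylHS hT)

/-- Pythagoras on the finite partial sums, which lie in mutually orthogonal copies of the Hilbert
space. -/
theorem enorm_weylHS {T : Hilb N →L[ℂ] Hilb N} (hT : IsHilbertSchmidt T) :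
    ‖weylHS T‖ₑ = hsNorm T := by
  have h1 : HasSum (fun k => ‖T (onb (Hilb N) k)‖ ^ 2) (‖weylHS T‖ ^ 2) := by
    have h2 : Tendsto (fun F : Finset (onbIndex (Hilb N)) =>
        ‖∑ k ∈ F, coeffIsometry k (T (onb (Hilb N) k))‖ ^ 2) atTop (𝓝 (‖weylHS T‖ ^ 2)) :=
      (Tendsto.norm (hasSum_weylHS hT)).pow 2
    simp_rw [orthogonalFamily_coeffIsometry.norm_sum] at h2
    exact h2
  rw [hT.hsNorm_eq, h1.tsum_eq, Real.sqrt_sq (norm_nonneg _), ofReal_norm]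

/-- The series converges in L² to one side, hence almost everywhere along a subsequence of partial
sums, and at every point to the trace; the two limits coincide. -/
theorem coeFn_weylHS_of_isTraceClass {S : Hilb N →L[ℂ] Hilb N} (hS : IsTraceClass S) :
    weylHS S =ᵐ[phaseMeasure N] weylFun S := by
  have := countable_onbIndex (H := Hilb N)
  obtain ⟨F, hF⟩ := exists_seq_tendsto (atTop : Filter (Finset (onbIndex (Hilb N))))
  have h1 := Tendsto.comp (hasSum_weylHS hS.isHilbertSchmidt) hF
  have h2 := tendstoInMeasure_of_tendsto_Lp h1
  obtain ⟨ns, hns, hae⟩ := h2.exists_seq_tendsto_ae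
  have h3 : ∀ k, coeffLp N (onb (Hilb N) k) (S (onb (Hilb N) k)) =ᵐ[phaseMeasure N]
      fun z => ⟪onb (Hilb N) k, weylOp z (S (onb (Hilb N) k))⟫_ℂ := fun k => coeFn_coeffLp _ _
  have h4 : ∀ n, (∑ k ∈ F n, coeffLp N (onb (Hilb N) k) (S (onb (Hilb N) k)) : Lp ℂ 2 _)
      =ᵐ[phaseMeasure N] fun z => ∑ k ∈ F n, coeffLp N (onb (Hilb N) k) (S (onb (Hilb N) k)) z :=
    fun n => by
      refine (Lp.coeFn_finsetSum _ _).trans (.of_forall fun z => ?_)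
      simp
  filter_upwards [hae, ae_all_iff.2 h3, ae_all_iff.2 h4] with z hz h3 h4
  refine tendsto_nhds_unique hz ?_
  have h5 : Tendsto (fun F : Finset (onbIndex (Hilb N)) =>
      ∑ k ∈ F, ⟪onb (Hilb N) k, weylOp z (S (onb (Hilb N) k))⟫_ℂ) atTop (𝓝 (weylFun S z)) :=
    (hS.summable_inner (weylOp z)).hasSum
  refine (h5.comp (hF.comp hns.tendsto_atTop)).congr fun n => ?_
  simp only [Function.comp_apply, h4, h3]

theorem IsTraceClass.memLp_weylFun {S : Hilb N →L[ℂ] Hilb N} (hS : IsTraceClass S) :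
    MemLp (weylFun S) 2 (phaseMeasure N) :=
  (memLp_congr_ae (coeFn_weylHS_of_isTraceClass hS)).1 (Lp.memLp _)

theorem weylLp_eq_weylHS {S : Hilb N →L[ℂ] Hilb N} (hS : IsTraceClass S) :
    weylLp S = weylHS S := by
  rw [weylLp, dif_pos hS.memLp_weylFun]
  refine Lp.ext (hS.memLp_weylFun.coeFn_toLp.trans (coeFn_weylHS_of_isTraceClass hS).symm)

/-- The finite rank operator `∑_{k ∈ F} |T eₖ⟩⟨eₖ|`. -/
def truncation (T : Hilb N →L[ℂ] Hilb N) (F : Finset (onbIndex (Hilb N))) :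
    Hilb N →L[ℂ] Hilb N :=
  ∑ k ∈ F, (innerSL ℂ (onb (Hilb N) k)).smulRight (T (onb (Hilb N) k))

theorem truncation_apply (T : Hilb N →L[ℂ] Hilb N) (F : Finset (onbIndex (Hilb N)))
    (v : Hilb N) : truncation T F v = ∑ k ∈ F, ⟪onb (Hilb N) k, v⟫_ℂ • T (onb (Hilb N) k) := by
  simp [truncation]

theorem inner_truncation (T : Hilb N →L[ℂ] Hilb N) (F : Finset (onbIndex (Hilb N)))
    (u v : Hilb N) : ⟪u, truncation T F v⟫_ℂ =
      ∑ k : F, ⟪u, T (onb (Hilb N) k)⟫_ℂ * ⟪onb (Hilb N) k, v⟫_ℂ := by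
  rw [truncation_apply, inner_sum, ← Finset.sum_coe_sort F
    (fun k => ⟪u, ⟪onb (Hilb N) k, v⟫_ℂ • T (onb (Hilb N) k)⟫_ℂ)]
  refine Finset.sum_congr rfl fun k _ => ?_
  rw [inner_smul_right, mul_comm]

theorem isTraceClass_truncation (T : Hilb N →L[ℂ] Hilb N) (F : Finset (onbIndex (Hilb N))) :
    IsTraceClass (truncation T F) := by
  let _ : MeasurableSpace F := ⊤
  have h : IsNuclear (Measure.count : Measure F) (fun k => T (onb (Hilb N) k))
      (fun k => onb (Hilb N) k) (truncation T F) :=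
    { measurable_left := .of_discrete
      measurable_right := .of_discrete
      integrable := .of_finite
      inner_eq := fun x y => by
        rw [inner_truncation, integral_count] }
  exact h.isTraceClass

theorem tendsto_hsNorm_truncation {T : Hilb N →L[ℂ] Hilb N} (hT : IsHilbertSchmidt T) :
    Tendsto (fun F => hsNorm (truncation T F - T)) atTop (𝓝 0) := by
  classical
  have h1 : ∀ (F : Finset (onbIndex (Hilb N))) k, (truncation T F - T) (onb (Hilb N) k) =
      if k ∈ F then 0 else -T (onb (Hilb N) k) := fun F k => by
    rw [sub_apply, truncation_apply]
    simp_rw [orthonormal_iff_ite.1 (onb (Hilb N)).orthonormal, ite_smul, one_smul, zero_smul]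
    rw [Finset.sum_ite_eq']
    split_ifs <;> simp
  have h2 := ENNReal.tendsto_tsum_compl_atTop_zero ((isHilbertSchmidt_iff_tsum_ne_top T).1 hT)
  have h3 : ∀ F : Finset (onbIndex (Hilb N)), hsNorm (truncation T F - T) =
      (∑' k : { k // k ∉ F }, ‖T (onb (Hilb N) k)‖ₑ ^ 2) ^ (1 / 2 : ℝ) := fun F => by
    have h5 : ∑' k : { k // k ∉ F }, ‖T (onb (Hilb N) k)‖ₑ ^ 2 =
        ∑' k, {k | k ∉ F}.indicator (fun k => ‖T (onb (Hilb N) k)‖ₑ ^ 2) k :=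
      tsum_subtype {k | k ∉ F} (fun k => ‖T (onb (Hilb N) k)‖ₑ ^ 2)
    rw [hsNorm, h5]
    congr 1
    refine tsum_congr fun k => ?_
    rw [h1, Set.indicator_apply]
    by_cases hk : k ∈ F <;> simp [hk]
  simp_rw [h3]
  have h4 := (ENNReal.continuous_rpow_const (y := 1 / 2)).tendsto 0 |>.comp h2
  rwa [ENNReal.zero_rpow_of_pos (by norm_num)] at h4

theorem neBot_traceClassNhds {T : Hilb N →L[ℂ] Hilb N} (hT : IsHilbertSchmidt T) :
    (traceClassNhds T).NeBot := by
  have h : Tendsto (truncation T) atTop (traceClassNhds T) :=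
    tendsto_inf.2 ⟨tendsto_comap_iff.2 (tendsto_hsNorm_truncation hT),
      tendsto_principal.2 (.of_forall fun F => isTraceClass_truncation T F)⟩
  exact h.neBot

theorem isWeylTransform_weylHS {T : Hilb N →L[ℂ] Hilb N} (hT : IsHilbertSchmidt T) :
    IsWeylTransform T (weylHS T) where
  neBot := neBot_traceClassNhds hT
  memLp := by
    have h : ∀ᶠ S in traceClassNhds T, IsTraceClass S :=
      eventually_inf_principal.2 (.of_forall fun _ h => h)
    exact h.mono fun S hS => hS.memLp_weylFun
  tendsto := by
    rw [tendsto_iff_edist_tendsto_0]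
    have h : Tendsto (fun S => hsNorm (S - T)) (traceClassNhds T) (𝓝 0) :=
      tendsto_comap.mono_left inf_le_left
    have h1 : ∀ᶠ S in traceClassNhds T, IsTraceClass S :=
      eventually_inf_principal.2 (.of_forall fun _ h => h)
    refine h.congr' (h1.mono fun S hS => ?_)
    beta_reduce
    rw [weylLp_eq_weylHS hS, edist_eq_enorm_sub, ← weylHS_sub hS.isHilbertSchmidt hT,
      enorm_weylHS (hS.isHilbertSchmidt.sub hT)]

theorem weylHS_injective {S T : Hilb N →L[ℂ] Hilb N} (hS : IsHilbertSchmidt S)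
    (hT : IsHilbertSchmidt T) (h : weylHS S = weylHS T) : S = T := by
  refine eq_of_hsNorm_sub_eq_zero ?_
  rw [← enorm_weylHS (hS.sub hT), weylHS_sub hS hT, h, sub_self, enorm_zero]

end HilbertSchmidtTransform

/-! ### Normal ordering of polynomials in position and momentum -/

section NormalOrdering

variable {N : ℕ}

/-- A subspace that contains 1 and is stable under left multiplication by the generators contains
the algebra. Thus normal ordering only has to be checked one letter at a time. -/
theorem adjoin_le_of_mul_mem {A : Type*} [Ring A] [Algebra ℂ A] {s : Set A} {M : Submodule ℂ A}
    (h1 : 1 ∈ M) (hs : ∀ a ∈ s, ∀ x ∈ M, a * x ∈ M) {x : A} (hx : x ∈ Algebra.adjoin ℂ s) :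
    x ∈ M := by
  suffices h : ∀ m ∈ M, x * m ∈ M by simpa using h 1 h1
  induction hx using Algebra.adjoin_induction with
  | mem a ha => exact hs a ha
  | algebraMap c =>
    intro m hm
    rw [← Algebra.smul_def]
    exact M.smul_mem c hm
  | add x y _ _ hx hy =>
    intro m hm
    rw [add_mul]
    exact M.add_mem (hx m hm) (hy m hm)
  | mul x y _ _ hx hy =>
    intro m hm
    rw [mul_assoc]
    exact hx _ (hy m hm)

theorem mul_prod_ofFn_pow {M : Type*} [Monoid M] {n : ℕ} (A : Fin n → M)
    (h : ∀ i j, Commute (A i) (A j)) (i : Fin n) (α : Fin n → ℕ) :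
    A i * (List.ofFn fun j => A j ^ α j).prod =
      (List.ofFn fun j => A j ^ (α j + (Pi.single i 1 : Fin n → ℕ) j)).prod := by
  induction n with
  | zero => exact i.elim0
  | succ n ih =>
    rw [List.ofFn_succ, List.ofFn_succ, List.prod_cons, List.prod_cons]
    refine Fin.cases ?_ (fun i => ?_) i
    · rw [← mul_assoc]
      congr 1
      · simp [pow_succ']
    · rw [← mul_assoc, ((h i.succ 0).pow_right _).eq, mul_assoc,
        ih (fun j => A j.succ) (fun i j => h _ _) i fun j => α j.succ]
      congr 1
      · simp [Pi.single_apply]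

theorem mul_multiPow {A : Fin N → 𝓢(Config N, ℂ) →L[ℂ] 𝓢(Config N, ℂ)}
    (h : ∀ i j, Commute (A i) (A j)) (i : Fin N) (α : Fin N → ℕ) :
    A i * multiPow A α = multiPow A (α + Pi.single i 1) :=
  mul_prod_ofFn_pow A h i α

theorem multiPow_zero (A : Fin N → 𝓢(Config N, ℂ) →L[ℂ] 𝓢(Config N, ℂ)) :
    multiPow A 0 = 1 := by
  simp [multiPow]

theorem multiPow_mem_adjoin (A : Fin N → 𝓢(Config N, ℂ) →L[ℂ] 𝓢(Config N, ℂ)) (α : Fin N → ℕ) :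
    multiPow A α ∈ Algebra.adjoin ℂ (Set.range A) := by
  refine list_prod_mem fun x hx => ?_
  obtain ⟨i, rfl⟩ := (List.mem_ofFn' _ _).1 hx
  exact pow_mem (Algebra.subset_adjoin (Set.mem_range_self i)) _

theorem commute_posOp (i j : Fin N) : Commute (posOp (N := N) i) (posOp j) := by
  refine ContinuousLinearMap.ext fun φ => SchwartzMap.ext fun y => ?_
  change posOp i (posOp j φ) y = posOp j (posOp i φ) y
  simp only [posOp_apply]
  ring

theorem commute_momOp (i j : Fin N) : Commute (momOp (N := N) i) (momOp j) := by
  refine ContinuousLinearMap.ext fun φ => SchwartzMap.ext fun y => ?_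
  change momOp i (momOp j φ) y = momOp j (momOp i φ) y
  have h : ∀ i j : Fin N, momOp i (momOp j φ) y = -Complex.I * (-Complex.I *
      fderiv ℝ (fderiv ℝ φ) y (EuclideanSpace.single i 1) (EuclideanSpace.single j 1)) := by
    intro i j
    have hd : HasFDerivAt (fderiv ℝ φ) (fderiv ℝ (fderiv ℝ φ) y) y :=
      (((φ.smooth 2).fderiv_right (m := 1) (by norm_num)).differentiable one_ne_zero y).hasFDerivAt
    have h1 : HasFDerivAt (momOp j φ) ((-Complex.I) • ((ContinuousLinearMap.apply ℝ ℂ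
        (EuclideanSpace.single j (1 : ℝ))) ∘L fderiv ℝ (fderiv ℝ φ) y)) y := by
      have h2 : (momOp j φ : Config N → ℂ) = fun y => -Complex.I *
          (ContinuousLinearMap.apply ℝ ℂ (EuclideanSpace.single j (1 : ℝ))) (fderiv ℝ φ y) :=
        funext (momOp_apply_fderiv j φ)
      rw [h2]
      exact (((ContinuousLinearMap.apply ℝ ℂ
        (EuclideanSpace.single j (1 : ℝ))).hasFDerivAt).comp y hd).const_mul _
    rw [momOp_apply_fderiv, h1.fderiv]
    rfl
  rw [h, h]
  congr 2
  exact ((φ.smooth 2).contDiffAt.isSymmSndFDerivAt (by simp)).eq _ _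

theorem posOp_mul_momOp (i j : Fin N) : posOp (N := N) i * momOp j - momOp j * posOp i =
    (if i = j then Complex.I else 0) • 1 := by
  refine ContinuousLinearMap.ext fun φ => SchwartzMap.ext fun y => ?_
  change posOp i (momOp j φ) y - momOp j (posOp i φ) y = (if i = j then Complex.I else 0) * φ y
  have h1 : HasFDerivAt (posOp i φ) (((y i : ℝ) : ℂ) • fderiv ℝ φ y + φ y •
      (Complex.ofRealCLM ∘L (EuclideanSpace.proj i : Config N →L[ℝ] ℝ))) y := by
    have h2 : (posOp i φ : Config N → ℂ) = fun y => ((y i : ℝ) : ℂ) * φ y :=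
      funext (posOp_apply i φ)
    rw [h2]
    exact ((Complex.ofRealCLM ∘L (EuclideanSpace.proj i : Config N →L[ℝ] ℝ)).hasFDerivAt).mul
      (φ.hasFDerivAt y)
  rw [posOp_apply, momOp_apply_fderiv, momOp_apply_fderiv, h1.fderiv]
  by_cases h : i = j
  · simp [h]; ring
  · simp [h]; ring

/-- The algebra of polynomials in the position and momentum operators. -/
def weylAlg (N : ℕ) : Subalgebra ℂ (𝓢(Config N, ℂ) →L[ℂ] 𝓢(Config N, ℂ)) :=
  Algebra.adjoin ℂ (Set.range posOp ∪ Set.range momOp)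

theorem posOp_mem_weylAlg (i : Fin N) : posOp i ∈ weylAlg N :=
  Algebra.subset_adjoin (Or.inl ⟨i, rfl⟩)

theorem momOp_mem_weylAlg (i : Fin N) : momOp i ∈ weylAlg N :=
  Algebra.subset_adjoin (Or.inr ⟨i, rfl⟩)

theorem fieldOp_mem_weylAlg (v : Phase N) : fieldOp v ∈ weylAlg N :=
  sub_mem (sum_mem fun i _ => Subalgebra.smul_mem _ (posOp_mem_weylAlg i) _)
    (sum_mem fun i _ => Subalgebra.smul_mem _ (momOp_mem_weylAlg i) _)

theorem monomial_mem_weylAlg (β α : Fin N → ℕ) :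
    multiPow momOp β * multiPow posOp α ∈ weylAlg N :=
  mul_mem (Algebra.adjoin_mono Set.subset_union_right (multiPow_mem_adjoin momOp β))
    (Algebra.adjoin_mono Set.subset_union_left (multiPow_mem_adjoin posOp α))

theorem adjoin_momOp_le_span {x : 𝓢(Config N, ℂ) →L[ℂ] 𝓢(Config N, ℂ)}
    (hx : x ∈ Algebra.adjoin ℂ (Set.range (momOp (N := N)))) :
    x ∈ Submodule.span ℂ (Set.range (multiPow (momOp (N := N)))) := by
  refine adjoin_le_of_mul_mem (Submodule.subset_span (Set.mem_range.2 ⟨0, multiPow_zero _⟩)) ?_ hx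
  rintro _ ⟨i, rfl⟩ x hx
  induction hx using Submodule.span_induction with
  | mem x hx =>
    obtain ⟨β, rfl⟩ := hx
    rw [mul_multiPow commute_momOp]
    exact Submodule.subset_span ⟨_, rfl⟩
  | zero => simp
  | add x y _ _ hx hy => rw [mul_add]; exact add_mem hx hy
  | smul c x _ hx => rw [mul_smul_comm]; exact Submodule.smul_mem _ _ hx

/-- The commutator with Q_i is a derivation and is scalar on each P_j, so it preserves the
polynomials in `P`. -/
theorem posOp_commutator_mem (i : Fin N) {x : 𝓢(Config N, ℂ) →L[ℂ] 𝓢(Config N, ℂ)}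
    (hx : x ∈ Algebra.adjoin ℂ (Set.range (momOp (N := N)))) :
    posOp i * x - x * posOp i ∈ Algebra.adjoin ℂ (Set.range (momOp (N := N))) := by
  induction hx using Algebra.adjoin_induction with
  | mem x hx =>
    obtain ⟨j, rfl⟩ := hx
    rw [posOp_mul_momOp]
    exact Subalgebra.smul_mem _ (one_mem _) _
  | algebraMap c => rw [Algebra.commutes, sub_self]; exact zero_mem _
  | add x y _ _ hx hy =>
    have h : posOp i * (x + y) - (x + y) * posOp i =
      (posOp i * x - x * posOp i) + (posOp i * y - y * posOp i) := by noncomm_ring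
    rw [h]
    exact add_mem hx hy
  | mul x y hx' hy' hx hy =>
    have h : posOp i * (x * y) - (x * y) * posOp i =
      (posOp i * x - x * posOp i) * y + x * (posOp i * y - y * posOp i) := by noncomm_ring
    rw [h]
    exact add_mem (mul_mem hx hy') (mul_mem hx' hy)

/-- Every polynomial in `Q` and `P` is a linear combination of the `P^β Q^α`. -/
theorem weylAlg_le_span {x : 𝓢(Config N, ℂ) →L[ℂ] 𝓢(Config N, ℂ)} (hx : x ∈ weylAlg N) :
    x ∈ Submodule.span ℂ (Set.range fun k : (Fin N → ℕ) × (Fin N → ℕ) =>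
      multiPow (momOp (N := N)) k.1 * multiPow posOp k.2) := by
  refine adjoin_le_of_mul_mem (Submodule.subset_span
    (Set.mem_range.2 ⟨(0, 0), by simp [multiPow_zero]⟩)) ?_ hx
  intro a ha x hx
  induction hx using Submodule.span_induction with
  | zero => simp
  | add x y _ _ hx hy => rw [mul_add]; exact add_mem hx hy
  | smul c x _ hx => rw [mul_smul_comm]; exact Submodule.smul_mem _ _ hx
  | mem x hx =>
    obtain ⟨⟨β, α⟩, rfl⟩ := hx
    dsimp only
    rcases ha with ⟨i, rfl⟩ | ⟨i, rfl⟩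
    -- Q_i is pulled through P^β; the commutator is a polynomial in `P` alone, so every resulting
    -- term is already ordered.
    · have h : posOp i * (multiPow momOp β * multiPow posOp α) =
          multiPow momOp β * (posOp i * multiPow posOp α) +
          (posOp i * multiPow momOp β - multiPow momOp β * posOp i) * multiPow posOp α := by
        noncomm_ring
      rw [h, mul_multiPow commute_posOp]
      refine add_mem (Submodule.subset_span ⟨(β, α + Pi.single i 1), rfl⟩) ?_
      have h2 := adjoin_momOp_le_span (posOp_commutator_mem i (multiPow_mem_adjoin momOp β))
      generalize posOp i * multiPow momOp β - multiPow momOp β * posOp i = c at h2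
      induction h2 using Submodule.span_induction with
      | mem x hx =>
        obtain ⟨γ, rfl⟩ := hx
        exact Submodule.subset_span ⟨(γ, α), rfl⟩
      | zero => simp
      | add x y _ _ hx hy => rw [add_mul]; exact add_mem hx hy
      | smul c x _ hx => rw [smul_mul_assoc]; exact Submodule.smul_mem _ _ hx
    · rw [← mul_assoc, mul_multiPow commute_momOp]
      exact Submodule.subset_span ⟨(β + Pi.single i 1, α), rfl⟩

end NormalOrdering

/-! ### Operations on Schwartz operators -/

section SchwartzOperators

variable {N : ℕ}

theorem norm_le_of_inner_toHilb_le {x : Hilb N} {C : ℝ} (hC : 0 ≤ C)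
    (h : ∀ ψ, ‖⟪toHilb N ψ, x⟫_ℂ‖ ≤ C * ‖toHilb N ψ‖) : ‖x‖ ≤ C := by
  have h1 : ∀ u : Hilb N, ‖⟪u, x⟫_ℂ‖ ≤ C * ‖u‖ := fun u =>
    (denseRange_toHilb N).induction_on (p := fun u => ‖⟪u, x⟫_ℂ‖ ≤ C * ‖u‖) u
      (isClosed_le (by fun_prop) (by fun_prop)) h
  have h2 := h1 x
  rw [inner_self_eq_norm_sq_to_K] at h2
  have h3 : ‖x‖ * ‖x‖ ≤ C * ‖x‖ := by
    simpa [sq] using h2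
  rcases (norm_nonneg x).eq_or_lt with h0 | h0
  · rwa [← h0]
  · exact le_of_mul_le_mul_right h3 h0

theorem ext_inner_toHilb {S T : Hilb N →L[ℂ] Hilb N}
    (h : ∀ ψ φ, ⟪toHilb N ψ, S (toHilb N φ)⟫_ℂ = ⟪toHilb N ψ, T (toHilb N φ)⟫_ℂ) : S = T := by
  refine ext_toHilb fun φ => ?_
  refine ext_inner_left ℂ fun u => ?_
  exact (denseRange_toHilb N).induction_on (p := fun u => ⟪u, S (toHilb N φ)⟫_ℂ =
    ⟪u, T (toHilb N φ)⟫_ℂ) u (isClosed_eq (by fun_prop) (by fun_prop)) fun ψ => h ψ φ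

instance isTopologicalAddGroup_schwartzOperator : IsTopologicalAddGroup (SchwartzOperator N) :=
  (schwartzOperator_withSeminorms N).topologicalAddGroup

namespace SchwartzOperator

theorem toCLM_add (S T : SchwartzOperator N) : (S + T).toCLM = S.toCLM + T.toCLM := rfl

theorem toCLM_smul (c : ℂ) (T : SchwartzOperator N) : (c • T).toCLM = c • T.toCLM := rfl

theorem toCLM_injective {S T : SchwartzOperator N} (h : S.toCLM = T.toCLM) : S = T :=
  Subtype.ext h

end SchwartzOperator

theorem toHilb_injective : Function.Injective (toHilb N) :=
  SchwartzMap.injective_toLp 2 volume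

/-- Normalizing both functions turns the supremum over unit balls into a homogeneous bound.
Injectivity of the embedding into L² ensures that only the zero function has norm zero. -/
theorem norm_inner_momPos_le (k : Idx N) (T : SchwartzOperator N) (ψ φ : 𝓢(Config N, ℂ)) :
    ‖⟪momPos k.2.2.1 k.1 ψ, T.toCLM (momPos k.2.2.2 k.2.1 φ)⟫_ℂ‖ ≤
      SchwartzOperator.seminorm k T * (‖toHilb N ψ‖ * ‖toHilb N φ‖) := by
  have hlin : ∀ β α (c : ℂ) (ψ : 𝓢(Config N, ℂ)), momPos β α (c • ψ) = c • momPos β α ψ :=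
    fun β α c ψ => by
      change toHilb N _ = c • toHilb N _
      rw [map_smul, map_smul, map_smul]
  have hzero : ∀ β α, momPos (N := N) β α 0 = 0 := fun β α => by
    change toHilb N _ = 0
    rw [map_zero, map_zero, map_zero]
  by_cases hψ : ψ = 0
  · simp [hψ, hzero]
  by_cases hφ : φ = 0
  · simp [hφ, hzero]
  have hψ' : 0 < ‖toHilb N ψ‖ := norm_pos_iff.2 ((map_ne_zero_iff _ toHilb_injective).2 hψ)
  have hφ' : 0 < ‖toHilb N φ‖ := norm_pos_iff.2 ((map_ne_zero_iff _ toHilb_injective).2 hφ)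
  have h1 : ∀ χ : 𝓢(Config N, ℂ), 0 < ‖toHilb N χ‖ →
      ‖(((‖toHilb N χ‖⁻¹ : ℝ) : ℂ) • χ).toLp 2 volume‖ ≤ 1 := fun χ hχ => by
    rw [← toHilb_apply, map_smul, norm_smul, Complex.norm_real, norm_inv, norm_norm,
      inv_mul_cancel₀ hχ.ne']
  have h2 : ‖toHilb N ψ‖⁻¹ * (‖toHilb N φ‖⁻¹ *
      ‖⟪momPos k.2.2.1 k.1 ψ, T.toCLM (momPos k.2.2.2 k.2.1 φ)⟫_ℂ‖) ≤
        SchwartzOperator.seminorm k T := by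
    refine le_csSup (T.isSchwartz k) ⟨_, _, h1 ψ hψ', h1 φ hφ', ?_⟩
    rw [hlin, hlin, map_smul, inner_smul_left, inner_smul_right, norm_mul, norm_mul,
      RCLike.norm_conj, Complex.norm_real, Complex.norm_real, norm_inv, norm_inv, norm_norm,
      norm_norm]
  rw [← mul_assoc, ← mul_inv, inv_mul_le_iff₀ (by positivity)] at h2
  linarith

/-- The form `⟨A ψ, T B φ⟩` is bounded, locally uniformly in the Schwartz operator `T`. -/
def FormBounded (A B : 𝓢(Config N, ℂ) →L[ℂ] 𝓢(Config N, ℂ)) : Prop :=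
  ∃ p : Seminorm ℂ (SchwartzOperator N), Continuous p ∧ ∀ (T : SchwartzOperator N) ψ φ,
    ‖⟪toHilb N (A ψ), T.toCLM (toHilb N (B φ))⟫_ℂ‖ ≤ p T * (‖toHilb N ψ‖ * ‖toHilb N φ‖)

/-- Monomials P^β Q^α are covered by the defining seminorms, and normal ordering reduces the whole
algebra to their linear combinations, on either side. -/
theorem formBounded_weylAlg {A B : 𝓢(Config N, ℂ) →L[ℂ] 𝓢(Config N, ℂ)}
    (hA : A ∈ weylAlg N) (hB : B ∈ weylAlg N) : FormBounded A B := by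
  replace hA := weylAlg_le_span hA
  replace hB := weylAlg_le_span hB
  induction hA using Submodule.span_induction with
  | zero => exact ⟨0, continuous_const, fun T ψ φ => by simp⟩
  | add A A' _ _ hA hA' =>
    obtain ⟨p, hp, h⟩ := hA
    obtain ⟨p', hp', h'⟩ := hA'
    refine ⟨p + p', hp.add hp', fun T ψ φ => ?_⟩
    rw [add_apply, map_add, inner_add_left, add_apply, add_mul]
    exact (norm_add_le _ _).trans (add_le_add (h T ψ φ) (h' T ψ φ))
  | smul c A _ hA =>
    obtain ⟨p, hp, h⟩ := hA
    refine ⟨‖c‖₊ • p, hp.const_smul ‖c‖₊, fun T ψ φ => ?_⟩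
    rw [smul_apply, map_smul, inner_smul_left, norm_mul, RCLike.norm_conj, smul_apply,
      NNReal.smul_def, smul_eq_mul, coe_nnnorm, mul_assoc]
    gcongr
    exact h T ψ φ
  | mem A hA =>
    obtain ⟨⟨β, α⟩, rfl⟩ := hA
    induction hB using Submodule.span_induction with
    | zero => exact ⟨0, continuous_const, fun T ψ φ => by simp⟩
    | add A A' _ _ hA hA' =>
      obtain ⟨p, hp, h⟩ := hA
      obtain ⟨p', hp', h'⟩ := hA'
      refine ⟨p + p', hp.add hp', fun T ψ φ => ?_⟩
      rw [add_apply, map_add, map_add, inner_add_right, add_apply, add_mul]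
      exact (norm_add_le _ _).trans (add_le_add (h T ψ φ) (h' T ψ φ))
    | smul c A _ hA =>
      obtain ⟨p, hp, h⟩ := hA
      refine ⟨‖c‖₊ • p, hp.const_smul ‖c‖₊, fun T ψ φ => ?_⟩
      rw [smul_apply, map_smul, map_smul, inner_smul_right, norm_mul, smul_apply,
        NNReal.smul_def, smul_eq_mul, coe_nnnorm, mul_assoc]
      gcongr
      exact h T ψ φ
    | mem B hB =>
      obtain ⟨⟨β', α'⟩, rfl⟩ := hB
      exact ⟨_, (schwartzOperator_withSeminorms N).continuous_seminorm (α, α', β, β'),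
        norm_inner_momPos_le (α, α', β, β')⟩

/-- For `B` in the Weyl algebra and a Schwartz operator `T`, the operator `T B` is bounded. -/
theorem exists_norm_apply_le {B : 𝓢(Config N, ℂ) →L[ℂ] 𝓢(Config N, ℂ)} (hB : B ∈ weylAlg N) :
    ∃ p : Seminorm ℂ (SchwartzOperator N), Continuous p ∧ ∀ (T : SchwartzOperator N) φ,
      ‖T.toCLM (toHilb N (B φ))‖ ≤ p T * ‖toHilb N φ‖ := by
  obtain ⟨p, hp, h⟩ := formBounded_weylAlg (one_mem (weylAlg N)) hB
  refine ⟨p, hp, fun T φ => norm_le_of_inner_toHilb_le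
    (mul_nonneg (apply_nonneg p T) (norm_nonneg _)) fun ψ => (h T ψ φ).trans_eq ?_⟩
  ring

/-- The bounded extension of `T B`. -/
def extendRight (T : Hilb N →L[ℂ] Hilb N) (B : 𝓢(Config N, ℂ) →L[ℂ] 𝓢(Config N, ℂ)) :
    Hilb N →L[ℂ] Hilb N :=
  LinearMap.extendOfNorm (T ∘L toHilb N ∘L B).toLinearMap (toHilb N).toLinearMap

theorem extendRight_toHilb (T : SchwartzOperator N) {B : 𝓢(Config N, ℂ) →L[ℂ] 𝓢(Config N, ℂ)}
    (hB : B ∈ weylAlg N) (φ : 𝓢(Config N, ℂ)) :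
    extendRight T.toCLM B (toHilb N φ) = T.toCLM (toHilb N (B φ)) := by
  obtain ⟨p, -, h⟩ := exists_norm_apply_le hB
  exact LinearMap.extendOfNorm_eq (e := (toHilb N).toLinearMap)
    (f := (T.toCLM ∘L toHilb N ∘L B).toLinearMap) (denseRange_toHilb N) ⟨p T, h T⟩ φ

theorem isSchwartzOperator_of_forall {S : Hilb N →L[ℂ] Hilb N}
    (h : ∀ A ∈ weylAlg N, ∀ B ∈ weylAlg N, ∃ C : ℝ, ∀ ψ φ : 𝓢(Config N, ℂ),
      ‖⟪toHilb N (A ψ), S (toHilb N (B φ))⟫_ℂ‖ ≤ C * (‖toHilb N ψ‖ * ‖toHilb N φ‖)) :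
    IsSchwartzOperator S := by
  intro k
  obtain ⟨C, hC⟩ := h _ (monomial_mem_weylAlg k.2.2.1 k.1) _ (monomial_mem_weylAlg k.2.2.2 k.2.1)
  -- `C` is not assumed nonnegative, and the norms are replaced by 1.
  refine ⟨|C|, ?_⟩
  rintro r ⟨ψ, φ, hψ, hφ, rfl⟩
  refine (hC ψ φ).trans ?_
  calc C * (‖toHilb N ψ‖ * ‖toHilb N φ‖) ≤ |C| * (1 * 1) := by
        gcongr
        · exact le_abs_self C
        · exact hψ
        · exact hφ
    _ = |C| := by ring

theorem continuous_of_formValues {E : Type*} [AddCommGroup E] [Module ℂ E] [TopologicalSpace E]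
    [IsTopologicalAddGroup E] (Λ : E →ₗ[ℂ] SchwartzOperator N)
    (h : ∀ A ∈ weylAlg N, ∀ B ∈ weylAlg N, ∃ p : Seminorm ℂ E, Continuous p ∧
      ∀ T (ψ φ : 𝓢(Config N, ℂ)),
        ‖⟪toHilb N (A ψ), (Λ T).toCLM (toHilb N (B φ))⟫_ℂ‖ ≤ p T * (‖toHilb N ψ‖ * ‖toHilb N φ‖)) :
    Continuous Λ := by
  refine WithSeminorms.continuous_of_continuous_comp (schwartzOperator_withSeminorms N) Λ fun k => ?_
  obtain ⟨p, hp, h⟩ := h _ (monomial_mem_weylAlg k.2.2.1 k.1) _ (monomial_mem_weylAlg k.2.2.2 k.2.1)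
  refine Seminorm.continuous_of_le hp fun T => ?_
  refine csSup_le ⟨0, zero_mem_formValues k _⟩ ?_
  rintro r ⟨ψ, φ, hψ, hφ, rfl⟩
  refine (h T ψ φ).trans ?_
  calc p T * (‖toHilb N ψ‖ * ‖toHilb N φ‖) ≤ p T * (1 * 1) := by
        gcongr
        · exact hψ
        · exact hφ
    _ = p T := by ring

namespace SchwartzOperator

/-- The adjoint of a Schwartz operator. -/
def adj (T : SchwartzOperator N) : SchwartzOperator N :=
  (⟨T.toCLM.adjoint, isSchwartzOperator_of_forall fun A hA B hB => by
    obtain ⟨p, -, h⟩ := formBounded_weylAlg hB hA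
    refine ⟨p T, fun ψ φ => ?_⟩
    rw [ContinuousLinearMap.adjoint_inner_right, ← norm_inner_symm]
    refine (h T φ ψ).trans_eq (by ring)⟩ : schwartzSubmodule N)

theorem toCLM_adj (T : SchwartzOperator N) : T.adj.toCLM = T.toCLM.adjoint := rfl

/-- The Schwartz operator `T G`, for a field operator `G = b · Q - a · P`. -/
def mulFieldFun (v : Phase N) (T : SchwartzOperator N) : SchwartzOperator N :=
  (⟨extendRight T.toCLM (fieldOp v), isSchwartzOperator_of_forall fun A hA B hB => by
    obtain ⟨p, -, h⟩ := formBounded_weylAlg hA (mul_mem (fieldOp_mem_weylAlg v) hB)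
    refine ⟨p T, fun ψ φ => ?_⟩
    rw [extendRight_toHilb T (fieldOp_mem_weylAlg v)]
    exact h T ψ φ⟩ : schwartzSubmodule N)

theorem mulFieldFun_toHilb (v : Phase N) (T : SchwartzOperator N) (φ : 𝓢(Config N, ℂ)) :
    (mulFieldFun v T).toCLM (toHilb N φ) = T.toCLM (toHilb N (fieldOp v φ)) :=
  extendRight_toHilb T (fieldOp_mem_weylAlg v) φ

/-- The Schwartz operator `G T`, for a field operator `G = b · Q - a · P`. -/
def fieldMulFun (v : Phase N) (T : SchwartzOperator N) : SchwartzOperator N :=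
  (mulFieldFun v T.adj).adj

theorem inner_fieldMulFun (v : Phase N) (T : SchwartzOperator N) (ψ : 𝓢(Config N, ℂ))
    (u : Hilb N) :
    ⟪toHilb N ψ, (fieldMulFun v T).toCLM u⟫_ℂ = ⟪toHilb N (fieldOp v ψ), T.toCLM u⟫_ℂ := by
  rw [fieldMulFun, toCLM_adj, ContinuousLinearMap.adjoint_inner_right, mulFieldFun_toHilb,
    toCLM_adj, ContinuousLinearMap.adjoint_inner_left]

/-- The continuous linear map `T ↦ T G` on Schwartz operators. -/
def mulField (v : Phase N) : SchwartzOperator N →L[ℂ] SchwartzOperator N where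
  toFun := mulFieldFun v
  map_add' S T := toCLM_injective <| ext_toHilb fun φ => by
    simp only [toCLM_add, add_apply, mulFieldFun_toHilb]
  map_smul' c T := toCLM_injective <| ext_toHilb fun φ => by
    simp only [toCLM_smul, smul_apply, mulFieldFun_toHilb, RingHom.id_apply]
  cont := continuous_of_formValues
    { toFun := mulFieldFun v
      map_add' := fun S T => toCLM_injective <| ext_toHilb fun φ => by
        simp only [toCLM_add, add_apply, mulFieldFun_toHilb]
      map_smul' := fun c T => toCLM_injective <| ext_toHilb fun φ => by
        simp only [toCLM_smul, smul_apply, mulFieldFun_toHilb, RingHom.id_apply] }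
    fun A hA B hB => by
      obtain ⟨p, hp, h⟩ := formBounded_weylAlg hA (mul_mem (fieldOp_mem_weylAlg v) hB)
      refine ⟨p, hp, fun T ψ φ => ?_⟩
      rw [LinearMap.coe_mk, AddHom.coe_mk, mulFieldFun_toHilb]
      exact h T ψ φ

theorem mulField_toHilb (v : Phase N) (T : SchwartzOperator N) (φ : 𝓢(Config N, ℂ)) :
    (mulField v T).toCLM (toHilb N φ) = T.toCLM (toHilb N (fieldOp v φ)) :=
  mulFieldFun_toHilb v T φ

/-- The continuous linear map `T ↦ G T` on Schwartz operators. -/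
def fieldMul (v : Phase N) : SchwartzOperator N →L[ℂ] SchwartzOperator N where
  toFun := fieldMulFun v
  map_add' S T := toCLM_injective <| ext_inner_toHilb fun ψ φ => by
    simp only [toCLM_add, add_apply, inner_fieldMulFun, inner_add_right]
  map_smul' c T := toCLM_injective <| ext_inner_toHilb fun ψ φ => by
    simp only [toCLM_smul, smul_apply, inner_fieldMulFun, inner_smul_right, RingHom.id_apply]
  cont := continuous_of_formValues
    { toFun := fieldMulFun v
      map_add' := fun S T => toCLM_injective <| ext_inner_toHilb fun ψ φ => by
        simp only [toCLM_add, add_apply, inner_fieldMulFun, inner_add_right]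
      map_smul' := fun c T => toCLM_injective <| ext_inner_toHilb fun ψ φ => by
        simp only [toCLM_smul, smul_apply, inner_fieldMulFun, inner_smul_right,
          RingHom.id_apply] }
    fun A hA B hB => by
      obtain ⟨p, hp, h⟩ := formBounded_weylAlg (mul_mem (fieldOp_mem_weylAlg v) hA) hB
      refine ⟨p, hp, fun T ψ φ => ?_⟩
      rw [LinearMap.coe_mk, AddHom.coe_mk, inner_fieldMulFun]
      exact h T ψ φ

end SchwartzOperator

end SchwartzOperators

/-! ### Functions bounded by continuous seminorms -/

section SeminormBounded

variable {E E' ι : Type*} [AddCommGroup E] [Module ℂ E] [TopologicalSpace E]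
  [AddCommGroup E'] [Module ℂ E'] [TopologicalSpace E']

/-- The functions `f · i` are bounded, uniformly in `i`, by a continuous seminorm. -/
def SeminormBounded (f : E → ι → ℝ) : Prop :=
  ∃ p : Seminorm ℂ E, Continuous p ∧ ∀ x i, f x i ≤ p x

namespace SeminormBounded

variable {f g : E → ι → ℝ}

theorem mono (hg : SeminormBounded g) (h : ∀ x i, f x i ≤ g x i) : SeminormBounded f := by
  obtain ⟨p, hp, hg⟩ := hg
  exact ⟨p, hp, fun x i => (h x i).trans (hg x i)⟩

theorem zero : SeminormBounded fun (_ : E) (_ : ι) => (0 : ℝ) :=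
  ⟨0, continuous_const, fun _ _ => le_rfl⟩

theorem add (hf : SeminormBounded f) (hg : SeminormBounded g) :
    SeminormBounded fun x i => f x i + g x i := by
  obtain ⟨p, hp, hf⟩ := hf
  obtain ⟨q, hq, hg⟩ := hg
  exact ⟨p + q, hp.add hq, fun x i => add_le_add (hf x i) (hg x i)⟩

theorem const_mul (hf : SeminormBounded f) {c : ℝ} (hc : 0 ≤ c) :
    SeminormBounded fun x i => c * f x i := by
  obtain ⟨p, hp, hf⟩ := hf
  exact ⟨c.toNNReal • p, hp.const_smul c.toNNReal, fun x i => by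
    rw [smul_apply, NNReal.smul_def, smul_eq_mul, Real.coe_toNNReal _ hc]
    exact mul_le_mul_of_nonneg_left (hf x i) hc⟩

theorem sum {J : Type*} (s : Finset J) {f : J → E → ι → ℝ} (hf : ∀ j, SeminormBounded (f j)) :
    SeminormBounded fun x i => ∑ j ∈ s, f j x i := by
  classical
  induction s using Finset.induction_on with
  | empty => simpa using zero
  | insert j s hj ih => simpa only [Finset.sum_insert hj] using (hf j).add ih

theorem comp (hf : SeminormBounded f) (Λ : E' →L[ℂ] E) : SeminormBounded fun x => f (Λ x) := by
  obtain ⟨p, hp, hf⟩ := hf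
  exact ⟨p.comp Λ.toLinearMap, hp.comp Λ.continuous, fun x i => hf (Λ x) i⟩

end SeminormBounded

end SeminormBounded

/-! ### Coherent states -/

section CoherentStates

variable {N : ℕ}

/-- A normalized bump function is enough: of the fiducial vector only smoothness, decay and unit
norm are used, so no Gaussian is needed. -/
theorem exists_norm_toHilb_eq_one (N : ℕ) : ∃ g : 𝓢(Config N, ℂ), ‖toHilb N g‖ = 1 := by
  let f : ContDiffBump (0 : Config N) := ⟨1, 2, one_pos, one_lt_two⟩
  have hs : HasCompactSupport fun y => (f y : ℂ) :=
    f.hasCompactSupport.comp_left Complex.ofReal_zero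
  let g : 𝓢(Config N, ℂ) := hs.toSchwartzMap (Complex.ofRealCLM.contDiff.comp f.contDiff)
  have hg : g ≠ 0 := fun h => by
    have h1 : g 0 = 1 := by
      change (f 0 : ℂ) = 1
      rw [f.one_of_mem_closedBall (Metric.mem_closedBall_self f.rIn_pos.le)]
      simp
    rw [h] at h1
    simp at h1
  have hg' : 0 < ‖toHilb N g‖ := norm_pos_iff.2 ((map_ne_zero_iff _ toHilb_injective).2 hg)
  refine ⟨((‖toHilb N g‖⁻¹ : ℝ) : ℂ) • g, ?_⟩
  rw [map_smul, norm_smul, Complex.norm_real, norm_inv, norm_norm, inv_mul_cancel₀ hg'.ne']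

/-- A Schwartz function of norm one. -/
def vac (N : ℕ) : 𝓢(Config N, ℂ) := (exists_norm_toHilb_eq_one N).choose

theorem norm_vac : ‖toHilb N (vac N)‖ = 1 := (exists_norm_toHilb_eq_one N).choose_spec

/-- The coherent state `W(x) g`. -/
def coh (x : Phase N) : 𝓢(Config N, ℂ) := weylS x (vac N)

theorem toHilb_coh (x : Phase N) : toHilb N (coh x) = weylOp x (toHilb N (vac N)) :=
  (weylOp_toHilb _ _).symm

theorem norm_coh (x : Phase N) : ‖toHilb N (coh x)‖ = 1 := by
  rw [toHilb_coh, norm_weylOp_apply, norm_vac]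

theorem continuous_coh : Continuous fun x : Phase N => toHilb N (coh x) := by
  simp_rw [toHilb_coh]
  exact continuous_weylOp _

theorem integral_inner_coh (u v : Hilb N) :
    ∫ x, ⟪u, toHilb N (coh x)⟫_ℂ * ⟪toHilb N (coh x), v⟫_ℂ ∂(phaseMeasure N) = ⟪u, v⟫_ℂ := by
  simp_rw [toHilb_coh]
  rw [integral_inner_weylOp_mul_inner, inner_self_eq_norm_sq_to_K, norm_vac]
  simp

/-- Unit vectors of phase space, on which the symplectic form detects all coordinates. -/
def phaseVec (N : ℕ) : Fin N ⊕ Fin N → Phase N :=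
  Sum.elim (fun i => (0, EuclideanSpace.single i 1)) fun i => (EuclideanSpace.single i 1, 0)

theorem norm_le_sum_abs_symp (x : Phase N) : ‖x‖ ≤ ∑ j, |symp (phaseVec N j) x| := by
  have h1 : ∀ y : Config N, ‖y‖ ≤ ∑ i, |y i| := fun y => by
    conv_lhs => rw [← (EuclideanSpace.basisFun (Fin N) ℝ).sum_repr y]
    refine (norm_sum_le _ _).trans (Finset.sum_le_sum fun i _ => ?_)
    simp [norm_smul]
  have h2 : ∑ j, |symp (phaseVec N j) x| = ∑ i, |x.1 i| + ∑ i, |x.2 i| := by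
    rw [Fintype.sum_sum_type]
    simp [symp, phaseVec, EuclideanSpace.inner_single_left]
  rw [h2, Prod.norm_def]
  have h3 : 0 ≤ ∑ i, |x.1 i| := Finset.sum_nonneg fun _ _ => abs_nonneg _
  have h4 : 0 ≤ ∑ i, |x.2 i| := Finset.sum_nonneg fun _ _ => abs_nonneg _
  exact max_le ((h1 x.1).trans (by linarith)) ((h1 x.2).trans (by linarith))

theorem norm_pow_le_sum_abs_symp (x : Phase N) (n : ℕ) :
    ‖x‖ ^ (n + 1) ≤ (Fintype.card (Fin N ⊕ Fin N) : ℝ) ^ n *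
      ∑ j, |symp (phaseVec N j) x| ^ (n + 1) := by
  refine (pow_le_pow_left₀ (norm_nonneg _) (norm_le_sum_abs_symp x) _).trans ?_
  exact pow_sum_le_card_mul_sum_pow (fun _ _ => abs_nonneg _) n

/-- Polynomial weights can be checked on the powers of the coordinates. -/
theorem SeminormBounded.norm_pow_mul {E : Type*} [AddCommGroup E] [Module ℂ E]
    [TopologicalSpace E] {f : E → Phase N → ℝ} (h0 : ∀ T x, 0 ≤ f T x)
    (h : ∀ v n, SeminormBounded fun T x => |symp v x| ^ n * f T x) (n : ℕ) :
    SeminormBounded fun T x => ‖x‖ ^ n * f T x := by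
  cases n with
  | zero => simpa using h 0 0
  | succ n =>
    refine (((SeminormBounded.sum Finset.univ fun j => h (phaseVec N j) (n + 1)).const_mul
      (c := (Fintype.card (Fin N ⊕ Fin N) : ℝ) ^ n) (by positivity))).mono fun T x => ?_
    rw [← Finset.sum_mul, ← mul_assoc]
    exact mul_le_mul_of_nonneg_right (norm_pow_le_sum_abs_symp x n) (h0 T x)

/-- Each factor σ(v, x) is exchanged, by the intertwining relation, for a field operator to the left
of W(x) or on `g`. The induction therefore quantifies over all `B` and `g`. -/
theorem seminormBounded_symp_pow_mul_norm_weylS (v : Phase N) (n : ℕ) :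
    ∀ B ∈ weylAlg N, ∀ g : 𝓢(Config N, ℂ), SeminormBounded fun (T : SchwartzOperator N) x =>
      |symp v x| ^ n * ‖T.toCLM (toHilb N (B (weylS x g)))‖ := by
  induction n with
  | zero =>
    intro B hB g
    obtain ⟨p, hp, h⟩ := exists_norm_apply_le hB
    have h1 : SeminormBounded fun (T : SchwartzOperator N) (_ : Phase N) => p T :=
      ⟨p, hp, fun _ _ => le_rfl⟩
    refine (h1.const_mul (norm_nonneg (toHilb N g))).mono fun T x => ?_
    rw [pow_zero, one_mul]
    refine (h T _).trans_eq ?_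
    rw [← weylOp_toHilb, norm_weylOp_apply, mul_comm]
  | succ n ih =>
    intro B hB g
    refine ((ih (B * fieldOp v) (mul_mem hB (fieldOp_mem_weylAlg v)) g).add
      (ih B hB (fieldOp v g))).mono fun T x => ?_
    have h1 : (symp v x : ℂ) • T.toCLM (toHilb N (B (weylS x g))) =
        T.toCLM (toHilb N ((B * fieldOp v) (weylS x g))) -
          T.toCLM (toHilb N (B (weylS x (fieldOp v g)))) := by
      rw [show (B * fieldOp v) (weylS x g) = B (fieldOp v (weylS x g)) from rfl, fieldOp_weylS, map_add, map_add, map_add, map_smul,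
        map_smul, map_smul, add_sub_cancel_left]
    have h2 : |symp v x| * ‖T.toCLM (toHilb N (B (weylS x g)))‖ =
        ‖(symp v x : ℂ) • T.toCLM (toHilb N (B (weylS x g)))‖ := by
      rw [norm_smul, Complex.norm_real, Real.norm_eq_abs]
    rw [pow_succ, mul_assoc, h2, h1, ← mul_add]
    gcongr
    exact norm_sub_le _ _

theorem seminormBounded_norm_coh (n : ℕ) :
    SeminormBounded fun (T : SchwartzOperator N) (x : Phase N) =>
      ‖x‖ ^ n * ‖T.toCLM (toHilb N (coh x))‖ :=
  SeminormBounded.norm_pow_mul (fun _ _ => norm_nonneg _)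
    (fun v n => seminormBounded_symp_pow_mul_norm_weylS v n 1 (one_mem _) (vac N)) n

theorem continuous_apply_coh (T : Hilb N →L[ℂ] Hilb N) :
    Continuous fun x : Phase N => T (toHilb N (coh x)) :=
  T.continuous.comp continuous_coh

theorem integrable_norm_pow_mul_coh (T : SchwartzOperator N) (n : ℕ) :
    Integrable (fun x : Phase N => ‖x‖ ^ n * ‖T.toCLM (toHilb N (coh x))‖) (phaseMeasure N) := by
  obtain ⟨p, -, hp⟩ := seminormBounded_norm_coh (N := N) 0
  -- Boundedness together with extra decay of order `integrablePower` makes the weighted function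
  -- integrable on phase space.
  obtain ⟨q, -, hq⟩ := seminormBounded_norm_coh (N := N) (n + (phaseMeasure N).integrablePower)
  exact integrable_of_le_of_pow_mul_le (C₁ := p T) (C₂ := q T)
    (fun x => by simpa using hp T x) (hq T) (continuous_apply_coh _).aestronglyMeasurable

theorem seminormBounded_integral_norm_coh :
    SeminormBounded fun (T : SchwartzOperator N) (_ : Unit) =>
      ∫ x, ‖T.toCLM (toHilb N (coh x))‖ ∂(phaseMeasure N) := by
  obtain ⟨p, hp, h⟩ := seminormBounded_norm_coh (N := N) 0
  obtain ⟨q, hq, h'⟩ := seminormBounded_norm_coh (N := N) (0 + (phaseMeasure N).integrablePower)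
  have h1 : SeminormBounded fun (T : SchwartzOperator N) (_ : Unit) => p T + q T :=
    ⟨p + q, hp.add hq, fun _ _ => le_rfl⟩
  refine (h1.const_mul (c := 2 ^ (phaseMeasure N).integrablePower *
    ∫ x : Phase N, (1 + ‖x‖) ^ (-((phaseMeasure N).integrablePower : ℝ)) ∂(phaseMeasure N))
      (by positivity)).mono fun T _ => ?_
  have h2 := integral_pow_mul_le_of_le_of_pow_mul_le (μ := phaseMeasure N) (k := 0)
    (f := fun x => T.toCLM (toHilb N (coh x))) (fun x => by simpa using h T x) (h' T)
  simpa using h2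

/-- The representation `T = ∫ T |W(x) g⟩⟨W(x) g| dx` of a Schwartz operator. -/
theorem isNuclear_coh (T : SchwartzOperator N) :
    IsNuclear (phaseMeasure N) (fun x => T.toCLM (toHilb N (coh x)))
      (fun x => toHilb N (coh x)) T.toCLM where
  measurable_left := (continuous_apply_coh _).aestronglyMeasurable
  measurable_right := continuous_coh.aestronglyMeasurable
  integrable := by simpa [norm_coh] using integrable_norm_pow_mul_coh T 0
  inner_eq u v := by
    rw [← ContinuousLinearMap.adjoint_inner_left, ← integral_inner_coh]
    simp_rw [ContinuousLinearMap.adjoint_inner_left]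

theorem SchwartzOperator.isTraceClass (T : SchwartzOperator N) : IsTraceClass T.toCLM :=
  (isNuclear_coh T).isTraceClass

theorem SchwartzOperator.isHilbertSchmidt (T : SchwartzOperator N) :
    IsHilbertSchmidt T.toCLM :=
  T.isTraceClass.isHilbertSchmidt

theorem weylFun_eq_integral (T : SchwartzOperator N) (z : Phase N) :
    weylFun T.toCLM z =
      ∫ x, ⟪toHilb N (coh x), weylOp z (T.toCLM (toHilb N (coh x)))⟫_ℂ ∂(phaseMeasure N) :=
  ((isNuclear_coh T).comp_left (weylOp z)).opTrace_eq

/-- The dual representation T = ∫ |W(x)g⟩⟨T* W(x)g| dx. Here W(z) acts on a Schwartz vector, so one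
can differentiate under the integral. -/
theorem weylFun_eq_integral_adj (T : SchwartzOperator N) (z : Phase N) :
    weylFun T.toCLM z =
      ∫ x, ⟪T.adj.toCLM (toHilb N (coh x)), weylOp z (toHilb N (coh x))⟫_ℂ ∂(phaseMeasure N) := by
  have h := (isNuclear_coh T.adj).adjoint
  rw [SchwartzOperator.toCLM_adj, ContinuousLinearMap.adjoint_adjoint] at h
  exact (h.comp_left (weylOp z)).opTrace_eq

theorem weylFun_adj (T : SchwartzOperator N) (z : Phase N) :
    weylFun T.adj.toCLM z = (starRingEnd ℂ) (weylFun T.toCLM (-z)) := by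
  have h : T.adj.adj = T := SchwartzOperator.toCLM_injective (by
    rw [SchwartzOperator.toCLM_adj, SchwartzOperator.toCLM_adj,
      ContinuousLinearMap.adjoint_adjoint])
  rw [weylFun_eq_integral_adj, h, weylFun_eq_integral, ← integral_conj]
  congr 1 with x
  rw [inner_conj_symm, ← neg_neg z, inner_weylOp_neg, neg_neg]

theorem integrable_inner_weylOp_coh (T : SchwartzOperator N) (z : Phase N) :
    Integrable (fun x => ⟪toHilb N (coh x), weylOp z (T.toCLM (toHilb N (coh x)))⟫_ℂ)
      (phaseMeasure N) := by
  have h1 := integrable_norm_pow_mul_coh T 0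
  simp only [pow_zero, one_mul] at h1
  refine h1.mono' (continuous_coh.inner ((weylOp z).continuous.comp
    (continuous_apply_coh _))).aestronglyMeasurable (.of_forall fun x => ?_)
  refine (norm_inner_le_norm _ _).trans_eq ?_
  rw [norm_coh, norm_weylOp_apply, one_mul]

theorem weylFun_add (S T : SchwartzOperator N) (z : Phase N) :
    weylFun (S + T).toCLM z = weylFun S.toCLM z + weylFun T.toCLM z := by
  rw [weylFun_eq_integral, weylFun_eq_integral, weylFun_eq_integral]
  simp only [SchwartzOperator.toCLM_add, add_apply, map_add, inner_add_right]
  exact integral_add (integrable_inner_weylOp_coh S z) (integrable_inner_weylOp_coh T z)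

theorem weylFun_smul (c : ℂ) (T : SchwartzOperator N) (z : Phase N) :
    weylFun (c • T).toCLM z = c * weylFun T.toCLM z := by
  rw [weylFun_eq_integral, weylFun_eq_integral]
  simp only [SchwartzOperator.toCLM_smul, smul_apply, map_smul, inner_smul_right]
  exact integral_const_mul _ _

theorem weylFun_sub (S T : SchwartzOperator N) (z : Phase N) :
    weylFun (S - T).toCLM z = weylFun S.toCLM z - weylFun T.toCLM z := by
  have h : S - T = S + (-1 : ℂ) • T := by rw [neg_one_smul, sub_eq_add_neg]
  rw [h, weylFun_add, weylFun_smul]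
  ring

theorem seminormBounded_norm_weylFun :
    SeminormBounded fun (T : SchwartzOperator N) z => ‖weylFun T.toCLM z‖ := by
  obtain ⟨p, hp, h⟩ := seminormBounded_integral_norm_coh (N := N)
  refine ⟨p, hp, fun T z => (?_ : _ ≤ _).trans (h T ())⟩
  beta_reduce
  rw [weylFun_eq_integral]
  have h1 := integrable_norm_pow_mul_coh T 0
  simp only [pow_zero, one_mul] at h1
  refine norm_integral_le_of_norm_le h1 (.of_forall fun x => ?_)
  refine (norm_inner_le_norm _ _).trans_eq ?_
  rw [norm_coh, norm_weylOp_apply, one_mul]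

end CoherentStates

/-! ### The Weyl transform of a Schwartz operator is a Schwartz function -/

section WeylTransform

variable {N : ℕ}

theorem continuous_symp (v : Phase N) : Continuous (symp v) := by
  unfold symp
  fun_prop

theorem fieldVec_coh (x v : Phase N) :
    fieldVec (coh x) v = weylOp x (fieldVec (vac N) v) + (symp v x : ℂ) • toHilb N (coh x) := by
  rw [coh, fieldVec_weylS, weylOp_toHilb x (vac N)]

theorem continuous_fieldVec_coh (v : Phase N) :
    Continuous fun x : Phase N => fieldVec (coh x) v := by
  simp_rw [fieldVec_coh]
  exact (continuous_weylOp _).add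
    ((Complex.continuous_ofReal.comp (continuous_symp v)).smul continuous_coh)

theorem norm_fieldVec_coh_le (x : Phase N) :
    ‖fieldVec (coh x)‖ ≤ ‖fieldVec (vac N)‖ + 2 * ‖x‖ := by
  refine ContinuousLinearMap.opNorm_le_bound _ (by positivity) fun v => ?_
  rw [fieldVec_coh]
  refine (norm_add_le _ _).trans ?_
  rw [norm_weylOp_apply, norm_smul, norm_coh, mul_one, Complex.norm_real, add_mul]
  refine add_le_add ((fieldVec (vac N)).le_opNorm v) ((abs_symp_le v x).trans_eq (by ring))

theorem continuous_coeffDeriv_coh (T : Hilb N →L[ℂ] Hilb N) (z : Phase N) :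
    Continuous fun x : Phase N => coeffDeriv (T (toHilb N (coh x))) (coh x) z := by
  refine continuous_clm_apply.2 fun v => ?_
  have h1 := continuous_apply_coh T
  have h2 := continuous_coh (N := N)
  have h3 := continuous_fieldVec_coh v
  simp_rw [coeffDeriv_apply, fieldVec_weylS]
  fun_prop

theorem norm_coeffDeriv_coh_le (u : Hilb N) (x z : Phase N) :
    ‖coeffDeriv u (coh x) z‖ ≤ ‖u‖ * (‖fieldVec (vac N)‖ + 2 * ‖x‖ + ‖z‖) := by
  refine (norm_coeffDeriv_le _ _ _).trans ?_
  rw [norm_coh, mul_one]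
  gcongr
  exact norm_fieldVec_coh_le x

/-- Eliminates W G in favour of G W. Paired with u = T* W(x)g, only the operator T G then appears.
-/
theorem coeffDeriv_eq (u : Hilb N) (φ : 𝓢(Config N, ℂ)) (z v : Phase N) :
    coeffDeriv u φ z v = Complex.I / 2 * (2 * ⟪u, toHilb N (fieldOp v (weylS z φ))⟫_ℂ -
      symp v z * ⟪u, weylOp z (toHilb N φ)⟫_ℂ) := by
  have h : weylOp z (fieldVec φ v) = fieldVec (weylS z φ) v -
      (symp v z : ℂ) • weylOp z (toHilb N φ) := by
    rw [fieldVec_weylS, add_sub_cancel_right]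
  rw [coeffDeriv_apply, h, inner_sub_right, inner_smul_right, fieldVec_apply]
  ring

theorem SchwartzOperator.inner_adj (T : SchwartzOperator N) (u v : Hilb N) :
    ⟪T.adj.toCLM u, v⟫_ℂ = ⟪u, T.toCLM v⟫_ℂ := by
  rw [SchwartzOperator.toCLM_adj, ContinuousLinearMap.adjoint_inner_left]

theorem integrable_inner_adj_weylOp_coh (T : SchwartzOperator N) (z : Phase N) :
    Integrable (fun x => ⟪T.adj.toCLM (toHilb N (coh x)), weylOp z (toHilb N (coh x))⟫_ℂ)
      (phaseMeasure N) := by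
  have h1 := integrable_norm_pow_mul_coh T.adj 0
  simp only [pow_zero, one_mul] at h1
  refine h1.mono' ((continuous_apply_coh _).inner ((weylOp z).continuous.comp
    continuous_coh)).aestronglyMeasurable (.of_forall fun x => ?_)
  refine (norm_inner_le_norm _ _).trans_eq ?_
  rw [norm_weylOp_apply, norm_coh, mul_one]

theorem exists_hasFDerivAt_weylFun (T : SchwartzOperator N) (z : Phase N) :
    ∃ L : Phase N →L[ℝ] ℂ, HasFDerivAt (weylFun T.toCLM) L z ∧
      ∀ v, L v = Complex.I / 2 * (2 * weylFun (SchwartzOperator.mulField v T).toCLM z -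
        symp v z * weylFun T.toCLM z) := by
  have h0 := integrable_norm_pow_mul_coh T.adj 0
  have h1 := integrable_norm_pow_mul_coh T.adj 1
  simp only [pow_zero, one_mul, pow_one] at h0 h1
  have hb : ∀ c : ℝ, Integrable (fun x : Phase N => ‖T.adj.toCLM (toHilb N (coh x))‖ *
      (‖fieldVec (vac N)‖ + 2 * ‖x‖ + c)) (phaseMeasure N) := fun c => by
    refine ((h1.const_mul 2).add (h0.const_mul (‖fieldVec (vac N)‖ + c))).congr
      (.of_forall fun x => ?_)
    simp only [Pi.add_apply]
    ring
  -- The derivative grows linearly in `x`, which the rapid decay of ‖T* W(x)g‖ compensates.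
  have key := hasFDerivAt_integral_of_dominated_of_fderiv_le (𝕜 := ℝ) (μ := phaseMeasure N)
    (s := Metric.ball z 1) (x₀ := z)
    (F := fun z x => ⟪T.adj.toCLM (toHilb N (coh x)), weylOp z (toHilb N (coh x))⟫_ℂ)
    (F' := fun z x => coeffDeriv (T.adj.toCLM (toHilb N (coh x))) (coh x) z)
    (bound := fun x => ‖T.adj.toCLM (toHilb N (coh x))‖ *
      (‖fieldVec (vac N)‖ + 2 * ‖x‖ + (‖z‖ + 1)))
    (Metric.ball_mem_nhds z one_pos)
    (.of_forall fun w => (integrable_inner_adj_weylOp_coh T w).aestronglyMeasurable)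
    (integrable_inner_adj_weylOp_coh T z)
    (continuous_coeffDeriv_coh _ z).aestronglyMeasurable
    (.of_forall fun x w hw => by
      have hw' : ‖w‖ ≤ ‖z‖ + 1 := by
        have h1 := norm_le_norm_add_norm_sub z w
        have h2 : ‖w - z‖ < 1 := by simpa [dist_eq_norm] using hw
        rw [norm_sub_rev] at h2
        linarith
      exact (norm_coeffDeriv_coh_le _ x w).trans (by gcongr))
    (hb _) (.of_forall fun x w _ => hasFDerivAt_coeff _ _ _)
  refine ⟨_, key.congr_of_eventuallyEq (.of_forall fun w => weylFun_eq_integral_adj T w),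
    fun v => ?_⟩
  rw [ContinuousLinearMap.integral_apply ((hb ‖z‖).mono'
    (continuous_coeffDeriv_coh _ z).aestronglyMeasurable
    (.of_forall fun x => norm_coeffDeriv_coh_le _ x z)), weylFun_eq_integral_adj,
    weylFun_eq_integral_adj]
  have h2 := (integrable_inner_adj_weylOp_coh (SchwartzOperator.mulField v T) z).const_mul 2
  have h3 := (integrable_inner_adj_weylOp_coh T z).const_mul (symp v z : ℂ)
  rw [← integral_const_mul, ← integral_const_mul, ← integral_sub h2 h3, ← integral_const_mul]
  congr 1 with x
  rw [coeffDeriv_eq, SchwartzOperator.inner_adj, SchwartzOperator.inner_adj,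
    SchwartzOperator.inner_adj, weylOp_toHilb, SchwartzOperator.mulField_toHilb]

/-- The same derivative with G T in place of T G, obtained from the adjoint and the reflection z ↦
−z. -/
theorem exists_hasFDerivAt_weylFun' (T : SchwartzOperator N) (z : Phase N) :
    ∃ L : Phase N →L[ℝ] ℂ, HasFDerivAt (weylFun T.toCLM) L z ∧
      ∀ v, L v = Complex.I / 2 * (2 * weylFun (SchwartzOperator.fieldMul v T).toCLM z +
        symp v z * weylFun T.toCLM z) := by
  obtain ⟨L, hL, hL'⟩ := exists_hasFDerivAt_weylFun T.adj (-z)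
  have h1 : ∀ w, weylFun T.toCLM w = (starRingEnd ℂ) (weylFun T.adj.toCLM (-w)) := fun w => by
    rw [weylFun_adj, neg_neg, Complex.conj_conj]
  refine ⟨_, ((Complex.conjCLE : ℂ →L[ℝ] ℂ).hasFDerivAt.comp z
    (hL.comp z (hasFDerivAt_id z).neg)).congr_of_eventuallyEq (.of_forall h1), fun v => ?_⟩
  have h2 : weylFun (SchwartzOperator.fieldMul v T).toCLM z =
      (starRingEnd ℂ) (weylFun (SchwartzOperator.mulField v T.adj).toCLM (-z)) :=
    weylFun_adj _ _
  rw [h2, h1 z]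
  have h3 : ((Complex.conjCLE : ℂ →L[ℝ] ℂ) ∘L L ∘L (-ContinuousLinearMap.id ℝ (Phase N))) v =
      -(starRingEnd ℂ) (L v) := by simp
  refine h3.trans ?_
  rw [hL', symp_neg_right]
  simp only [map_mul, map_sub, map_div₀, Complex.conj_I, Complex.conj_ofReal, map_ofNat]
  push_cast
  ring

namespace SchwartzOperator

/-- The map `T ↦ T G - G T` on Schwartz operators, which the Weyl transform takes to the
multiplication by a linear function. -/
def commField (v : Phase N) : SchwartzOperator N →L[ℂ] SchwartzOperator N :=
  mulField v - fieldMul v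

instance : ContinuousSMul ℂ (SchwartzOperator N) :=
  (schwartzOperator_withSeminorms N).continuousSMul

/-- The map `T ↦ (i/2) (T G + G T)` on Schwartz operators, which the Weyl transform takes to a
directional derivative. -/
def anticommField (v : Phase N) : SchwartzOperator N →L[ℂ] SchwartzOperator N :=
  (Complex.I / 2) • (mulField v + fieldMul v)

end SchwartzOperator

open SchwartzOperator

/-- The two expressions for the derivative must agree, and their difference is this identity;
cyclicity of the trace is not needed. -/
theorem weylFun_commField (v : Phase N) (T : SchwartzOperator N) (z : Phase N) :
    weylFun (commField v T).toCLM z = symp v z * weylFun T.toCLM z := by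
  obtain ⟨L, hL, h⟩ := exists_hasFDerivAt_weylFun T z
  obtain ⟨L', hL', h'⟩ := exists_hasFDerivAt_weylFun' T z
  have h1 := h v
  rw [hL.unique hL', h' v] at h1
  have h2 := mul_left_cancel₀ (by simp) h1
  rw [commField, sub_apply, weylFun_sub]
  linear_combination (-1 / 2) * h2

theorem exists_hasFDerivAt_weylFun_anticommField (T : SchwartzOperator N) (z : Phase N) :
    ∃ L : Phase N →L[ℝ] ℂ, HasFDerivAt (weylFun T.toCLM) L z ∧
      ∀ v, L v = weylFun (anticommField v T).toCLM z := by
  obtain ⟨L, hL, h⟩ := exists_hasFDerivAt_weylFun T z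
  refine ⟨L, hL, fun v => ?_⟩
  have h1 := weylFun_commField v T z
  rw [commField, sub_apply, weylFun_sub] at h1
  rw [h v, anticommField, smul_apply, add_apply, weylFun_smul, weylFun_add]
  linear_combination (Complex.I / 2) * h1

/-- The derivative of the Weyl transform, as a sum over a basis of phase space. -/
theorem hasFDerivAt_weylFun (T : SchwartzOperator N) (z : Phase N) :
    HasFDerivAt (weylFun T.toCLM) (∑ j, ContinuousLinearMap.smulRightL ℝ (Phase N) ℂ
      ((Module.finBasis ℝ (Phase N)).coord j).toContinuousLinearMap
        (weylFun (anticommField (Module.finBasis ℝ (Phase N) j) T).toCLM z)) z := by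
  obtain ⟨L, hL, h⟩ := exists_hasFDerivAt_weylFun_anticommField T z
  refine hL.congr_fderiv (ContinuousLinearMap.ext fun v => ?_)
  conv_lhs => rw [← (Module.finBasis ℝ (Phase N)).sum_repr v, map_sum]
  simp [sum_apply, ← h]

theorem contDiff_weylFun (n : ℕ) (T : SchwartzOperator N) :
    ContDiff ℝ n (weylFun T.toCLM) := by
  -- The derivative is a combination of Weyl transforms of other Schwartz operators, so `T` must
  -- vary.
  induction n generalizing T with
  | zero =>
    exact contDiff_zero.2 (continuous_iff_continuousAt.2 fun z =>
      (hasFDerivAt_weylFun T z).continuousAt)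
  | succ n ih =>
    push_cast
    refine contDiff_succ_iff_fderiv.2 ⟨fun z => (hasFDerivAt_weylFun T z).differentiableAt,
      fun h => absurd h (by simp), ?_⟩
    rw [funext fun z => (hasFDerivAt_weylFun T z).fderiv]
    exact ContDiff.sum fun j _ => (ContinuousLinearMap.contDiff _).comp (ih _)

theorem seminormBounded_symp_pow_mul_norm_weylFun (v : Phase N) (n : ℕ) :
    SeminormBounded fun (T : SchwartzOperator N) z => |symp v z| ^ n * ‖weylFun T.toCLM z‖ := by
  induction n with
  | zero => simpa using seminormBounded_norm_weylFun
  | succ n ih =>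
    refine (ih.comp (commField v)).mono fun T z => le_of_eq ?_
    rw [weylFun_commField, norm_mul, Complex.norm_real, Real.norm_eq_abs, pow_succ, mul_assoc]

/-- A derivative of the transform is a finite combination of transforms of `anticommField` images,
and continuous seminorms pull back along these continuous maps. -/
theorem seminormBounded_iteratedFDeriv_weylFun (k n : ℕ) :
    SeminormBounded fun (T : SchwartzOperator N) z =>
      ‖z‖ ^ k * ‖iteratedFDeriv ℝ n (weylFun T.toCLM) z‖ := by
  induction n with
  | zero =>
    simpa using SeminormBounded.norm_pow_mul (fun (T : SchwartzOperator N) z =>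
      norm_nonneg (weylFun T.toCLM z)) seminormBounded_symp_pow_mul_norm_weylFun k
  | succ n ih =>
    refine (SeminormBounded.sum Finset.univ fun j =>
      (ih.comp (anticommField (Module.finBasis ℝ (Phase N) j))).const_mul
        (norm_nonneg (ContinuousLinearMap.smulRightL ℝ (Phase N) ℂ
          ((Module.finBasis ℝ (Phase N)).coord j).toContinuousLinearMap))).mono fun T z => ?_
    have h := iteratedFDeriv_fun_sum_apply (𝕜 := ℝ) (n := n) (x := z) (u := Finset.univ)
      (f := fun j z => ContinuousLinearMap.smulRightL ℝ (Phase N) ℂ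
        ((Module.finBasis ℝ (Phase N)).coord j).toContinuousLinearMap
          (weylFun (anticommField (Module.finBasis ℝ (Phase N) j) T).toCLM z))
      fun j _ => ((ContinuousLinearMap.contDiff _).comp (contDiff_weylFun n _)).contDiffAt
    rw [← norm_iteratedFDeriv_fderiv, funext fun z => (hasFDerivAt_weylFun T z).fderiv, h]
    refine (mul_le_mul_of_nonneg_left (norm_sum_le _ _) (by positivity)).trans ?_
    rw [Finset.mul_sum]
    refine Finset.sum_le_sum fun j _ => ?_
    rw [mul_left_comm]
    gcongr
    exact ContinuousLinearMap.norm_iteratedFDeriv_comp_left _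
      (contDiff_weylFun n _).contDiffAt le_rfl

/-- The Weyl transform of a Schwartz operator, as a Schwartz function. -/
def weylSchwartzₗ (N : ℕ) : SchwartzOperator N →ₗ[ℂ] 𝓢(Phase N, ℂ) where
  toFun T :=
    { toFun := weylFun T.toCLM
      smooth' := contDiff_infty.2 fun n => contDiff_weylFun n T
      decay' := fun k n => by
        obtain ⟨p, -, h⟩ := seminormBounded_iteratedFDeriv_weylFun (N := N) k n
        exact ⟨p T, h T⟩ }
  map_add' S T := SchwartzMap.ext fun z => weylFun_add S T z
  map_smul' c T := SchwartzMap.ext fun z => weylFun_smul c T z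

/-- The Weyl transform as a continuous linear map from Schwartz operators to Schwartz functions. -/
def weylSchwartz (N : ℕ) : SchwartzOperator N →L[ℂ] 𝓢(Phase N, ℂ) where
  toLinearMap := weylSchwartzₗ N
  cont := by
    refine WithSeminorms.continuous_of_continuous_comp
      (schwartz_withSeminorms ℂ (Phase N) ℂ) (weylSchwartzₗ N) fun ⟨k, n⟩ => ?_
    obtain ⟨p, hp, h⟩ := seminormBounded_iteratedFDeriv_weylFun (N := N) k n
    exact Seminorm.continuous_of_le hp fun T =>
      SchwartzMap.seminorm_le_bound ℂ k n _ (apply_nonneg p T) (h T)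

theorem weylSchwartz_apply (T : SchwartzOperator N) (z : Phase N) :
    weylSchwartz N T z = weylFun T.toCLM z := rfl

end WeylTransform

/-! ### Weyl quantization of Schwartz functions -/

section Quantization

variable {N : ℕ}

theorem integrable_schwartz (g : 𝓢(Phase N, ℂ)) : Integrable g (phaseMeasure N) :=
  g.integrable

theorem continuous_weylOp_neg (u : Hilb N) : Continuous fun x : Phase N => weylOp (-x) u :=
  (continuous_weylOp u).comp continuous_neg

theorem integrable_smul_weylOp (g : 𝓢(Phase N, ℂ)) (u : Hilb N) :
    Integrable (fun x => g x • weylOp (-x) u) (phaseMeasure N) := by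
  refine ((integrable_schwartz g).norm.mul_const ‖u‖).mono'
    (g.continuous.smul (continuous_weylOp_neg u)).aestronglyMeasurable (.of_forall fun x => ?_)
  rw [norm_smul, norm_weylOp_apply]

/-- The operator `∫ g(x) W(-x) dx`. -/
def weylQuant (g : 𝓢(Phase N, ℂ)) : Hilb N →L[ℂ] Hilb N :=
  LinearMap.mkContinuous
    { toFun := fun u => ∫ x, g x • weylOp (-x) u ∂(phaseMeasure N)
      map_add' := fun u v => by
        simp_rw [map_add, smul_add]
        exact integral_add (integrable_smul_weylOp g u) (integrable_smul_weylOp g v)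
      map_smul' := fun c u => by
        simp_rw [map_smul, smul_comm _ c]
        exact integral_smul c _ }
    (∫ x, ‖g x‖ ∂(phaseMeasure N)) fun u => by
      rw [← integral_mul_const]
      refine norm_integral_le_of_norm_le ((integrable_schwartz g).norm.mul_const ‖u‖)
        (.of_forall fun x => ?_)
      rw [norm_smul, norm_weylOp_apply]

theorem norm_weylQuant_le (g : 𝓢(Phase N, ℂ)) :
    ‖weylQuant g‖ ≤ ∫ x, ‖g x‖ ∂(phaseMeasure N) :=
  LinearMap.mkContinuous_norm_le _ (integral_nonneg fun _ => norm_nonneg _) _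

theorem inner_weylQuant (g : 𝓢(Phase N, ℂ)) (u v : Hilb N) :
    ⟪u, weylQuant g v⟫_ℂ = ∫ x, g x * ⟪u, weylOp (-x) v⟫_ℂ ∂(phaseMeasure N) := by
  have h := (innerSL ℂ u).integral_comp_comm (integrable_smul_weylOp g v)
  simp only [innerSL_apply_apply, inner_smul_right] at h
  exact h.symm

theorem integrable_mul_coeff (g : 𝓢(Phase N, ℂ)) (u v : Hilb N) :
    Integrable (fun x => g x * ⟪u, weylOp (-x) v⟫_ℂ) (phaseMeasure N) := by
  have h := (innerSL ℂ u).integrable_comp (integrable_smul_weylOp g v)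
  simp only [innerSL_apply_apply, inner_smul_right] at h
  exact h

theorem weylQuant_add (f g : 𝓢(Phase N, ℂ)) : weylQuant (f + g) = weylQuant f + weylQuant g := by
  refine ContinuousLinearMap.ext fun u => ext_inner_left ℂ fun v => ?_
  rw [add_apply, inner_add_right, inner_weylQuant, inner_weylQuant, inner_weylQuant,
    ← integral_add (integrable_mul_coeff f v u) (integrable_mul_coeff g v u)]
  congr 1 with x
  rw [add_apply, add_mul]

theorem weylQuant_smul (c : ℂ) (g : 𝓢(Phase N, ℂ)) : weylQuant (c • g) = c • weylQuant g := by
  refine ContinuousLinearMap.ext fun u => ext_inner_left ℂ fun v => ?_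
  rw [smul_apply, inner_smul_right, inner_weylQuant, inner_weylQuant, ← integral_const_mul]
  congr 1 with x
  rw [smul_apply, smul_eq_mul, mul_assoc]

/-- Multiplication by the linear function `symp v`. -/
def sympMul (v : Phase N) : 𝓢(Phase N, ℂ) →L[ℂ] 𝓢(Phase N, ℂ) :=
  SchwartzMap.smulLeftCLM ℂ fun x : Phase N => ((symp v x : ℝ) : ℂ)

theorem sympMul_apply (v : Phase N) (g : 𝓢(Phase N, ℂ)) (x : Phase N) :
    sympMul v g x = symp v x * g x := by
  have h : Function.HasTemperateGrowth fun x : Phase N => ((symp v x : ℝ) : ℂ) :=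
    (Complex.ofRealCLM ∘L (innerSL ℝ v.2 ∘L ContinuousLinearMap.fst ℝ (Config N) (Config N) -
      innerSL ℝ v.1 ∘L ContinuousLinearMap.snd ℝ (Config N) (Config N))).hasTemperateGrowth
  rw [sympMul, SchwartzMap.smulLeftCLM_apply_apply h, smul_eq_mul]

/-- The differential operator that corresponds to the left multiplication by a field operator, for
`s = -1`, and to the right multiplication, for `s = 1`. -/
def fieldSymbol (s : ℂ) (v : Phase N) : 𝓢(Phase N, ℂ) →L[ℂ] 𝓢(Phase N, ℂ) :=
  -Complex.I • LineDeriv.lineDerivOpCLM ℂ 𝓢(Phase N, ℂ) v + (s / 2) • sympMul v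

theorem fieldSymbol_apply (s : ℂ) (v : Phase N) (g : 𝓢(Phase N, ℂ)) (x : Phase N) :
    fieldSymbol s v g x = -Complex.I * fderiv ℝ g x v + s / 2 * (symp v x * g x) := by
  rw [← sympMul_apply]
  rfl

theorem hasFDerivAt_coeff_neg (u : Hilb N) (φ : 𝓢(Config N, ℂ)) (x : Phase N) :
    HasFDerivAt (fun x => ⟪u, weylOp (-x) (toHilb N φ)⟫_ℂ) (-coeffDeriv u φ (-x)) x := by
  refine ((hasFDerivAt_coeff u φ (-x)).comp x (hasFDerivAt_id x).neg).congr_fderiv ?_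
  refine ContinuousLinearMap.ext fun v => ?_
  simp

theorem inner_fieldVec_weylS (ψ φ : 𝓢(Config N, ℂ)) (z v : Phase N) :
    ⟪toHilb N ψ, fieldVec (weylS z φ) v⟫_ℂ =
      ⟪toHilb N (fieldOp v ψ), weylOp z (toHilb N φ)⟫_ℂ := by
  rw [fieldVec_apply, ← inner_fieldOp, weylOp_toHilb]

theorem coeffDeriv_toHilb (ψ φ : 𝓢(Config N, ℂ)) (z v : Phase N) :
    coeffDeriv (toHilb N ψ) φ z v = Complex.I / 2 *
      (⟪toHilb N (fieldOp v ψ), weylOp z (toHilb N φ)⟫_ℂ +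
        ⟪toHilb N ψ, weylOp z (toHilb N (fieldOp v φ))⟫_ℂ) := by
  rw [coeffDeriv_apply, inner_fieldVec_weylS, fieldVec_apply]

theorem inner_fieldOp_weylOp (ψ φ : 𝓢(Config N, ℂ)) (z v : Phase N) :
    ⟪toHilb N (fieldOp v ψ), weylOp z (toHilb N φ)⟫_ℂ =
      ⟪toHilb N ψ, weylOp z (toHilb N (fieldOp v φ))⟫_ℂ +
        symp v z * ⟪toHilb N ψ, weylOp z (toHilb N φ)⟫_ℂ := by
  rw [← inner_fieldVec_weylS, fieldVec_weylS, inner_add_right, inner_smul_right, fieldVec_apply]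

/-- Integration by parts against a matrix coefficient of the Weyl system. -/
theorem inner_weylQuant_fieldSymbol (s : ℂ) (v : Phase N) (g : 𝓢(Phase N, ℂ))
    (ψ φ : 𝓢(Config N, ℂ)) :
    ⟪toHilb N ψ, weylQuant (fieldSymbol s v g) (toHilb N φ)⟫_ℂ =
      (1 - s) / 2 * ⟪toHilb N (fieldOp v ψ), weylQuant g (toHilb N φ)⟫_ℂ +
        (1 + s) / 2 * ⟪toHilb N ψ, weylQuant g (toHilb N (fieldOp v φ))⟫_ℂ := by
  have ha := integrable_mul_coeff g (toHilb N (fieldOp v ψ)) (toHilb N φ)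
  have hb := integrable_mul_coeff g (toHilb N ψ) (toHilb N (fieldOp v φ))
  have hd : Integrable (fun x => fderiv ℝ g x v * ⟪toHilb N ψ, weylOp (-x) (toHilb N φ)⟫_ℂ)
      (phaseMeasure N) :=
    integrable_mul_coeff (LineDeriv.lineDerivOp v g) (toHilb N ψ) (toHilb N φ)
  have hs : Integrable (fun x => (symp v x * g x) *
      ⟪toHilb N ψ, weylOp (-x) (toHilb N φ)⟫_ℂ) (phaseMeasure N) := by
    simpa only [sympMul_apply] using integrable_mul_coeff (sympMul v g) (toHilb N ψ) (toHilb N φ)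
  have h1 : ∀ x, g x * (-coeffDeriv (toHilb N ψ) φ (-x)) v =
      -(Complex.I / 2) * (g x * ⟪toHilb N (fieldOp v ψ), weylOp (-x) (toHilb N φ)⟫_ℂ) +
        -(Complex.I / 2) * (g x * ⟪toHilb N ψ, weylOp (-x) (toHilb N (fieldOp v φ))⟫_ℂ) :=
    fun x => by
      rw [neg_apply, coeffDeriv_toHilb]
      ring
  have h2 := integral_bilinear_hasFDerivAt_right_eq_neg_left_of_integrable
    (B := ContinuousLinearMap.mul ℝ ℂ) (μ := phaseMeasure N) (f := g) (f' := fderiv ℝ g)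
    (g := fun x => ⟪toHilb N ψ, weylOp (-x) (toHilb N φ)⟫_ℂ)
    (g' := fun x => -coeffDeriv (toHilb N ψ) φ (-x)) (v := v) hd
    (by
      simp_rw [ContinuousLinearMap.mul_apply', h1]
      exact (ha.const_mul _).add (hb.const_mul _))
    (integrable_mul_coeff g (toHilb N ψ) (toHilb N φ))
    (fun x _ => g.differentiableAt.hasFDerivAt) (fun x _ => hasFDerivAt_coeff_neg _ _ _)
  simp_rw [ContinuousLinearMap.mul_apply', h1] at h2
  rw [integral_add (ha.const_mul _) (hb.const_mul _), integral_const_mul, integral_const_mul,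
    ← inner_weylQuant, ← inner_weylQuant] at h2
  -- Multiplying the symbol by σ(v, ·) produces the commutator with G_v, by the intertwining
  -- relation at −x; integration by parts in `h2` supplies the anticommutator.
  have h3 : ∫ x, (symp v x * g x) * ⟪toHilb N ψ, weylOp (-x) (toHilb N φ)⟫_ℂ ∂(phaseMeasure N) =
      ⟪toHilb N ψ, weylQuant g (toHilb N (fieldOp v φ))⟫_ℂ -
        ⟪toHilb N (fieldOp v ψ), weylQuant g (toHilb N φ)⟫_ℂ := by
    rw [inner_weylQuant, inner_weylQuant, ← integral_sub hb ha]
    congr 1 with x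
    rw [inner_fieldOp_weylOp, symp_neg_right]
    push_cast
    ring
  have h4 : ⟪toHilb N ψ, weylQuant (fieldSymbol s v g) (toHilb N φ)⟫_ℂ =
      -Complex.I * ∫ x, fderiv ℝ g x v * ⟪toHilb N ψ, weylOp (-x) (toHilb N φ)⟫_ℂ
        ∂(phaseMeasure N) +
      s / 2 * ∫ x, (symp v x * g x) * ⟪toHilb N ψ, weylOp (-x) (toHilb N φ)⟫_ℂ
        ∂(phaseMeasure N) := by
    rw [inner_weylQuant, ← integral_const_mul, ← integral_const_mul,
      ← integral_add (hd.const_mul _) (hs.const_mul _)]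
    congr 1 with x
    rw [fieldSymbol_apply]
    ring
  rw [h4, h3]
  linear_combination -Complex.I * h2 - (⟪toHilb N (fieldOp v ψ), weylQuant g (toHilb N φ)⟫_ℂ +
    ⟪toHilb N ψ, weylQuant g (toHilb N (fieldOp v φ))⟫_ℂ) / 2 * Complex.I_sq

theorem posOp_eq_fieldOp (i : Fin N) :
    posOp i = fieldOp ((0, EuclideanSpace.single i 1) : Phase N) := by
  ext φ y
  rw [fieldOp_apply, posOp_apply]
  simp [EuclideanSpace.inner_single_left]

theorem momOp_eq_fieldOp (i : Fin N) :
    momOp i = fieldOp ((-EuclideanSpace.single i 1, 0) : Phase N) := by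
  ext φ y
  rw [fieldOp_apply, momOp_apply_fderiv]
  simp

theorem weylAlg_induction {P : (𝓢(Config N, ℂ) →L[ℂ] 𝓢(Config N, ℂ)) → Prop}
    (field : ∀ v, P (fieldOp v)) (scalar : ∀ c : ℂ, P (algebraMap ℂ _ c))
    (add : ∀ A B, P A → P B → P (A + B)) (mul : ∀ A B, P A → P B → P (A * B))
    {A : 𝓢(Config N, ℂ) →L[ℂ] 𝓢(Config N, ℂ)} (hA : A ∈ weylAlg N) : P A := by
  refine Algebra.adjoin_induction (p := fun A _ => P A) ?_ scalar (fun A B _ _ => add A B)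
    (fun A B _ _ => mul A B) hA
  rintro A (⟨i, rfl⟩ | ⟨i, rfl⟩)
  · rw [posOp_eq_fieldOp]
    exact field _
  · rw [momOp_eq_fieldOp]
    exact field _

/-- The case s = −1 of the integration by parts handles one field operator. Scalars get conjugated
because `A` sits in the antilinear slot. -/
theorem exists_symbol_left {A : 𝓢(Config N, ℂ) →L[ℂ] 𝓢(Config N, ℂ)} (hA : A ∈ weylAlg N) :
    ∃ D : 𝓢(Phase N, ℂ) →L[ℂ] 𝓢(Phase N, ℂ), ∀ g ψ φ,
      ⟪toHilb N (A ψ), weylQuant g (toHilb N φ)⟫_ℂ =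
        ⟪toHilb N ψ, weylQuant (D g) (toHilb N φ)⟫_ℂ := by
  refine weylAlg_induction (P := fun A => ∃ D : 𝓢(Phase N, ℂ) →L[ℂ] 𝓢(Phase N, ℂ), ∀ g ψ φ,
      ⟪toHilb N (A ψ), weylQuant g (toHilb N φ)⟫_ℂ =
        ⟪toHilb N ψ, weylQuant (D g) (toHilb N φ)⟫_ℂ) ?_ ?_ ?_ ?_ hA
  · intro v
    refine ⟨fieldSymbol (-1) v, fun g ψ φ => ?_⟩
    rw [inner_weylQuant_fieldSymbol]
    ring
  · intro c
    refine ⟨(starRingEnd ℂ) c • ContinuousLinearMap.id ℂ _, fun g ψ φ => ?_⟩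
    have h1 : (algebraMap ℂ (𝓢(Config N, ℂ) →L[ℂ] 𝓢(Config N, ℂ)) c) ψ = c • ψ := rfl
    have h2 : ((starRingEnd ℂ) c • ContinuousLinearMap.id ℂ 𝓢(Phase N, ℂ)) g =
      (starRingEnd ℂ) c • g := rfl
    rw [h1, h2, map_smul, inner_smul_left, weylQuant_smul, smul_apply, inner_smul_right]
  · rintro A B ⟨D, hD⟩ ⟨D', hD'⟩
    refine ⟨D + D', fun g ψ φ => ?_⟩
    rw [add_apply, map_add, inner_add_left, hD, hD', add_apply, weylQuant_add, add_apply,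
      inner_add_right]
  · rintro A B ⟨D, hD⟩ ⟨D', hD'⟩
    exact ⟨D' ∘L D, fun g ψ φ => (hD g (B ψ) φ).trans (hD' (D g) ψ φ)⟩

theorem exists_symbol_right {B : 𝓢(Config N, ℂ) →L[ℂ] 𝓢(Config N, ℂ)} (hB : B ∈ weylAlg N) :
    ∃ D : 𝓢(Phase N, ℂ) →L[ℂ] 𝓢(Phase N, ℂ), ∀ g ψ φ,
      ⟪toHilb N ψ, weylQuant g (toHilb N (B φ))⟫_ℂ =
        ⟪toHilb N ψ, weylQuant (D g) (toHilb N φ)⟫_ℂ := by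
  refine weylAlg_induction (P := fun B => ∃ D : 𝓢(Phase N, ℂ) →L[ℂ] 𝓢(Phase N, ℂ), ∀ g ψ φ,
      ⟪toHilb N ψ, weylQuant g (toHilb N (B φ))⟫_ℂ =
        ⟪toHilb N ψ, weylQuant (D g) (toHilb N φ)⟫_ℂ) ?_ ?_ ?_ ?_ hB
  · intro v
    refine ⟨fieldSymbol 1 v, fun g ψ φ => ?_⟩
    rw [inner_weylQuant_fieldSymbol]
    ring
  · intro c
    refine ⟨c • ContinuousLinearMap.id ℂ _, fun g ψ φ => ?_⟩
    have h1 : (algebraMap ℂ (𝓢(Config N, ℂ) →L[ℂ] 𝓢(Config N, ℂ)) c) φ = c • φ := rfl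
    have h2 : (c • ContinuousLinearMap.id ℂ 𝓢(Phase N, ℂ)) g = c • g := rfl
    rw [h1, h2, map_smul, map_smul, weylQuant_smul, smul_apply]
  · rintro A B ⟨D, hD⟩ ⟨D', hD'⟩
    refine ⟨D + D', fun g ψ φ => ?_⟩
    rw [add_apply, map_add, map_add, inner_add_right, hD, hD', add_apply, weylQuant_add,
      add_apply, inner_add_right]
  · rintro A B ⟨D, hD⟩ ⟨D', hD'⟩
    exact ⟨D' ∘L D, fun g ψ φ => (hD g ψ (B φ)).trans (hD' (D g) ψ φ)⟩

/-- Once `A` and `B` have been moved onto the symbol, the operator norm is at most the L¹ norm of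
the new symbol, which is a continuous seminorm of `g`. -/
theorem exists_norm_inner_weylQuant_le {A B : 𝓢(Config N, ℂ) →L[ℂ] 𝓢(Config N, ℂ)}
    (hA : A ∈ weylAlg N) (hB : B ∈ weylAlg N) :
    ∃ p : Seminorm ℂ 𝓢(Phase N, ℂ), Continuous p ∧ ∀ g ψ φ,
      ‖⟪toHilb N (A ψ), weylQuant g (toHilb N (B φ))⟫_ℂ‖ ≤
        p g * (‖toHilb N ψ‖ * ‖toHilb N φ‖) := by
  obtain ⟨D, hD⟩ := exists_symbol_left hA
  obtain ⟨D', hD'⟩ := exists_symbol_right hB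
  let Λ : 𝓢(Phase N, ℂ) →L[ℂ] Lp ℂ 1 (phaseMeasure N) :=
    SchwartzMap.toLpCLM ℂ ℂ 1 (phaseMeasure N) ∘L D' ∘L D
  refine ⟨(normSeminorm ℂ _).comp Λ.toLinearMap, continuous_norm.comp Λ.continuous,
    fun g ψ φ => ?_⟩
  have h : ∫ x, ‖D' (D g) x‖ ∂(phaseMeasure N) = ‖Λ g‖ := by
    rw [L1.norm_eq_integral_norm]
    refine integral_congr_ae ?_
    filter_upwards [(D' (D g)).coeFn_toLp 1 (phaseMeasure N)] with x hx
    exact congrArg norm hx.symm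
  rw [hD, hD']
  refine (norm_inner_le_norm _ _).trans ?_
  refine (mul_le_mul_of_nonneg_left (ContinuousLinearMap.le_opNorm _ _) (norm_nonneg _)).trans ?_
  calc ‖toHilb N ψ‖ * (‖weylQuant (D' (D g))‖ * ‖toHilb N φ‖)
      ≤ ‖toHilb N ψ‖ * (‖Λ g‖ * ‖toHilb N φ‖) := by
        gcongr
        exact (norm_weylQuant_le _).trans_eq h
    _ = ‖Λ g‖ * (‖toHilb N ψ‖ * ‖toHilb N φ‖) := by ring

/-- Weyl quantization, as a linear map from Schwartz functions to Schwartz operators. -/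
def weylQuantₗ (N : ℕ) : 𝓢(Phase N, ℂ) →ₗ[ℂ] SchwartzOperator N where
  toFun g := (⟨weylQuant g, isSchwartzOperator_of_forall fun A hA B hB => by
    obtain ⟨p, -, h⟩ := exists_norm_inner_weylQuant_le hA hB
    exact ⟨p g, h g⟩⟩ : schwartzSubmodule N)
  map_add' f g := SchwartzOperator.toCLM_injective (weylQuant_add f g)
  map_smul' c g := SchwartzOperator.toCLM_injective (weylQuant_smul c g)

theorem continuous_weylQuantₗ : Continuous (weylQuantₗ N) :=
  continuous_of_formValues _ fun _ hA _ hB => exists_norm_inner_weylQuant_le hA hB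

end Quantization

/-! ### The Weyl transform and Weyl quantization are inverse to each other -/

section Inversion

variable {N : ℕ}

theorem inner_weylOp_neg_right (u v : Hilb N) (x : Phase N) :
    ⟪u, weylOp (-x) v⟫_ℂ = ⟪weylOp x u, v⟫_ℂ := by
  rw [← inner_weylOp_neg, neg_neg]

/-- W(z) is moved to the left entry, where W(−z)W(x) is a phase times W(x − z) on the fixed vector
`vac N`; strong continuity on that vector then gives joint continuity. -/
theorem continuous_inner_coh_weylOp (T : Hilb N →L[ℂ] Hilb N) :
    Continuous fun p : Phase N × Phase N =>
      ⟪toHilb N (coh p.1), weylOp p.2 (T (toHilb N (coh p.1)))⟫_ℂ := by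
  have h1 : Continuous fun p : Phase N × Phase N => T (toHilb N (coh p.1)) :=
    (continuous_apply_coh T).comp continuous_fst
  have h2 : Continuous fun p : Phase N × Phase N => weylOp (-p.2 + p.1) (toHilb N (vac N)) :=
    (continuous_weylOp _).comp (continuous_snd.neg.add continuous_fst)
  have h3 : Continuous fun p : Phase N × Phase N => symp (-p.2) p.1 := by
    unfold symp
    fun_prop
  have h4 : ∀ p : Phase N × Phase N, ⟪toHilb N (coh p.1), weylOp p.2 (T (toHilb N (coh p.1)))⟫_ℂ =
      ⟪Complex.exp (Complex.I / 2 * symp (-p.2) p.1) • weylOp (-p.2 + p.1) (toHilb N (vac N)),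
        T (toHilb N (coh p.1))⟫_ℂ := fun p => by
    rw [← weylOp_weylOp, ← toHilb_coh, inner_weylOp_neg]
  simp_rw [h4]
  exact (((Complex.continuous_exp.comp (continuous_const.mul
    (Complex.continuous_ofReal.comp h3))).smul h2)).inner h1

/-- Inserting the coherent state formula for the trace and integrating over `x` first, orthogonality
leaves ∫ ⟨u, T W(y)g⟩⟨W(y)g, v⟩ dy, which is ⟨u, T v⟩. -/
theorem weylQuant_weylSchwartz (T : SchwartzOperator N) :
    weylQuant (weylSchwartz N T) = T.toCLM := by
  refine ContinuousLinearMap.ext fun v => ext_inner_left ℂ fun u => ?_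
  let f : Phase N → Phase N → ℂ := fun y x => (starRingEnd ℂ) ⟪v, weylOp x u⟫_ℂ *
    ⟪toHilb N (coh y), weylOp x (T.toCLM (toHilb N (coh y)))⟫_ℂ
  have hc : Continuous fun p : Phase N × Phase N => (starRingEnd ℂ) ⟪v, weylOp p.2 u⟫_ℂ :=
    Complex.continuous_conj.comp ((continuous_coeff v u).comp continuous_snd)
  have hf : AEStronglyMeasurable (Function.uncurry f) ((phaseMeasure N).prod (phaseMeasure N)) :=
    (hc.mul (continuous_inner_coh_weylOp T.toCLM)).aestronglyMeasurable
  have h0 := integrable_norm_pow_mul_coh T 0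
  simp only [pow_zero, one_mul] at h0
  have hy : ∀ y, Integrable (f y) (phaseMeasure N) := fun y =>
    integrable_coeff_mul v u (toHilb N (coh y)) (T.toCLM (toHilb N (coh y)))
  have hint : Integrable (Function.uncurry f) ((phaseMeasure N).prod (phaseMeasure N)) := by
    refine (integrable_prod_iff hf).2 ⟨.of_forall hy, ?_⟩
    refine (h0.const_mul (‖v‖ * ‖u‖)).mono' hf.norm.integral_prod_right' (.of_forall fun y => ?_)
    rw [Real.norm_of_nonneg (integral_nonneg fun _ => norm_nonneg _)]
    have h1 := integral_norm_coeff_mul_le v u (toHilb N (coh y)) (T.toCLM (toHilb N (coh y)))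
    rw [norm_coh, one_mul] at h1
    refine (integral_congr_ae (.of_forall fun x => ?_)).trans_le h1
    simp only [Function.uncurry_apply_pair, f, norm_mul, RCLike.norm_conj]
  have h2 : ∀ x, weylSchwartz N T x * ⟪u, weylOp (-x) v⟫_ℂ = ∫ y, f y x ∂(phaseMeasure N) :=
    fun x => by
      rw [integral_const_mul, ← weylFun_eq_integral, weylSchwartz_apply, inner_weylOp_neg_right,
        inner_conj_symm, mul_comm]
  rw [inner_weylQuant]
  simp_rw [h2]
  rw [← integral_integral_swap hint, (isNuclear_coh T).inner_eq]
  congr 1 with y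
  rw [integral_coeff_mul, mul_comm, mul_comm]

theorem inner_weylOp_conj (a x : Phase N) (u v : Hilb N) :
    ⟪weylOp a u, weylOp (-x) (weylOp a v)⟫_ℂ =
      Complex.exp (Complex.I * symp a x) * ⟪u, weylOp (-x) v⟫_ℂ := by
  rw [← inner_weylOp_neg_right, weylOp_weylOp (-x) a, map_smul, weylOp_weylOp, smul_smul,
    inner_smul_right, ← Complex.exp_add, show -a + (-x + a) = -x by abel]
  congr 2
  have h : symp (-x) a + symp (-a) (-x + a) = 2 * symp a x := by
    simp only [symp, Prod.fst_neg, Prod.snd_neg, Prod.fst_add, Prod.snd_add, inner_neg_left,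
      inner_neg_right, inner_add_right, real_inner_comm a.1 x.2, real_inner_comm a.2 x.1,
      real_inner_comm a.1 a.2]
    ring
  have h' : (symp (-x) a : ℂ) + symp (-a) (-x + a) = 2 * symp a x := by exact_mod_cast h
  linear_combination (Complex.I / 2) * h'

/-- A continuous integrable function whose symplectic Fourier transform vanishes is zero. -/
theorem eq_zero_of_integral_exp_symp {k : Phase N → ℂ} (hc : Continuous k) (hi : Integrable k)
    (h : ∀ a, ∫ x, Complex.exp (Complex.I * symp a x) * k x = 0) : k = 0 := by
  -- The Fourier transform needs an inner product space, so phase space is given its Euclidean norm;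
  -- this does not change the volume.
  have hp := WithLp.volume_preserving_symm_measurableEquiv_toLp_prod (Config N) (Config N)
  let k' : WithLp 2 (Phase N) → ℂ := fun w => k (WithLp.ofLp w)
  have hc' : Continuous k' := hc.comp (WithLp.prod_continuous_ofLp 2 _ _)
  have hi' : Integrable k' := hp.integrable_comp_of_integrable hi
  have hF : FourierTransform.fourier k' = 0 := by
    funext w
    rw [Real.fourier_eq', Pi.zero_apply,
      -- The point a is chosen so that σ(a, y) = −2π⟨y, w⟩.
      ← h (((2 * Real.pi) • (WithLp.ofLp w).2, -(2 * Real.pi) • (WithLp.ofLp w).1) : Phase N),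
      ← hp.integral_comp']
    congr 1 with y
    rw [smul_eq_mul]
    congr 2
    have h1 : symp (((2 * Real.pi) • (WithLp.ofLp w).2, -(2 * Real.pi) • (WithLp.ofLp w).1) :
        Phase N) (WithLp.ofLp y) = -2 * Real.pi * ⟪y, w⟫_ℝ := by
      rw [WithLp.prod_inner_apply, symp, inner_smul_left, inner_smul_left,
        real_inner_comm (WithLp.ofLp y).1, real_inner_comm (WithLp.ofLp y).2]
      simp
      ring
    rw [mul_comm, ← h1]
    rfl
  have h2 := hc'.fourierInv_fourier_eq hi' (by rw [hF]; exact integrable_zero _ _ _)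
  funext x
  have h3 : k x = k' (WithLp.toLp 2 x) := rfl
  rw [h3, ← h2, hF, Real.fourierInv_eq']
  simp

/-- Testing against W(a)u and W(a)v brings out the character e^{iσ(a, x)}, so the symplectic Fourier
transform of h(x)⟨u, W(−x)v⟩ vanishes and with it the function. The choice v = W(x)u with a unit
vector u isolates h(x). -/
theorem weylQuant_eq_zero {h : 𝓢(Phase N, ℂ)} (hh : weylQuant h = 0) : h = 0 := by
  have hpi : ((2 * Real.pi) ^ N)⁻¹ ≠ 0 := by positivity
  have h1 : ∀ u v : Hilb N, (fun x => h x * ⟪u, weylOp (-x) v⟫_ℂ) = 0 := fun u v => by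
    refine eq_zero_of_integral_exp_symp (h.continuous.mul (continuous_const.inner
      (continuous_weylOp_neg v))) ?_ fun a => ?_
    · refine (integrable_smul_measure ?_ ENNReal.ofReal_ne_top).1 (integrable_mul_coeff h u v)
      exact (ENNReal.ofReal_pos.2 (by positivity)).ne'
    · have h2 := inner_weylQuant h (weylOp a u) (weylOp a v)
      rw [hh, zero_apply, inner_zero_right, phaseMeasure, integral_smul_measure,
        ENNReal.toReal_ofReal (by positivity), eq_comm, smul_eq_zero] at h2
      rw [← h2.resolve_left hpi]
      congr 1 with x
      rw [inner_weylOp_conj]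
      ring
  refine SchwartzMap.ext fun x => ?_
  have h2 := congrFun (h1 (toHilb N (vac N)) (weylOp x (toHilb N (vac N)))) x
  beta_reduce at h2
  rw [weylOp_neg_weylOp, inner_self_eq_norm_sq_to_K, norm_vac] at h2
  simpa using h2

/-- The Weyl transform, as a topological isomorphism from Schwartz operators to Schwartz
functions. -/
def weylEquiv (N : ℕ) : SchwartzOperator N ≃L[ℂ] 𝓢(Phase N, ℂ) :=
  have h : ∀ T, weylQuantₗ N (weylSchwartz N T) = T := fun T =>
    SchwartzOperator.toCLM_injective (weylQuant_weylSchwartz T)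
  ContinuousLinearEquiv.equivOfInverse (weylSchwartz N)
    { toLinearMap := weylQuantₗ N, cont := continuous_weylQuantₗ } h fun g => by
    -- One-sided inversion and injectivity of quantization give the other side: transforming and
    -- quantizing again does not change the quantization of `g`.
    refine sub_eq_zero.1 (weylQuant_eq_zero ?_)
    have h1 := map_sub (weylQuantₗ N) (weylSchwartz N (weylQuantₗ N g)) g
    rw [h, sub_self] at h1
    exact congrArg SchwartzOperator.toCLM h1

theorem weylEquiv_apply (T : SchwartzOperator N) (z : Phase N) :
    weylEquiv N T z = weylFun T.toCLM z := rfl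

theorem weylHS_toCLM_ae (T : SchwartzOperator N) :
    weylHS T.toCLM =ᵐ[phaseMeasure N] weylEquiv N T :=
  coeFn_weylHS_of_isTraceClass T.isTraceClass

/-- A Hilbert–Schmidt operator is a Schwartz operator if and only if its Weyl transform is a
Schwartz function. -/
theorem isSchwartzOperator_iff {T : Hilb N →L[ℂ] Hilb N} (hT : IsHilbertSchmidt T) :
    IsSchwartzOperator T ↔ ∃ g : 𝓢(Phase N, ℂ), weylHS T =ᵐ[phaseMeasure N] g := by
  constructor
  · intro h
    exact ⟨_, weylHS_toCLM_ae (⟨T, h⟩ : schwartzSubmodule N)⟩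
  · rintro ⟨g, hg⟩
    -- `S` is a Schwartz operator with the same Weyl transform as `T`, hence equal to `T` by
    -- injectivity on Hilbert–Schmidt operators.
    let S := (weylEquiv N).symm g
    have h1 := weylHS_toCLM_ae S
    rw [ContinuousLinearEquiv.apply_symm_apply] at h1
    rw [← weylHS_injective S.isHilbertSchmidt hT (Lp.ext (h1.trans hg.symm))]
    exact S.isSchwartz

end Inversion

end

end QuantumHA

theorem mainTheorem4 (N : ℕ) :
    (∀ T : QuantumHA.Hilb N →L[ℂ] QuantumHA.Hilb N, QuantumHA.IsHilbertSchmidt T →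
      ∃ f : MeasureTheory.Lp ℂ 2 (QuantumHA.phaseMeasure N), QuantumHA.IsWeylTransform T f ∧
        (QuantumHA.IsSchwartzOperator T ↔
          ∃ g : 𝓢(QuantumHA.Phase N, ℂ), f =ᵐ[QuantumHA.phaseMeasure N] g)) ∧
    ∃ Φ : QuantumHA.SchwartzOperator N ≃L[ℂ] 𝓢(QuantumHA.Phase N, ℂ),
      ∀ T : QuantumHA.SchwartzOperator N,
        QuantumHA.IsHilbertSchmidt T.toCLM ∧
        QuantumHA.IsTraceClass T.toCLM ∧
        (∀ x : QuantumHA.Phase N, Φ T x = QuantumHA.opTrace (QuantumHA.weylOp x ∘L T.toCLM)) ∧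
        ∃ f : MeasureTheory.Lp ℂ 2 (QuantumHA.phaseMeasure N),
          QuantumHA.IsWeylTransform T.toCLM f ∧ f =ᵐ[QuantumHA.phaseMeasure N] Φ T :=
  ⟨fun T hT => ⟨QuantumHA.weylHS T, QuantumHA.isWeylTransform_weylHS hT,
      QuantumHA.isSchwartzOperator_iff hT⟩,
    QuantumHA.weylEquiv N, fun T => ⟨T.isHilbertSchmidt, T.isTraceClass,
      QuantumHA.weylEquiv_apply T, QuantumHA.weylHS T.toCLM,
      QuantumHA.isWeylTransform_weylHS T.isHilbertSchmidt, QuantumHA.weylHS_toCLM_ae T⟩⟩
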